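/- Notation. $\mathrm{Sp}(2n,\mathbb R)$ is the real symplectic group of $\mathbb R^{2n}=\mathbb R^n\oplus\mathbb R^n$, and $\mathrm{ASp}(2n,\mathbb R)=\mathrm{Sp}(2n,\mathbb R)\ltimes\mathbb R^{2n}$ is the group of affine symplectic maps $$g=\begin{pmatrix}a&b&r\\c&d&s\\0&0&1\end{pmatrix}:\ (x,y)\mapsto(ax+by+r,\;cx+dy+s).$$ It is represented in $L^2(\mathbb R^{2n})$ by $T(g)f(v)=f(gv)$, so $T(gh)=T(h)T(g)$. Let $\mathcal Z^{+}(n)$ (resp. $\mathcal Z^-(n)$) be the set of complex symmetric $n\times n$ matrices with positive (resp. negative) definite imaginary part, and $\mathcal{AZ}^\pm(n)=\mathcal Z^\pm(n)\times\mathbb C^n$. The group acts on $\mathcal{AZ}^\pm(n)$ by $g(P,\pi)=(P',\,a\pi+r-P'(c\pi+s))$, $P'=(aP+b)(cP+d)^{-1}$. For $\varphi,\psi\in L^2(\mathbb R^n)$ put $$K^{+}\varphi(P,\pi)=(2\pi)^{-n/4}\int_{\mathbb R^n}\varphi(u)\,e^{\frac i2u^tPu+\frac i{\sqrt2}u^t\pi}\,du,\qquad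 K^{-}\psi(Q,\varkappa)=(2\pi)^{-n/4}\int_{\mathbb R^n}\psi(v)\,e^{-\frac i2v^tQv-\frac i{\sqrt2}v^t\varkappa}\,dv$$ for $(P,\pi)\in\mathcal{AZ}^+(n)$, $(Q,\varkappa)\in\mathcal{AZ}^-(n)$. Let $\mathcal H^\pm$ be the image of $L^2(\mathbb R^n)$ under $K^\pm$, with the transported Hilbert norm. Then $\mathcal H^+\otimes\mathcal H^-$ is realized as the image of $L^2(\mathbb R^n)\otimes L^2(\mathbb R^n)=L^2(\mathbb R^n\times\mathbb R^n)$ under $K^+\otimes K^-$, a space of functions $F(P,\pi;Q,\varkappa)$ on $\mathcal{AZ}^+(n)\times\mathcal{AZ}^-(n)$ with the transported norm. For $g\in\mathrm{ASp}(2n,\mathbb R)$ let $h$ be a continuous branch of $\det(cP+d)^{-1/2}$ on $\mathcal Z^+(n)$, and put $$E_g(P,\pi)=-\tfrac14\pi^t(cP+d)^{-1}c\,\pi+\tfrac14s^tP's-\tfrac12s^t(a\pi-P'c\pi).$$ The representation in $\mathcal H^+\otimes\mathcal H^-$ is $$S(g)F(P,\pi;Q,\varkappa)=h(P)\,\overline{h(\overline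 Q)}\;e^{iE_g(P,\pi)-iE_g(Q,\varkappa)}\,F\bigl(g(P,\pi);g(Q,\varkappa)\bigr),$$ which does not depend on the choice of the sign of $h$. Theorem. A branch $h$ exists for every $g$. For $f\in L^2(\mathbb R^{2n})$, $(P,\pi)\in\mathcal{AZ}^+(n)$, $(Q,\varkappa)\in\mathcal{AZ}^-(n)$, the integral $$\mathfrak Jf(P,\pi;Q,\varkappa)=\frac{\det\bigl[(-i(P-Q))^{-1/2}\bigr]}{(2\pi)^n}\int_{\mathbb R^{2n}}f(x,y)\,\exp\Bigl\{-\frac i2\,w^t\begin{pmatrix}2(P-Q)^{-1}&(P-Q)^{-1}(P+Q)\\(P+Q)(P-Q)^{-1}&-2(P^{-1}-Q^{-1})^{-1}\end{pmatrix}w+\frac i2\,y^t(\pi-\varkappa)\Bigr\}\,dx\,dy,$$ $$w=\begin{pmatrix}\frac{\pi+\varkappa}2-x\\ y\end{pmatrix},$$ converges absolutely, where $\det[A^{-1/2}]$ is the product of the principal values $\lambda^{-1/2}$ over the eigenvalues $\lambda$ of $A$ (with multiplicities). The functions $\mathfrak Jf$ are holomorphic on $\mathcal{AZ}^+(n)\times\mathcal{AZ}^-(n)$,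 and $\mathfrak J$ is a linear bijection of $L^2(\mathbb R^{2n})$ onto $\mathcal H^+\otimes\mathcal H^-$ with $\|\mathfrak Jf\|=(4\pi)^{-n/2}\|f\|$, that is, unitary up to this constant factor. It intertwines the two representations: $\mathfrak J\,T(g)=S(g)\,\mathfrak J$ for all $g\in\mathrm{ASp}(2n,\mathbb R)$. Every bounded linear operator $L^2(\mathbb R^{2n})\to\mathcal H^+\otimes\mathcal H^-$ that intertwines them is a scalar multiple of $\mathfrak J$. -/

import Mathlib

open Matrix MeasureTheory

noncomputable section

namespace SiegelWeil

/-! ### The phase space `ℝ²ⁿ` and the affine symplectic group -/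

/-- `ℝ²ⁿ = ℝⁿ ⊕ ℝⁿ`; the point `(x, y)` has `x i = v (inl i)` and `y i = v (inr i)`. -/
abbrev Phase (n : ℕ) : Type := Fin n ⊕ Fin n → ℝ

/-- The Hilbert space `L²(ℝ²ⁿ)` for Lebesgue measure. -/
abbrev L2 (n : ℕ) : Type := Lp ℂ 2 (volume : Measure (Phase n))

/-- `ASp(2n, ℝ) = Sp(2n, ℝ) ⋉ ℝ²ⁿ`: the element with linear part `lin` and translation part
`trans` is the affine map `v ↦ lin v + trans`. -/
@[ext] structure ASp (n : ℕ) where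
  lin : Matrix.symplecticGroup (Fin n) ℝ
  trans : Phase n

namespace ASp

variable {n : ℕ}

instance : Mul (ASp n) := ⟨fun g h => ⟨g.lin * h.lin, g.lin.1 *ᵥ h.trans + g.trans⟩⟩
instance : One (ASp n) := ⟨⟨1, 0⟩⟩
instance : Inv (ASp n) := ⟨fun g => ⟨g.lin⁻¹, -((g.lin⁻¹).1 *ᵥ g.trans)⟩⟩

@[simp] theorem mul_lin (g h : ASp n) : (g * h).lin = g.lin * h.lin := rfl
@[simp] theorem mul_trans (g h : ASp n) :
    (g * h).trans = g.lin.1 *ᵥ h.trans + g.trans := rfl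
@[simp] theorem one_lin : (1 : ASp n).lin = 1 := rfl
@[simp] theorem one_trans : (1 : ASp n).trans = 0 := rfl
@[simp] theorem inv_lin (g : ASp n) : (g⁻¹).lin = (g.lin)⁻¹ := rfl
@[simp] theorem inv_trans (g : ASp n) : (g⁻¹).trans = -((g.lin⁻¹).1 *ᵥ g.trans) := rfl

/-- The group law is composition of affine maps. -/
instance : Group (ASp n) :=
  Group.ofLeftAxioms
    (fun g h k => by
      ext1
      · simp [mul_assoc]
      · simp [Matrix.mulVec_add, add_assoc])
    (fun g => by
      ext1
      · simp
      · simp)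
    (fun g => by
      ext1
      · simp
      · simp)

instance : MulAction (ASp n) (Phase n) where
  smul g v := g.lin.1 *ᵥ v + g.trans
  one_smul v := by
    change (1 : Matrix (Fin n ⊕ Fin n) (Fin n ⊕ Fin n) ℝ) *ᵥ v + 0 = v
    simp
  mul_smul g h v := by
    change (g.lin.1 * h.lin.1) *ᵥ v + (g.lin.1 *ᵥ h.trans + g.trans)
      = g.lin.1 *ᵥ (h.lin.1 *ᵥ v + h.trans) + g.trans
    simp [Matrix.mulVec_add, add_assoc]

theorem smul_def (g : ASp n) (v : Phase n) : g • v = g.lin.1 *ᵥ v + g.trans := rfl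

theorem measurePreserving_smul (g : ASp n) :
    MeasurePreserving (fun v : Phase n => g • v) volume volume := by
  have hdet : g.lin.1.det = 1 := SymplecticGroup.det_eq_one g.lin.2
  have h1 : MeasurePreserving (Matrix.toLin' g.lin.1) (volume : Measure (Phase n)) volume := by
    refine ⟨(LinearMap.continuous_of_finiteDimensional _).measurable, ?_⟩
    rw [Real.map_matrix_volume_pi_eq_smul_volume_pi (by rw [hdet]; exact one_ne_zero), hdet]
    simp
  exact (measurePreserving_add_right (volume : Measure (Phase n)) g.trans).comp h1

/-- The unitary representation of `ASp(2n, ℝ)` in `L²(ℝ²ⁿ)` by changes of variables,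
`T(g) f (v) = f (g v)`, so that `T(g h) = T(h) T(g)`. -/
def repL2 (g : ASp n) : L2 n →ₗᵢ[ℂ] L2 n :=
  Lp.compMeasurePreservingₗᵢ ℂ (fun v : Phase n => g • v) g.measurePreserving_smul

/-! The blocks of `g = (a b r; c d s; 0 0 1)`, with entries regarded as complex numbers. -/

def a (g : ASp n) : Matrix (Fin n) (Fin n) ℂ := g.lin.1.toBlocks₁₁.map Complex.ofReal
def b (g : ASp n) : Matrix (Fin n) (Fin n) ℂ := g.lin.1.toBlocks₁₂.map Complex.ofReal
def c (g : ASp n) : Matrix (Fin n) (Fin n) ℂ := g.lin.1.toBlocks₂₁.map Complex.ofReal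
def d (g : ASp n) : Matrix (Fin n) (Fin n) ℂ := g.lin.1.toBlocks₂₂.map Complex.ofReal
def r (g : ASp n) : Fin n → ℂ := fun i => (g.trans (Sum.inl i) : ℂ)
def s (g : ASp n) : Fin n → ℂ := fun i => (g.trans (Sum.inr i) : ℂ)

/-- `c P + d`. -/
def den (g : ASp n) (P : Matrix (Fin n) (Fin n) ℂ) : Matrix (Fin n) (Fin n) ℂ :=
  g.c * P + g.d

/-- `(a P + b) (c P + d)⁻¹`. -/
def moebius (g : ASp n) (P : Matrix (Fin n) (Fin n) ℂ) : Matrix (Fin n) (Fin n) ℂ :=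
  (g.a * P + g.b) * (g.den P)⁻¹

/-- `a π + r - (a P + b) (c P + d)⁻¹ (c π + s)`. -/
def moebiusVec (g : ASp n) (P : Matrix (Fin n) (Fin n) ℂ) (p : Fin n → ℂ) : Fin n → ℂ :=
  g.a *ᵥ p + g.r - g.moebius P *ᵥ (g.c *ᵥ p + g.s)

end ASp

/-! ### Siegel half-planes -/

variable {n : ℕ}

/-- `Z⁺(n)`: complex symmetric matrices with positive definite imaginary part. -/
def siegelUpper (n : ℕ) : Set (Matrix (Fin n) (Fin n) ℂ) :=
  {P | P.IsSymm ∧ (P.map Complex.im).PosDef}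

/-- `Z⁻(n)`: complex symmetric matrices with negative definite imaginary part. -/
def siegelLower (n : ℕ) : Set (Matrix (Fin n) (Fin n) ℂ) :=
  {Q | Q.IsSymm ∧ (-(Q.map Complex.im)).PosDef}

/-- `AZ⁺(n) = Z⁺(n) × ℂⁿ`. -/
abbrev AZpos (n : ℕ) : Type := siegelUpper n × (Fin n → ℂ)

/-- `AZ⁻(n) = Z⁻(n) × ℂⁿ`. -/
abbrev AZneg (n : ℕ) : Type := siegelLower n × (Fin n → ℂ)

theorem map_conj_mem_upper {Q : Matrix (Fin n) (Fin n) ℂ} (hQ : Q ∈ siegelLower n) :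
    Q.map (starRingEnd ℂ) ∈ siegelUpper n := by
  refine ⟨hQ.1.map _, ?_⟩
  have : (Q.map (starRingEnd ℂ)).map Complex.im = -(Q.map Complex.im) := by ext i j; simp
  rw [this]; exact hQ.2

theorem map_conj_mem_lower {Q : Matrix (Fin n) (Fin n) ℂ} (hQ : Q ∈ siegelUpper n) :
    Q.map (starRingEnd ℂ) ∈ siegelLower n := by
  refine ⟨hQ.1.map _, ?_⟩
  have : -((Q.map (starRingEnd ℂ)).map Complex.im) = Q.map Complex.im := by ext i j; simp
  rw [this]; exact hQ.2

/-- Complex conjugation `Z⁻(n) → Z⁺(n)`, `Q ↦ Q̄`. -/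
def conjLower (Q : siegelLower n) : siegelUpper n :=
  ⟨Q.1.map (starRingEnd ℂ), map_conj_mem_upper Q.2⟩

/-! ### The action of `ASp(2n, ℝ)` on `AZ⁺(n)` and `AZ⁻(n)` -/

theorem im_quadratic {P : Matrix (Fin n) (Fin n) ℂ} (hP : P ∈ siegelUpper n) {w : Fin n → ℂ}
    (hw : w ≠ 0) : 0 < (star w ⬝ᵥ P *ᵥ w).im := by
  have hsymm : ∀ i j, P j i = P i j := fun i j => hP.1.apply i j
  have key : (star w ⬝ᵥ P *ᵥ w).im
      = (fun i => (w i).re) ⬝ᵥ (P.map Complex.im) *ᵥ (fun i => (w i).re)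
        + (fun i => (w i).im) ⬝ᵥ (P.map Complex.im) *ᵥ (fun i => (w i).im) := by
    have h2 : ∑ i, ∑ j, ((w i).re * (P i j).re * (w j).im - (w i).im * (P i j).re * (w j).re)
        = 0 := by
      simp only [Finset.sum_sub_distrib]
      rw [sub_eq_zero, Finset.sum_comm]
      refine Finset.sum_congr rfl fun i _ => Finset.sum_congr rfl fun j _ => ?_
      rw [hsymm i j]; ring
    rw [← add_zero ((fun i => (w i).re) ⬝ᵥ _ + _), ← h2]
    simp only [dotProduct, mulVec, Finset.mul_sum, Complex.im_sum, ← Finset.sum_add_distrib,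
      Matrix.map_apply, Pi.star_apply]
    refine Finset.sum_congr rfl fun i _ => Finset.sum_congr rfl fun j _ => ?_
    simp
    ring
  rw [key]
  have hnn : ∀ x : Fin n → ℝ, 0 ≤ x ⬝ᵥ (P.map Complex.im) *ᵥ x := fun x => by
    simpa using hP.2.posSemidef.dotProduct_mulVec_nonneg x
  have hpos : ∀ x : Fin n → ℝ, x ≠ 0 → 0 < x ⬝ᵥ (P.map Complex.im) *ᵥ x := fun x hx => by
    simpa using hP.2.dotProduct_mulVec_pos hx
  by_cases hre : (fun i => (w i).re) = 0
  · have him : (fun i => (w i).im) ≠ 0 := by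
      intro h
      apply hw
      funext i
      exact Complex.ext (congrFun hre i) (congrFun h i)
    exact add_pos_of_nonneg_of_pos (hnn _) (hpos _ him)
  · exact add_pos_of_pos_of_nonneg (hpos _ hre) (hnn _)

namespace ASp

theorem block_relations (g : ASp n) :
    g.aᵀ * g.c = g.cᵀ * g.a ∧ g.bᵀ * g.d = g.dᵀ * g.b ∧ g.aᵀ * g.d - g.cᵀ * g.b = 1 := by
  have h := g.lin.2
  rw [← Matrix.fromBlocks_toBlocks g.lin.1] at h
  obtain ⟨h1, h2, h3⟩ := SymplecticGroup.fromBlocks_mem_iff.1 h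
  have m : ∀ X Y : Matrix (Fin n) (Fin n) ℝ,
      (X * Y).map Complex.ofReal = X.map Complex.ofReal * Y.map Complex.ofReal :=
    fun X Y => Matrix.map_mul (f := Complex.ofRealHom)
  refine ⟨?_, ?_, ?_⟩
  · have := congrArg (fun X => X.map Complex.ofReal) h1
    simp only [m] at this
    exact this
  · have := congrArg (fun X => X.map Complex.ofReal) h2
    simp only [m] at this
    exact this
  · have := congrArg (fun X => X.map Complex.ofReal) h3
    simp only [Matrix.map_sub _ Complex.ofReal_sub, m,
      Matrix.map_one _ Complex.ofReal_zero Complex.ofReal_one] at this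
    exact this

theorem real_blocks (g : ASp n) :
    g.aᴴ = g.aᵀ ∧ g.bᴴ = g.bᵀ ∧ g.cᴴ = g.cᵀ ∧ g.dᴴ = g.dᵀ := by
  refine ⟨?_, ?_, ?_, ?_⟩ <;> ext i j <;> simp [a, b, c, d]

theorem num_den_symm (g : ASp n) {P : Matrix (Fin n) (Fin n) ℂ} (hP : P.IsSymm) :
    (g.a * P + g.b)ᵀ * g.den P = (g.den P)ᵀ * (g.a * P + g.b) := by
  obtain ⟨h1, h2, h3⟩ := g.block_relations
  have h4 : g.dᵀ * g.a - g.bᵀ * g.c = 1 := by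
    have := congrArg Matrix.transpose h3
    simpa using this
  have hP' : Pᵀ = P := hP
  have e : (g.a * P + g.b)ᵀ * g.den P - (g.den P)ᵀ * (g.a * P + g.b)
      = P * (g.aᵀ * g.c - g.cᵀ * g.a) * P + P * (g.aᵀ * g.d - g.cᵀ * g.b)
        - (g.dᵀ * g.a - g.bᵀ * g.c) * P + (g.bᵀ * g.d - g.dᵀ * g.b) := by
    simp only [den, transpose_add, transpose_mul, hP']
    noncomm_ring
  rw [← sub_eq_zero, e, h1, h2, h3, h4]
  simp

theorem num_den_herm (g : ASp n) {P : Matrix (Fin n) (Fin n) ℂ} :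
    (g.den P)ᴴ * (g.a * P + g.b) - ((g.den P)ᴴ * (g.a * P + g.b))ᴴ = P - Pᴴ := by
  obtain ⟨h1, h2, h3⟩ := g.block_relations
  obtain ⟨r1, r2, r3, r4⟩ := g.real_blocks
  have t3 : g.cᵀᴴ = g.c := by rw [← r3, conjTranspose_conjTranspose]
  have t4 : g.dᵀᴴ = g.d := by rw [← r4, conjTranspose_conjTranspose]
  have h4 : g.dᵀ * g.a - g.bᵀ * g.c = 1 := by
    have := congrArg Matrix.transpose h3
    simpa using this
  have e : (g.den P)ᴴ * (g.a * P + g.b) - ((g.den P)ᴴ * (g.a * P + g.b))ᴴ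
      = (g.dᵀ * g.a - g.bᵀ * g.c) * P - Pᴴ * (g.aᵀ * g.d - g.cᵀ * g.b)
        - Pᴴ * (g.aᵀ * g.c - g.cᵀ * g.a) * P - (g.bᵀ * g.d - g.dᵀ * g.b) := by
    simp only [den, conjTranspose_add, conjTranspose_mul, conjTranspose_conjTranspose,
      r1, r2, r3, r4, t3, t4]
    noncomm_ring
  rw [e, h1, h2, h3, h4]
  simp

theorem im_num_den (g : ASp n) (P : Matrix (Fin n) (Fin n) ℂ) (w : Fin n → ℂ) :
    (star (g.den P *ᵥ w) ⬝ᵥ ((g.a * P + g.b) *ᵥ w)).im = (star w ⬝ᵥ P *ᵥ w).im := by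
  have im_eq : ∀ X : Matrix (Fin n) (Fin n) ℂ,
      star w ⬝ᵥ (X - Xᴴ) *ᵥ w = 2 * Complex.I * ((star w ⬝ᵥ X *ᵥ w).im : ℂ) := by
    intro X
    have h : star w ⬝ᵥ Xᴴ *ᵥ w = (starRingEnd ℂ) (star w ⬝ᵥ X *ᵥ w) := by
      rw [starRingEnd_apply, Matrix.star_dotProduct, star_mulVec,
        conjTranspose_conjTranspose, ← dotProduct_mulVec]
    rw [sub_mulVec, dotProduct_sub, h, Complex.sub_conj]
    push_cast
    ring
  have h := congrArg (fun X : Matrix (Fin n) (Fin n) ℂ => star w ⬝ᵥ X *ᵥ w)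
    (g.num_den_herm (P := P))
  simp only [im_eq] at h
  have h' := mul_left_cancel₀ (mul_ne_zero two_ne_zero Complex.I_ne_zero) h
  rw [Complex.ofReal_inj] at h'
  rw [← h', star_mulVec, ← dotProduct_mulVec, mulVec_mulVec]

theorem isUnit_det_den (g : ASp n) {P : Matrix (Fin n) (Fin n) ℂ} (hP : P ∈ siegelUpper n) :
    IsUnit (g.den P).det := by
  rw [isUnit_iff_ne_zero]
  intro h
  obtain ⟨w, hw, hw0⟩ := Matrix.exists_mulVec_eq_zero_iff.2 h
  have := im_quadratic hP hw
  rw [← g.im_num_den P w, hw0] at this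
  simp at this

theorem moebius_mem_upper (g : ASp n) {P : Matrix (Fin n) (Fin n) ℂ} (hP : P ∈ siegelUpper n) :
    g.moebius P ∈ siegelUpper n := by
  have hu := g.isUnit_det_den hP
  have hs : (g.moebius P).IsSymm := by
    have h := g.num_den_symm hP.1
    have hut : IsUnit ((g.den P)ᵀ).det := by rwa [det_transpose]
    change ((g.a * P + g.b) * (g.den P)⁻¹)ᵀ = (g.a * P + g.b) * (g.den P)⁻¹
    rw [transpose_mul, transpose_nonsing_inv]
    calc ((g.den P)ᵀ)⁻¹ * (g.a * P + g.b)ᵀ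
        = ((g.den P)ᵀ)⁻¹ * (((g.a * P + g.b)ᵀ * g.den P) * (g.den P)⁻¹) := by
          rw [mul_nonsing_inv_cancel_right _ _ hu]
      _ = (g.a * P + g.b) * (g.den P)⁻¹ := by
          rw [h, Matrix.mul_assoc, nonsing_inv_mul_cancel_left _ _ hut]
  refine ⟨hs, Matrix.PosDef.of_dotProduct_mulVec_pos ?_ ?_⟩
  · refine Matrix.IsHermitian.ext fun i j => ?_
    change (g.moebius P j i).im = (g.moebius P i j).im
    rw [hs.apply i j]
  · intro x hx
    set X : Fin n → ℂ := fun i => (x i : ℂ) with hX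
    set w : Fin n → ℂ := (g.den P)⁻¹ *ᵥ X with hw
    have hNw : g.den P *ᵥ w = X := by
      rw [hw, mulVec_mulVec, mul_nonsing_inv _ hu, one_mulVec]
    have hw0 : w ≠ 0 := by
      intro h
      apply hx
      funext i
      have := congrFun hNw i
      rw [h, mulVec_zero] at this
      simpa [hX] using this.symm
    have hLw : (g.a * P + g.b) *ᵥ w = g.moebius P *ᵥ X := by
      rw [hw, mulVec_mulVec]; rfl
    have hpos := im_quadratic hP hw0
    rw [← g.im_num_den P w, hNw, hLw] at hpos
    have e : (star X ⬝ᵥ g.moebius P *ᵥ X).im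
        = star x ⬝ᵥ (g.moebius P).map Complex.im *ᵥ x := by
      simp [dotProduct, mulVec, Complex.im_sum, hX, Finset.mul_sum]
    rwa [e] at hpos

theorem moebius_map_conj (g : ASp n) (P : Matrix (Fin n) (Fin n) ℂ) :
    g.moebius (P.map (starRingEnd ℂ)) = (g.moebius P).map (starRingEnd ℂ) := by
  have hr : ∀ X : Matrix (Fin n) (Fin n) ℝ,
      (X.map Complex.ofReal).map (starRingEnd ℂ) = X.map Complex.ofReal := by
    intro X; ext i j; simp
  have ha : g.a.map (starRingEnd ℂ) = g.a := hr _
  have hb : g.b.map (starRingEnd ℂ) = g.b := hr _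
  have hc : g.c.map (starRingEnd ℂ) = g.c := hr _
  have hd : g.d.map (starRingEnd ℂ) = g.d := hr _
  have hinv : ∀ X : Matrix (Fin n) (Fin n) ℂ,
      (X.map (starRingEnd ℂ))⁻¹ = X⁻¹.map (starRingEnd ℂ) := by
    intro X
    have h1 : X.map (starRingEnd ℂ) = Xᴴᵀ := rfl
    have h2 : X⁻¹.map (starRingEnd ℂ) = X⁻¹ᴴᵀ := rfl
    rw [h1, h2, ← transpose_nonsing_inv, conjTranspose_nonsing_inv]
  have hadd : ∀ X Y : Matrix (Fin n) (Fin n) ℂ,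
      (X + Y).map (starRingEnd ℂ) = X.map (starRingEnd ℂ) + Y.map (starRingEnd ℂ) :=
    fun X Y => Matrix.map_add _ (map_add (starRingEnd ℂ)) X Y
  simp only [moebius, den, Matrix.map_mul, hadd, ← hinv, ha, hb, hc, hd]

theorem moebius_mem_lower (g : ASp n) {Q : Matrix (Fin n) (Fin n) ℂ} (hQ : Q ∈ siegelLower n) :
    g.moebius Q ∈ siegelLower n := by
  have h := map_conj_mem_lower (g.moebius_mem_upper (map_conj_mem_upper hQ))
  rw [← moebius_map_conj] at h
  have e : (Q.map (starRingEnd ℂ)).map (starRingEnd ℂ) = Q := by ext i j; simp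
  rwa [e] at h

/-- The action on `AZ⁺(n)`:
`(P, π) ↦ ((aP+b)(cP+d)⁻¹, aπ + r - (aP+b)(cP+d)⁻¹(cπ+s))`. -/
def actPos (g : ASp n) (z : AZpos n) : AZpos n :=
  (⟨g.moebius z.1, g.moebius_mem_upper z.1.2⟩, g.moebiusVec z.1 z.2)

/-- The action on `AZ⁻(n)`, by the same formula. -/
def actNeg (g : ASp n) (z : AZneg n) : AZneg n :=
  (⟨g.moebius z.1, g.moebius_mem_lower z.1.2⟩, g.moebiusVec z.1 z.2)

end ASp

/-! ### The spaces of holomorphic functions -/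

/-- The function `exp (i/2 uᵗPu + i/√2 uᵗπ) / (2π)^(n/4)`, the integral kernel of the transform
`K⁺` from `L²(ℝⁿ)` to functions on `AZ⁺(n)`. -/
def kerPos (z : AZpos n) (u : Fin n → ℝ) : ℂ :=
  let U : Fin n → ℂ := fun i => (u i : ℂ)
  (((2 * Real.pi) ^ (-(n : ℝ) / 4) : ℝ) : ℂ) *
    Complex.exp (Complex.I / 2 * (U ⬝ᵥ z.1.1 *ᵥ U)
      + Complex.I / (Real.sqrt 2 : ℂ) * (U ⬝ᵥ z.2))

/-- The function `exp (-i/2 vᵗQv - i/√2 vᵗϰ) / (2π)^(n/4)`, the integral kernel of the transform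
`K⁻` from `L²(ℝⁿ)` to functions on `AZ⁻(n)`. -/
def kerNeg (z : AZneg n) (v : Fin n → ℝ) : ℂ :=
  let V : Fin n → ℂ := fun i => (v i : ℂ)
  (((2 * Real.pi) ^ (-(n : ℝ) / 4) : ℝ) : ℂ) *
    Complex.exp (-(Complex.I / 2 * (V ⬝ᵥ z.1.1 *ᵥ V))
      - Complex.I / (Real.sqrt 2 : ℂ) * (V ⬝ᵥ z.2))

/-- The transform `K⁺ ⊗ K⁻` of `φ ∈ L²(ℝⁿ × ℝⁿ) = L²(ℝⁿ) ⊗ L²(ℝⁿ)`. -/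
def tensorTransform (φ : L2 n) (z : AZpos n × AZneg n) : ℂ :=
  ∫ w : Phase n, φ w * (kerPos z.1 (w ∘ Sum.inl) * kerNeg z.2 (w ∘ Sum.inr))

/-- On a product `φ(u) ψ(v)` the transform is the product of `K⁺ φ` and `K⁻ ψ`. -/
theorem integral_product (φ ψ : (Fin n → ℝ) → ℂ) (z : AZpos n × AZneg n) :
    (∫ w : Phase n, (φ (w ∘ Sum.inl) * ψ (w ∘ Sum.inr)) *
        (kerPos z.1 (w ∘ Sum.inl) * kerNeg z.2 (w ∘ Sum.inr)))
      = (∫ u, φ u * kerPos z.1 u) * ∫ v, ψ v * kerNeg z.2 v := by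
  rw [← integral_prod_mul, ← Measure.volume_eq_prod,
    ← (volume_measurePreserving_sumPiEquivProdPi fun _ : Fin n ⊕ Fin n => ℝ).integral_comp']
  refine integral_congr_ae (Filter.Eventually.of_forall fun w => ?_)
  change φ (w ∘ Sum.inl) * ψ (w ∘ Sum.inr) * (kerPos z.1 (w ∘ Sum.inl) * kerNeg z.2 (w ∘ Sum.inr))
    = (φ (w ∘ Sum.inl) * kerPos z.1 (w ∘ Sum.inl)) * (ψ (w ∘ Sum.inr) * kerNeg z.2 (w ∘ Sum.inr))
  ring

/-- `H⁺ ⊗ H⁻` as a space of functions on `AZ⁺(n) × AZ⁻(n)`: as `H⁺` and `H⁻` are the images of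
`L²(ℝⁿ)` under `K⁺` and `K⁻`, it is the image of `L²(ℝⁿ) ⊗ L²(ℝⁿ)` under `K⁺ ⊗ K⁻`. -/
def HTensor (n : ℕ) : Set (AZpos n × AZneg n → ℂ) :=
  {F | ∃ φ : L2 n, tensorTransform φ = F}

/-- The Hilbert norm of `H⁺ ⊗ H⁻`, carried over from `L²(ℝⁿ) ⊗ L²(ℝⁿ)` by `K⁺ ⊗ K⁻`. -/
def hNorm (F : AZpos n × AZneg n → ℂ) : ℝ :=
  sInf {t : ℝ | ∃ φ : L2 n, tensorTransform φ = F ∧ t = ‖φ‖}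

/-- Holomorphic functions on `AZ⁺(n) × AZ⁻(n)`. The domain is an open subset of a linear subspace
(the matrices are symmetric), and differentiability is taken along the domain. -/
def IsHolomorphic (F : AZpos n × AZneg n → ℂ) : Prop :=
  ∃ G : (Matrix (Fin n) (Fin n) ℂ × (Fin n → ℂ)) × (Matrix (Fin n) (Fin n) ℂ × (Fin n → ℂ)) → ℂ,
    DifferentiableOn ℂ G {q | q.1.1 ∈ siegelUpper n ∧ q.2.1 ∈ siegelLower n} ∧
    ∀ z : AZpos n × AZneg n, G ((z.1.1.1, z.1.2), (z.2.1.1, z.2.2)) = F z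

/-! ### The representation in `H⁺ ⊗ H⁻` -/

/-- A continuous (hence holomorphic) branch `h` of `det (c P + d)^(-1/2)` on `Z⁺(n)`; there are
two of them, which differ by a sign. -/
def IsDetBranch (g : ASp n) (h : siegelUpper n → ℂ) : Prop :=
  Continuous h ∧ ∀ P : siegelUpper n, h P ^ 2 * (g.den P.1).det = 1

/-- The phase
`-¼ πᵗ(cP+d)⁻¹cπ + ¼ sᵗP's - ½ sᵗ(aπ - P'cπ)`, where `P' = (aP+b)(cP+d)⁻¹`. -/
def phase (g : ASp n) (P : Matrix (Fin n) (Fin n) ℂ) (p : Fin n → ℂ) : ℂ :=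
  -(1 / 4) * (p ⬝ᵥ ((g.den P)⁻¹ * g.c) *ᵥ p)
    + 1 / 4 * (g.s ⬝ᵥ g.moebius P *ᵥ g.s)
    - 1 / 2 * (g.s ⬝ᵥ (g.a *ᵥ p - g.moebius P *ᵥ (g.c *ᵥ p)))

/-- The operator of `g` in `H⁺ ⊗ H⁻`. In `H⁺` it is
`S(g) F (P, π) = det(cP+d)^(-1/2) exp(i phase) F(g (P, π))`, determined up to a sign; in `H⁻` it
is the complex conjugate of this operator, so the sign does not matter in the tensor product. -/
def repTensor (g : ASp n) (h : siegelUpper n → ℂ) (F : AZpos n × AZneg n → ℂ) :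
    AZpos n × AZneg n → ℂ := fun z =>
  (h z.1.1 * Complex.exp (Complex.I * phase g z.1.1 z.1.2)) *
    (starRingEnd ℂ (h (conjLower z.2.1)) * Complex.exp (-Complex.I * phase g z.2.1 z.2.2)) *
    F (g.actPos z.1, g.actNeg z.2)

/-- `L` intertwines the representations of `ASp(2n, ℝ)` in `L²(ℝ²ⁿ)` and in `H⁺ ⊗ H⁻`. -/
def Intertwines (L : L2 n →ₗ[ℂ] (AZpos n × AZneg n → ℂ)) : Prop :=
  ∀ (g : ASp n) (h : siegelUpper n → ℂ), IsDetBranch g h →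
    ∀ f : L2 n, L (g.repL2 f) = repTensor g h (L f)

/-! ### The kernel of the intertwining operator -/

/-- `det (A^(-1/2))`, for the principal branch of the power: the product of `λ^(-1/2)` over the
eigenvalues `λ` of `A`, with multiplicities. If `A` is complex symmetric with positive definite
real part, the eigenvalues have positive real part, and this is the continuous branch of
`(det A)^(-1/2)` that equals `1` at the unit matrix. -/
def detInvSqrt (A : Matrix (Fin n) (Fin n) ℂ) : ℂ :=
  (A.charpoly.roots.map fun l => l ^ (-(1 / 2) : ℂ)).prod

/-- The matrix
`(2(P-Q)⁻¹, (P-Q)⁻¹(P+Q); (P+Q)(P-Q)⁻¹, -2(P⁻¹-Q⁻¹)⁻¹)`. -/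
def kernelMatrix (P Q : Matrix (Fin n) (Fin n) ℂ) : Matrix (Fin n ⊕ Fin n) (Fin n ⊕ Fin n) ℂ :=
  Matrix.fromBlocks
    ((2 : ℂ) • (P - Q)⁻¹) ((P - Q)⁻¹ * (P + Q))
    ((P + Q) * (P - Q)⁻¹) (-((2 : ℂ) • (P⁻¹ - Q⁻¹)⁻¹))

/-- The vector `((π + ϰ)/2 - x, y)`. -/
def kernelVector (p k : Fin n → ℂ) (v : Phase n) : Fin n ⊕ Fin n → ℂ :=
  Sum.elim (fun i => (p i + k i) / 2 - (v (Sum.inl i) : ℂ)) (fun i => (v (Sum.inr i) : ℂ))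

/-- The kernel
`(2π)⁻ⁿ det[(-i(P-Q))^(-1/2)] exp(-i/2 wᵗ M w + i/2 yᵗ(π-ϰ))`, where `M` is `kernelMatrix P Q`,
and `w = ((π + ϰ)/2 - x, y)`. -/
def kernel (z : AZpos n × AZneg n) (v : Phase n) : ℂ :=
  let P : Matrix (Fin n) (Fin n) ℂ := z.1.1
  let p : Fin n → ℂ := z.1.2
  let Q : Matrix (Fin n) (Fin n) ℂ := z.2.1
  let k : Fin n → ℂ := z.2.2
  let w := kernelVector p k v
  ((2 * Real.pi : ℝ) : ℂ)⁻¹ ^ n * detInvSqrt (-(Complex.I • (P - Q))) *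
    Complex.exp (-(Complex.I / 2) * (w ⬝ᵥ kernelMatrix P Q *ᵥ w)
      + Complex.I / 2 * ∑ i, (v (Sum.inr i) : ℂ) * (p i - k i))

end SiegelWeil

end

open SiegelWeil

noncomputable section

set_option linter.unusedSectionVars false

namespace SiegelWeil

/-! ### Fourier uniqueness and Plancherel with the kernel `exp(-i v·w)` -/

open scoped FourierTransform SchwartzMap

/-! In the variables `(u, v) = (y/√2 + β, y/√2 - β)`, a Fourier transform in `β` alone turns the
kernel of `K⁺ ⊗ K⁻` into the kernel of `𝔍` (`kernel_eq_integral`). Plancherel in `β` then shows that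
the two families of conjugated kernels, indexed by `z = (P, π; Q, ϰ)`, have Gram matrices that
differ only by the factor `(4π)⁻ⁿ` (`integral_gram`). Each family is total in `L²`, because at `P =
i`, `Q = -i` it contains the standard Gaussian times every character. Hence some unitary `U` of `L²`
maps one family to the other up to the constant `(4π)^(-n/2)`, and `𝔍 = (4π)^(-n/2) (K⁺ ⊗ K⁻) U`
(`transform_eq_tensorTransform`). Bijectivity, the norm and holomorphy are inherited from `K⁺ ⊗ K⁻`.
Convergence holds because the kernel is itself a Gaussian with positive definite real part
(`im_kernelMatrix_neg`).

Intertwining is a covariance of the kernel under simultaneous motion of `z` and of the point of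
`ℝ²ⁿ` by `g` (`kernel_smul`). The exponent is a bilinear expression in the affine forms `x - Py - π`
and `x - Qy - ϰ`, which `g` multiplies by the contragredients of `cP + d` and `cQ + d`. The
remaining terms produce the phases `E_g`. For the determinant factor, `(cQ+d)ᵗ (P'-Q') (cP+d) = P -
Q` gives equality of squares; the sign is settled by connectedness of `Z⁻(n)`, starting from `Q =
P̄`, where both sides are positive (`detInvSqrt_eq`). The same identity with `Q = -i` fixed exhibits
a branch `h`.

For uniqueness, a bounded intertwiner is `𝔍 B` with `B` bounded and commuting with every `T(g)`. The
involution of `L²` corresponding to `v ↦ -v` in the second tensor factor commutes with the linear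
symplectic substitutions and exchanges translations with multiplications by characters. Conjugated
by it, `B` commutes with all characters, so it is multiplication by a function
(`gauss_mul_eq_of_commute_modulate`). This function is invariant under the shears `y ↦ y + tx` and
`x ↦ x + ty` with diagonal `t`, hence constant almost everywhere (`exists_ae_eq_const_of_shear`). -/

/-- Every Schwartz function is the Fourier transform of a Schwartz function, so the multiplication
formula `∫ f̂ g = ∫ f ĝ` makes `f` orthogonal to all of them, in particular to all test functions.
-/
theorem ae_eq_zero_of_fourier_eq_zero {E : Type*} [NormedAddCommGroup E] [InnerProductSpace ℝ E]
    [FiniteDimensional ℝ E] [MeasurableSpace E] [BorelSpace E] {f : E → ℂ} (hf : Integrable f)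
    (h : ∀ w, 𝓕 f w = 0) : f =ᵐ[volume] 0 := by
  have key : ∀ g : 𝓢(E, ℂ), ∫ x, f x * g x = 0 := by
    intro g
    have h1 := VectorFourier.integral_fourierIntegral_smul_eq_flip (L := innerₗ E) (μ := volume)
      (ν := volume) (f := f) (g := ⇑(𝓕⁻ g : 𝓢(E, ℂ))) Real.continuous_fourierChar continuous_inner hf
      (𝓕⁻ g : 𝓢(E, ℂ)).integrable
    have h2 : ∀ x, VectorFourier.fourierIntegral Real.fourierChar volume (innerₗ E).flip
        (⇑(𝓕⁻ g : 𝓢(E, ℂ))) x = g x := by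
      intro x
      have : 𝓕 (𝓕⁻ g : 𝓢(E, ℂ)) = g := FourierTransform.fourier_fourierInv_eq g
      conv_rhs => rw [← this, SchwartzMap.fourier_coe]
      simp [Real.fourier_eq, VectorFourier.fourierIntegral]
    have h3 : ∀ x, VectorFourier.fourierIntegral Real.fourierChar volume (innerₗ E) f x = 0 := h
    simp only [h2, h3, smul_eq_mul, zero_mul, integral_zero] at h1
    exact h1.symm
  refine ae_eq_zero_of_integral_contDiff_smul_eq_zero hf.locallyIntegrable fun g hg hc => ?_
  have hg' : ContDiff ℝ (⊤ : ℕ∞) (fun x => (g x : ℂ)) := Complex.ofRealCLM.contDiff.comp hg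
  have hc' : HasCompactSupport (fun x => (g x : ℂ)) := hc.comp_left (g := fun t : ℝ => (t : ℂ)) rfl
  rw [← key (hc'.toSchwartzMap hg')]
  refine integral_congr_ae (.of_forall fun x => ?_)
  change g x • f x = f x * (g x : ℂ)
  rw [Complex.real_smul, mul_comm]

variable {ι : Type*} [Fintype ι]

/-- `ι → ℝ` carries the sup norm, so Fourier analysis is done on `EuclideanSpace ℝ ι`, which has the
same Lebesgue measure. -/
theorem fourier_comp_ofLp (f : (ι → ℝ) → ℂ) (w : EuclideanSpace ℝ ι) :
    𝓕 (fun v : EuclideanSpace ℝ ι => f v.ofLp) w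
      = ∫ v : ι → ℝ, f v * Complex.exp (-(Complex.I * (2 * Real.pi * ∑ i, (v i : ℂ) * w i))) := by
  rw [Real.fourier_eq', ← (PiLp.volume_preserving_ofLp ι).integral_comp
    (MeasurableEquiv.toLp 2 (ι → ℝ)).symm.measurableEmbedding]
  refine integral_congr_ae (.of_forall fun v => ?_)
  simp only [smul_eq_mul, PiLp.inner_apply]
  rw [mul_comm]
  congr 2
  simp
  simp_rw [mul_comm (w.ofLp _ : ℂ)]
  ring

theorem ae_eq_zero_of_forall_integral_exp {f : (ι → ℝ) → ℂ} (hf : Integrable f)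
    (h : ∀ a : ι → ℝ, ∫ v, f v * Complex.exp (Complex.I * ∑ i, (v i : ℂ) * a i) = 0) :
    f =ᵐ[volume] 0 := by
  have hE : Integrable (fun v : EuclideanSpace ℝ ι => f v.ofLp) :=
    (PiLp.volume_preserving_ofLp ι).integrable_comp_of_integrable hf
  have h0 := ae_eq_zero_of_fourier_eq_zero hE fun w => by
    rw [fourier_comp_ofLp, ← h (fun i => -(2 * Real.pi * w i))]
    refine integral_congr_ae (.of_forall fun v => ?_)
    simp only [Finset.mul_sum, ← Finset.sum_neg_distrib]
    congr 3
    funext i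
    push_cast
    ring
  have h1 := (PiLp.volume_preserving_toLp ι).quasiMeasurePreserving.ae h0
  exact h1

/-- Continuity of `F` and integrability of its transform give pointwise inversion, so nothing beyond
integrability is asked of `G`. The constant is the Jacobian of `w ↦ 2πw`, which passes from the
kernel `exp(-2πi v·w)`. -/
theorem plancherel {F G : (ι → ℝ) → ℂ} (hF : Continuous F) (hFi : Integrable F)
    (hGi : Integrable G)
    (hFh : Integrable fun w : ι → ℝ =>
      ∫ v, F v * Complex.exp (-(Complex.I * ∑ i, (v i : ℂ) * w i))) :
    ∫ w : ι → ℝ, starRingEnd ℂ (∫ v, F v * Complex.exp (-(Complex.I * ∑ i, (v i : ℂ) * w i)))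
        * (∫ v, G v * Complex.exp (-(Complex.I * ∑ i, (v i : ℂ) * w i)))
      = (((2 * Real.pi) ^ Fintype.card ι : ℝ) : ℂ) * ∫ v, starRingEnd ℂ (F v) * G v := by
  set FE : EuclideanSpace ℝ ι → ℂ := fun v => F v.ofLp with hFE
  set GE : EuclideanSpace ℝ ι → ℂ := fun v => G v.ofLp with hGE
  have mp := PiLp.volume_preserving_ofLp ι
  have me := (MeasurableEquiv.toLp 2 (ι → ℝ)).symm.measurableEmbedding
  have hFEi : Integrable FE := mp.integrable_comp_of_integrable hFi
  have hGEi : Integrable GE := mp.integrable_comp_of_integrable hGi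
  have hFEc : Continuous FE := hF.comp (PiLp.continuous_ofLp 2 _)
  have hpi : (2 * Real.pi) ≠ 0 := by positivity
  set Fh : (ι → ℝ) → ℂ := fun w => ∫ v, F v * Complex.exp (-(Complex.I * ∑ i, (v i : ℂ) * w i))
  set Gh : (ι → ℝ) → ℂ := fun w => ∫ v, G v * Complex.exp (-(Complex.I * ∑ i, (v i : ℂ) * w i))
  have e1 : ∀ w, 𝓕 FE w = Fh ((2 * Real.pi) • w.ofLp) := fun w => by
    rw [hFE, fourier_comp_ofLp]
    simp only [Fh, Finset.mul_sum, Pi.smul_apply, smul_eq_mul]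
    congr! 7
    push_cast; ring
  have e2 : ∀ w, 𝓕 GE w = Gh ((2 * Real.pi) • w.ofLp) := fun w => by
    rw [hGE, fourier_comp_ofLp]
    simp only [Gh, Finset.mul_sum, Pi.smul_apply, smul_eq_mul]
    congr! 7
    push_cast; ring
  have hFEh : Integrable (𝓕 FE) := by
    have : 𝓕 FE = (fun w => Fh ((2 * Real.pi) • w)) ∘ WithLp.ofLp := funext e1
    rw [this]
    refine mp.integrable_comp_of_integrable ?_
    exact (integrable_comp_smul_iff volume Fh hpi).2 hFh
  -- The sesquilinear multiplication formula with the second function equal to `𝓕 FE`: the inverse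
  -- transform that it produces is `FE` again.
  have h1 := VectorFourier.integral_sesq_fourierIntegral_eq_neg_flip (L := innerₗ _) (μ := volume)
      (ν := volume) (f := GE) (g := 𝓕 FE) (innerSL ℂ)
      Real.continuous_fourierChar continuous_inner hGEi hFEh
  have h2 : ∀ x, VectorFourier.fourierIntegral Real.fourierChar volume
      (-(innerₗ (EuclideanSpace ℝ ι)).flip) (𝓕 FE) x = FE x := by
    intro x
    rw [flip_innerₗ]
    exact congrFun (hFEc.fourierInv_fourier_eq hFEi hFEh) x
  have h3 : ∀ x, VectorFourier.fourierIntegral Real.fourierChar volume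
      (innerₗ (EuclideanSpace ℝ ι)) GE x = 𝓕 GE x := fun x => rfl
  simp only [h2, h3, e1, e2, coe_innerSL_apply, RCLike.inner_apply] at h1
  have h4 := mp.integral_comp me (fun w => Fh ((2 * Real.pi) • w) *
    (starRingEnd ℂ) (Gh ((2 * Real.pi) • w)))
  have h5 := mp.integral_comp me (fun w => F w * (starRingEnd ℂ) (G w))
  have h6 := Measure.integral_comp_smul volume (fun w => Fh w * (starRingEnd ℂ) (Gh w))
    (2 * Real.pi)
  have h7 : ∫ w, Fh w * (starRingEnd ℂ) (Gh w)
      = (((2 * Real.pi) ^ Fintype.card ι : ℝ) : ℂ) * ∫ w, F w * (starRingEnd ℂ) (G w) := by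
    rw [← h5]
    simp only [hFE, hGE] at h1
    rw [← h1, h4, h6, Module.finrank_fintype_fun_eq_card, Complex.real_smul, ← mul_assoc,
      ← Complex.ofReal_mul, abs_of_pos (by positivity), mul_inv_cancel₀ (by positivity)]
    simp
  have h8 := congrArg (starRingEnd ℂ) h7
  rw [← integral_conj, map_mul, ← integral_conj, Complex.conj_ofReal] at h8
  simpa using h8

/-! ### Gaussians with positive real part: bounds, integrability, holomorphic dependence on
parameters -/

section Gaussian

variable {ι : Type*} [Fintype ι]

/-- A real vector, regarded as a complex one. -/
abbrev cvec (v : ι → ℝ) : ι → ℂ := fun i => (v i : ℂ)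

/-- The function `exp (-½ vᵗBv + vᵗb)` of a real vector `v`. -/
def gaussExp (B : Matrix ι ι ℂ) (b : ι → ℂ) (v : ι → ℝ) : ℂ :=
  Complex.exp (-(1 / 2) * (cvec v ⬝ᵥ B *ᵥ cvec v) + cvec v ⬝ᵥ b)

/-- The real part of the quadratic form `vᵗBv` is positive on nonzero real vectors. -/
def RePos (B : Matrix ι ι ℂ) : Prop :=
  ∀ v : ι → ℝ, v ≠ 0 → 0 < (cvec v ⬝ᵥ B *ᵥ cvec v).re

theorem cvec_smul (t : ℝ) (v : ι → ℝ) : cvec (t • v) = (t : ℂ) • cvec v := by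
  ext i; simp [cvec]

theorem continuous_quadratic (B : Matrix ι ι ℂ) :
    Continuous fun v : ι → ℝ => cvec v ⬝ᵥ B *ᵥ cvec v := by
  simp only [dotProduct, mulVec]
  fun_prop

theorem continuous_gaussExp (B : Matrix ι ι ℂ) (b : ι → ℂ) : Continuous (gaussExp B b) := by
  unfold gaussExp
  have := continuous_quadratic B
  simp only [dotProduct, mulVec] at *
  fun_prop

/-- By compactness the form attains a positive minimum on the unit sphere; homogeneity of degree two
does the rest. -/
theorem RePos.exists_lower_bound {B : Matrix ι ι ℂ} (hB : RePos B) :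
    ∃ ε > 0, ∀ v : ι → ℝ, ε * ‖v‖ ^ 2 ≤ (cvec v ⬝ᵥ B *ᵥ cvec v).re := by
  set q : (ι → ℝ) → ℝ := fun v => (cvec v ⬝ᵥ B *ᵥ cvec v).re with hq
  have hqc : Continuous q := Complex.continuous_re.comp (continuous_quadratic B)
  have hom : ∀ (t : ℝ) v, q (t • v) = t ^ 2 * q v := fun t v => by
    simp only [hq, cvec_smul, mulVec_smul, dotProduct_smul, smul_dotProduct, smul_eq_mul]
    rw [← mul_assoc, ← Complex.ofReal_mul, Complex.re_ofReal_mul, sq]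
  -- The sphere is empty exactly when `ι` is; this covers `n = 0`.
  rcases (Metric.sphere (0 : ι → ℝ) 1).eq_empty_or_nonempty with he | hne
  · refine ⟨1, one_pos, fun v => ?_⟩
    have hv : v = 0 := by
      by_contra hv
      have : (‖v‖⁻¹ • v) ∈ Metric.sphere (0 : ι → ℝ) 1 := by
        simp [norm_smul, inv_mul_cancel₀ (norm_ne_zero_iff.2 hv)]
      rw [he] at this
      exact this
    have h0 : q 0 = 0 := by simpa using hom 0 0
    subst hv
    rw [norm_zero]
    change _ ≤ q 0
    rw [h0]; simp
  · obtain ⟨x, hx, hmin⟩ := (isCompact_sphere (0 : ι → ℝ) 1).exists_isMinOn hne hqc.continuousOn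
    have hx1 : ‖x‖ = 1 := by simpa using hx
    refine ⟨q x, hB x (by rintro rfl; simp at hx1), fun v => ?_⟩
    by_cases hv : v = 0
    · have h0 : q 0 = 0 := by simpa using hom 0 0
      subst hv
      rw [norm_zero]
      change _ ≤ q 0
      rw [h0]; simp
    · have hs : (‖v‖⁻¹ • v) ∈ Metric.sphere (0 : ι → ℝ) 1 := by
        simp [norm_smul, inv_mul_cancel₀ (norm_ne_zero_iff.2 hv)]
      have h1 : q x ≤ q (‖v‖⁻¹ • v) := hmin hs
      rw [hom, inv_pow, inv_mul_eq_div, le_div_iff₀ (by positivity)] at h1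
      exact h1

theorem integrable_exp_neg_sq_norm {ε : ℝ} (hε : 0 < ε) :
    Integrable fun v : ι → ℝ => Real.exp (-ε * ‖v‖ ^ 2) := by
  classical
  set N : ℝ := (Fintype.card ι : ℝ) + 1
  have hN : 0 < N := by positivity
  have h1 : Integrable fun v : ι → ℝ => ∏ i, Real.exp (-(ε / N) * v i ^ 2) :=
    Integrable.fintype_prod fun i => integrable_exp_neg_mul_sq (by positivity)
  refine h1.mono' (by fun_prop) (.of_forall fun v => ?_)
  rw [Real.norm_of_nonneg (Real.exp_pos _).le, ← Real.exp_sum, Real.exp_le_exp,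
    ← Finset.mul_sum, neg_mul, neg_mul, neg_le_neg_iff]
  have h2 : ∑ i, v i ^ 2 ≤ N * ‖v‖ ^ 2 := by
    calc ∑ i, v i ^ 2 ≤ ∑ _i : ι, ‖v‖ ^ 2 := by
          refine Finset.sum_le_sum fun i _ => ?_
          rw [← sq_abs]
          exact pow_le_pow_left₀ (abs_nonneg _) (norm_le_pi_norm v i) 2
      _ = (Fintype.card ι : ℝ) * ‖v‖ ^ 2 := by simp
      _ ≤ N * ‖v‖ ^ 2 := by gcongr; simp [N]
  calc ε / N * ∑ i, v i ^ 2 ≤ ε / N * (N * ‖v‖ ^ 2) := by gcongr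
    _ = ε * ‖v‖ ^ 2 := by field_simp

theorem norm_dotProduct_cvec_le (b : ι → ℂ) (v : ι → ℝ) :
    ‖cvec v ⬝ᵥ b‖ ≤ (∑ i, ‖b i‖) * ‖v‖ := by
  refine (norm_sum_le _ _).trans ?_
  rw [Finset.sum_mul]
  refine Finset.sum_le_sum fun i _ => ?_
  rw [norm_mul, mul_comm, Complex.norm_real]
  gcongr
  exact norm_le_pi_norm v i

/-- The linear term is absorbed by completing a square, at the price of half of the decay rate. -/
theorem exists_norm_gaussExp_le {B : Matrix ι ι ℂ} (hB : RePos B) (b : ι → ℂ) :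
    ∃ ε > 0, ∃ C, ∀ v, ‖gaussExp B b v‖ ≤ Real.exp (C - ε * ‖v‖ ^ 2) := by
  obtain ⟨ε, hε, h⟩ := hB.exists_lower_bound
  set S := ∑ i, ‖b i‖
  refine ⟨ε / 4, by positivity, S ^ 2 / ε, fun v => ?_⟩
  rw [gaussExp, Complex.norm_exp, Real.exp_le_exp, Complex.add_re]
  have h1 : (-(1 / 2) * (cvec v ⬝ᵥ B *ᵥ cvec v)).re
      = -(1 / 2) * (cvec v ⬝ᵥ B *ᵥ cvec v).re := by
    rw [show (-(1 / 2) : ℂ) = ((-(1 / 2) : ℝ) : ℂ) by push_cast; rfl, Complex.re_ofReal_mul]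
  have h2 := (Complex.re_le_norm _).trans (norm_dotProduct_cvec_le b v)
  have h3 : S * ‖v‖ ≤ S ^ 2 / ε + ε / 4 * ‖v‖ ^ 2 := by
    have h5 : S ^ 2 / ε + ε / 4 * ‖v‖ ^ 2 - S * ‖v‖ = (S - ε / 2 * ‖v‖) ^ 2 / ε := by
      field_simp; ring
    have : 0 ≤ (S - ε / 2 * ‖v‖) ^ 2 / ε := by positivity
    linarith
  have h4 := h v
  rw [h1]
  change _ ≤ S * _ at h2
  nlinarith

/-- Functions that are integrable against all Gaussian weights. -/
def SubGaussian (φ : (ι → ℝ) → ℂ) : Prop :=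
  AEStronglyMeasurable φ ∧ ∀ ε > 0, Integrable fun v => ‖φ v‖ * Real.exp (-ε * ‖v‖ ^ 2)

theorem subGaussian_const (c : ℂ) : SubGaussian fun _ : ι → ℝ => c :=
  ⟨aestronglyMeasurable_const, fun _ hε => (integrable_exp_neg_sq_norm hε).const_mul _⟩

theorem memLp_exp_neg_sq_norm {ε : ℝ} (hε : 0 < ε) :
    MemLp (fun v : ι → ℝ => Real.exp (-ε * ‖v‖ ^ 2)) 2 := by
  rw [memLp_two_iff_integrable_sq (by fun_prop)]
  refine (integrable_exp_neg_sq_norm (ι := ι) (ε := 2 * ε) (by positivity)).congr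
    (.of_forall fun v => ?_)
  simp only
  rw [← Real.exp_nat_mul]
  congr 1
  push_cast; ring

theorem subGaussian_of_memLp {φ : (ι → ℝ) → ℂ} (hφ : MemLp φ 2) : SubGaussian φ :=
  ⟨hφ.1, fun _ hε => hφ.norm.integrable_mul (memLp_exp_neg_sq_norm hε)⟩

theorem SubGaussian.integrable_mul_gaussExp {φ : (ι → ℝ) → ℂ} (hφ : SubGaussian φ)
    {B : Matrix ι ι ℂ} (hB : RePos B) (b : ι → ℂ) :
    Integrable fun v => φ v * gaussExp B b v := by
  obtain ⟨ε, hε, C, h⟩ := exists_norm_gaussExp_le hB b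
  refine ((hφ.2 ε hε).const_mul (Real.exp C)).mono'
    (hφ.1.mul (continuous_gaussExp B b).aestronglyMeasurable) (.of_forall fun v => ?_)
  rw [norm_mul]
  calc _ ≤ ‖φ v‖ * Real.exp (C - ε * ‖v‖ ^ 2) := by gcongr; exact h v
    _ = _ := by rw [sub_eq_add_neg, Real.exp_add]; ring_nf

theorem integrable_gaussExp {B : Matrix ι ι ℂ} (hB : RePos B) (b : ι → ℂ) :
    Integrable (gaussExp B b) := by
  simpa using (subGaussian_const 1).integrable_mul_gaussExp hB b

theorem memLp_gaussExp {B : Matrix ι ι ℂ} (hB : RePos B) (b : ι → ℂ) :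
    MemLp (gaussExp B b) 2 := by
  obtain ⟨ε, hε, C, h⟩ := exists_norm_gaussExp_le hB b
  refine ((memLp_exp_neg_sq_norm hε).const_mul (Real.exp C)).mono
    (continuous_gaussExp B b).aestronglyMeasurable (.of_forall fun v => (h v).trans ?_)
  rw [sub_eq_add_neg, Real.exp_add, ← neg_mul]
  exact le_abs_self _

/-- The exponent `-½ vᵗBv + vᵗb` as a linear functional of `(B, b)`. -/
def gaussExponent (v : ι → ℝ) : ((ι → ι → ℂ) × (ι → ℂ)) →L[ℂ] ℂ :=
  (∑ i, ∑ j, (-(1 / 2) * ((v i : ℂ) * v j)) •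
      ((ContinuousLinearMap.proj j).comp ((ContinuousLinearMap.proj i).comp
        (ContinuousLinearMap.fst ℂ (ι → ι → ℂ) (ι → ℂ)))))
    + ∑ i, (v i : ℂ) • ((ContinuousLinearMap.proj i).comp
        (ContinuousLinearMap.snd ℂ (ι → ι → ℂ) (ι → ℂ)))

theorem gaussExponent_apply (v : ι → ℝ) (q : (ι → ι → ℂ) × (ι → ℂ)) :
    gaussExponent v q = -(1 / 2) * (cvec v ⬝ᵥ Matrix.of q.1 *ᵥ cvec v) + cvec v ⬝ᵥ q.2 := by
  simp only [gaussExponent, _root_.add_apply, _root_.sum_apply, _root_.smul_apply,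
    ContinuousLinearMap.comp_apply, ContinuousLinearMap.proj_apply,
    smul_eq_mul, dotProduct, mulVec, Finset.mul_sum, ContinuousLinearMap.coe_fst',
    ContinuousLinearMap.coe_snd', Matrix.of_apply]
  congr 1
  refine Finset.sum_congr rfl fun i _ => Finset.sum_congr rfl fun j _ => ?_
  ring

theorem exp_gaussExponent (v : ι → ℝ) (q : (ι → ι → ℂ) × (ι → ℂ)) :
    Complex.exp (gaussExponent v q) = gaussExp (Matrix.of q.1) q.2 v := by
  rw [gaussExponent_apply]; rfl

theorem continuous_gaussExponent :
    Continuous (gaussExponent : (ι → ℝ) → ((ι → ι → ℂ) × (ι → ℂ)) →L[ℂ] ℂ) := by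
  unfold gaussExponent
  fun_prop

theorem exists_norm_gaussExponent_le :
    ∃ K > 0, ∀ v : ι → ℝ, ‖gaussExponent v‖ ≤ K * (‖v‖ ^ 2 + ‖v‖) := by
  set N : ℝ := (Fintype.card ι : ℝ)
  refine ⟨N ^ 2 + N + 1, by positivity, fun v => ?_⟩
  refine ContinuousLinearMap.opNorm_le_bound _ (by positivity) fun q => ?_
  have hq1 : ∀ i j, ‖q.1 i j‖ ≤ ‖q‖ := fun i j =>
    ((norm_le_pi_norm _ j).trans (norm_le_pi_norm _ i)).trans (norm_fst_le q)
  have hq2 : ∀ i, ‖q.2 i‖ ≤ ‖q‖ := fun i => (norm_le_pi_norm _ i).trans (norm_snd_le q)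
  have hv : ∀ i, ‖(v i : ℂ)‖ ≤ ‖v‖ := fun i => by
    rw [Complex.norm_real]; exact norm_le_pi_norm v i
  rw [gaussExponent_apply]
  have e1 : ‖cvec v ⬝ᵥ Matrix.of q.1 *ᵥ cvec v‖ ≤ N * (N * (‖v‖ * (‖q‖ * ‖v‖))) := by
    refine (norm_sum_le_of_le _ (fun i _ => ?_)).trans_eq
      (by rw [Finset.sum_const, nsmul_eq_mul]; rfl)
    rw [norm_mul]
    have : ‖(Matrix.of q.1 *ᵥ cvec v) i‖ ≤ N * (‖q‖ * ‖v‖) := by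
      refine (norm_sum_le_of_le _ (fun j _ => ?_)).trans_eq
        (by rw [Finset.sum_const, nsmul_eq_mul]; rfl)
      rw [norm_mul]
      gcongr
      · exact hq1 i j
      · exact hv j
    calc _ ≤ ‖v‖ * (N * (‖q‖ * ‖v‖)) := by gcongr; exact hv i
      _ = _ := by ring
  have e2 : ‖cvec v ⬝ᵥ q.2‖ ≤ N * (‖v‖ * ‖q‖) := by
    refine (norm_sum_le_of_le _ (fun i _ => ?_)).trans_eq
      (by rw [Finset.sum_const, nsmul_eq_mul]; rfl)
    rw [norm_mul]
    gcongr
    · exact hv i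
    · exact hq2 i
  have e3 : ‖(-(1 / 2) : ℂ)‖ = 1 / 2 := by norm_num
  refine (norm_add_le _ _).trans ?_
  rw [norm_mul, e3]
  have p1 : 0 ≤ N ^ 2 * ‖v‖ ^ 2 * ‖q‖ := by positivity
  have p2 : 0 ≤ N * ‖v‖ ^ 2 * ‖q‖ := by positivity
  have p3 : 0 ≤ N ^ 2 * ‖v‖ * ‖q‖ := by positivity
  have p4 : 0 ≤ ‖v‖ ^ 2 * ‖q‖ := by positivity
  have p5 : 0 ≤ ‖v‖ * ‖q‖ := by positivity
  nlinarith

/-- Integrals against Gaussians are holomorphic in the parameters of the Gaussian. -/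
theorem SubGaussian.differentiableAt_integral {φ : (ι → ℝ) → ℂ} (hφ : SubGaussian φ)
    (q₀ : (ι → ι → ℂ) × (ι → ℂ)) (hB : RePos (Matrix.of q₀.1)) :
    DifferentiableAt ℂ (fun q : (ι → ι → ℂ) × (ι → ℂ) =>
      ∫ v, φ v * gaussExp (Matrix.of q.1) q.2 v) q₀ := by
  obtain ⟨K, hK, hKl⟩ := exists_norm_gaussExponent_le (ι := ι)
  obtain ⟨ε, hε, C, hC⟩ := exists_norm_gaussExp_le hB q₀.2
  -- The radius is chosen so that twice the possible change of the exponent is at most `ε/4 + ε/2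
  -- ‖v‖²`. One of the two shares pays for moving `q` inside the ball, the other for the factor
  -- `‖gaussExponent v‖` of the derivative, which is bounded by `exp(δL)/δ`.
  set δ : ℝ := ε / (8 * K) with hδ
  have hδ0 : 0 < δ := by positivity
  have hre : ∀ v, (gaussExponent v q₀).re ≤ C - ε * ‖v‖ ^ 2 := fun v => by
    have := hC v
    rwa [← exp_gaussExponent, Complex.norm_exp, Real.exp_le_exp] at this
  have hmeas : ∀ q, AEStronglyMeasurable fun v => φ v * Complex.exp (gaussExponent v q) :=
    fun q => hφ.1.mul (by
      simp_rw [exp_gaussExponent]; exact (continuous_gaussExp _ _).aestronglyMeasurable)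
  simp_rw [← exp_gaussExponent]
  refine (hasFDerivAt_integral_of_dominated_of_fderiv_le (𝕜 := ℂ)
    (F' := fun q v => (φ v * Complex.exp (gaussExponent v q)) • gaussExponent v)
    (bound := fun v => Real.exp (C + ε / 4) / δ * (‖φ v‖ * Real.exp (-(ε / 2) * ‖v‖ ^ 2)))
    (Metric.ball_mem_nhds q₀ hδ0) (.of_forall hmeas) ?_ ?_ ?_ ?_ ?_).differentiableAt
  · simp_rw [exp_gaussExponent]
    exact hφ.integrable_mul_gaussExp hB _
  · exact (hmeas q₀).smul continuous_gaussExponent.aestronglyMeasurable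
  · refine .of_forall fun v q hq => ?_
    set L := ‖gaussExponent v‖ with hL
    have hq' : ‖q - q₀‖ ≤ δ := by
      rw [← dist_eq_norm]; exact (Metric.mem_ball.1 hq).le
    have h1 : (gaussExponent v q).re ≤ C - ε * ‖v‖ ^ 2 + L * δ := by
      have e : gaussExponent v q = gaussExponent v q₀ + gaussExponent v (q - q₀) := by
        rw [← map_add]; congr 1; abel
      rw [e, Complex.add_re]
      refine add_le_add (hre v) ((Complex.re_le_norm _).trans ?_)
      exact (ContinuousLinearMap.le_opNorm _ _).trans (by gcongr)
    have h2 : L ≤ Real.exp (δ * L) / δ := by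
      rw [le_div_iff₀ hδ0]
      have := Real.add_one_le_exp (δ * L)
      linarith
    have h3 : δ * L ≤ ε / 8 * (‖v‖ ^ 2 + ‖v‖) := by
      calc δ * L ≤ δ * (K * (‖v‖ ^ 2 + ‖v‖)) := by gcongr; exact hKl v
        _ = _ := by rw [hδ]; field_simp
    have h4 : 2 * (δ * L) ≤ ε / 4 + ε / 2 * ‖v‖ ^ 2 := by
      nlinarith [sq_nonneg (‖v‖ - 2)]
    rw [norm_smul, norm_mul, Complex.norm_exp]
    calc ‖φ v‖ * Real.exp (gaussExponent v q).re * L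
        ≤ ‖φ v‖ * Real.exp (C - ε * ‖v‖ ^ 2 + L * δ) * (Real.exp (δ * L) / δ) := by gcongr
      _ = ‖φ v‖ / δ * Real.exp (C - ε * ‖v‖ ^ 2 + 2 * (δ * L)) := by
          rw [show C - ε * ‖v‖ ^ 2 + 2 * (δ * L) = (C - ε * ‖v‖ ^ 2 + L * δ) + δ * L by ring,
            Real.exp_add (C - ε * ‖v‖ ^ 2 + L * δ)]
          ring
      _ ≤ ‖φ v‖ / δ * Real.exp ((C + ε / 4) + -(ε / 2) * ‖v‖ ^ 2) := by
          refine mul_le_mul_of_nonneg_left (Real.exp_le_exp.2 ?_) (by positivity)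
          linarith
      _ = _ := by rw [Real.exp_add]; ring
  · exact (hφ.2 _ (by positivity)).const_mul _
  · refine .of_forall fun v q _ => ?_
    have := ((gaussExponent v).hasFDerivAt (x := q)).cexp.const_mul (φ v)
    rwa [smul_smul] at this

end Gaussian

/-! ### The Gaussian integral for complex symmetric matrices, and the branch `det[A^(-1/2)]` -/

section GaussianIntegral

variable {n : ℕ}

/-- A real matrix, regarded as a complex one. -/
abbrev cmat {m : Type*} (X : Matrix m m ℝ) : Matrix m m ℂ := X.map Complex.ofReal

theorem cmat_mul {m : Type*} [Fintype m] (X Y : Matrix m m ℝ) : cmat (X * Y) = cmat X * cmat Y :=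
  Matrix.map_mul (f := Complex.ofRealHom)

theorem cmat_mulVec {m : Type*} [Fintype m] (X : Matrix m m ℝ) (v : m → ℝ) :
    cmat X *ᵥ cvec v = cvec (X *ᵥ v) := by
  ext i; simp [mulVec, dotProduct, cvec]

theorem det_cmat {m : Type*} [Fintype m] [DecidableEq m] (X : Matrix m m ℝ) :
    (cmat X).det = (X.det : ℂ) :=
  (Complex.ofRealHom.map_det X).symm

theorem re_quadratic {m : Type*} [Fintype m] (A : Matrix m m ℂ) (v : m → ℝ) :
    (cvec v ⬝ᵥ A *ᵥ cvec v).re = v ⬝ᵥ A.map Complex.re *ᵥ v := by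
  simp [dotProduct, mulVec, cvec, Finset.mul_sum]

theorem rePos_iff {A : Matrix (Fin n) (Fin n) ℂ} (hA : A.IsSymm) :
    RePos A ↔ (A.map Complex.re).PosDef := by
  constructor
  · intro h
    refine Matrix.PosDef.of_dotProduct_mulVec_pos ?_ fun x hx => ?_
    · refine Matrix.IsHermitian.ext fun i j => ?_
      simp [hA.apply i j]
    · rw [star_trivial, ← re_quadratic]; exact h x hx
  · intro h v hv
    rw [re_quadratic]
    simpa using h.dotProduct_mulVec_pos hv

theorem rePos_neg_I_smul {P : Matrix (Fin n) (Fin n) ℂ} (hP : P ∈ siegelUpper n) :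
    RePos (-(Complex.I • P)) := by
  intro v hv
  have := hP.2.dotProduct_mulVec_pos hv
  rw [re_quadratic]
  have e : (-(Complex.I • P)).map Complex.re = P.map Complex.im := by ext i j; simp
  rw [e]; simpa using this

theorem I_smul_mem_siegelUpper {A : Matrix (Fin n) (Fin n) ℂ} (hA : A.IsSymm) (h : RePos A) :
    Complex.I • A ∈ siegelUpper n := by
  refine ⟨hA.smul _, ?_⟩
  have e : (Complex.I • A).map Complex.im = A.map Complex.re := by ext i j; simp
  rw [e]; exact (rePos_iff hA).1 h

open scoped MatrixOrder in
theorem exists_eq_transpose_mul_self {B : Matrix (Fin n) (Fin n) ℝ} (hB : B.PosDef) :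
    ∃ S : Matrix (Fin n) (Fin n) ℝ, IsUnit S.det ∧ B = Sᵀ * S := by
  obtain ⟨y, hy, h⟩ := CStarAlgebra.isStrictlyPositive_iff_eq_star_mul_self.mp
    hB.isStrictlyPositive
  exact ⟨y, (Matrix.isUnit_iff_isUnit_det y).1 hy, h⟩

/-- Simultaneous diagonalization by congruence: with `Re A = SᵗS`, the real symmetric matrix `(S⁻¹)ᵗ
(Im A) S⁻¹` is diagonalized orthogonally, which leaves the identity in the real part. -/
theorem exists_diagonalization {A : Matrix (Fin n) (Fin n) ℂ} (hA : A.IsSymm) (h : RePos A) :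
    ∃ (R : Matrix (Fin n) (Fin n) ℝ) (d : Fin n → ℝ), IsUnit R.det ∧
      A = (cmat R)ᵀ * diagonal (fun i => 1 + Complex.I * (d i : ℂ)) * cmat R := by
  obtain ⟨S, hS, hB⟩ := exists_eq_transpose_mul_self ((rePos_iff hA).1 h)
  set C : Matrix (Fin n) (Fin n) ℝ := (S⁻¹)ᵀ * A.map Complex.im * S⁻¹ with hC
  have hCh : C.IsHermitian := by
    have : (A.map Complex.im)ᵀ = A.map Complex.im := hA.map _
    change Cᵀ = C
    simp only [hC, transpose_mul, transpose_transpose, this, Matrix.mul_assoc]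
  set U : Matrix (Fin n) (Fin n) ℝ := hCh.eigenvectorUnitary.1 with hU
  have hU1 : U * Uᵀ = 1 := (Unitary.mem_iff.1 hCh.eigenvectorUnitary.2).2
  have hC2 : C = U * diagonal hCh.eigenvalues * Uᵀ := by
    have := hCh.spectral_theorem
    rw [Unitary.conjStarAlgAut_apply] at this
    exact this
  have hIm : A.map Complex.im = Sᵀ * C * S := by
    have hSt : IsUnit (Sᵀ).det := by rwa [det_transpose]
    simp only [hC, transpose_nonsing_inv]
    rw [← Matrix.mul_assoc, ← Matrix.mul_assoc, mul_nonsing_inv _ hSt, Matrix.one_mul,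
      Matrix.mul_assoc, nonsing_inv_mul _ hS, Matrix.mul_one]
  obtain ⟨d, hd⟩ : ∃ d, d = hCh.eigenvalues := ⟨_, rfl⟩
  rw [← hd] at hC2
  refine ⟨Uᵀ * S, d, ?_, ?_⟩
  · rw [det_mul]
    refine IsUnit.mul ?_ hS
    have := congrArg det hU1
    rw [det_mul, det_one, mul_comm] at this
    exact IsUnit.of_mul_eq_one _ this
  · have e1 : A = cmat (A.map Complex.re) + Complex.I • cmat (A.map Complex.im) := by
      ext i j
      simp only [Matrix.add_apply, Matrix.smul_apply, Matrix.map_apply, smul_eq_mul]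
      rw [mul_comm]; exact (Complex.re_add_im _).symm
    have e2 : diagonal (fun i => 1 + Complex.I * (d i : ℂ))
        = 1 + Complex.I • cmat (diagonal d) := by
      ext i j
      by_cases hij : i = j
      · subst hij; simp
      · simp [hij]
    have e3 : ∀ X : Matrix (Fin n) (Fin n) ℝ, (cmat X)ᵀ = cmat Xᵀ := fun X => rfl
    have e4 : (cmat U) * (cmat Uᵀ) = 1 := by
      rw [← cmat_mul, hU1]; simp [cmat]
    conv_lhs => rw [e1]
    rw [hIm, hB, hC2, e2, e3]
    simp only [cmat_mul, transpose_mul, transpose_transpose, Matrix.mul_add, Matrix.add_mul,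
      Matrix.mul_one, Matrix.mul_smul, Matrix.smul_mul, Matrix.mul_assoc]
    rw [← Matrix.mul_assoc (cmat U) (cmat Uᵀ), e4, Matrix.one_mul]

theorem integral_comp_mulVec {ι : Type*} [Fintype ι] [DecidableEq ι] {M : Matrix ι ι ℝ}
    (hM : M.det ≠ 0) (f : (ι → ℝ) → ℂ) :
    ∫ v, f (M *ᵥ v) = ((|M.det|⁻¹ : ℝ) : ℂ) * ∫ v, f v := by
  have h := Real.map_matrix_volume_pi_eq_smul_volume_pi hM
  have hu : IsUnit M.det := isUnit_iff_ne_zero.2 hM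
  have hme : MeasurableEmbedding (Matrix.toLin' M) :=
    (LinearEquiv.toContinuousLinearEquiv (LinearEquiv.ofLinearMap (toLin' M) (toLin' M⁻¹)
      (by rw [← toLin'_mul, mul_nonsing_inv _ hu, toLin'_one])
      (by rw [← toLin'_mul, nonsing_inv_mul _ hu, toLin'_one]))).toHomeomorph.measurableEmbedding
  have h2 := hme.integral_map (μ := volume) f
  rw [h, integral_smul_measure, ENNReal.toReal_ofReal (abs_nonneg _), abs_inv] at h2
  simp only [toLin'_apply] at h2
  rw [← h2, Complex.real_smul]

/-- This follows from the factored characteristic polynomial, evaluated at `-s/t`. It describes the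
determinant along the segment from `1` to `A` by the eigenvalues of `A` alone. -/
theorem det_add_smul_eq_prod (A : Matrix (Fin n) (Fin n) ℂ) (s t : ℂ) :
    (s • (1 : Matrix (Fin n) (Fin n) ℂ) + t • A).det
      = (A.charpoly.roots.map fun l => s + t * l).prod := by
  have hsp : A.charpoly = (A.charpoly.roots.map fun a => Polynomial.X - Polynomial.C a).prod := by
    have := (IsAlgClosed.splits A.charpoly).eq_prod_roots_of_monic A.charpoly_monic
    exact this
  have hcard : Multiset.card A.charpoly.roots = n := by
    have := (IsAlgClosed.splits A.charpoly).natDegree_eq_card_roots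
    rw [← this, charpoly_natDegree_eq_dim, Fintype.card_fin]
  by_cases ht : t = 0
  · subst ht
    simp [hcard]
  · have h1 : s • (1 : Matrix (Fin n) (Fin n) ℂ) + t • A
        = (-t) • (scalar (Fin n) (-(s / t)) - A) := by
      ext i j
      by_cases hij : i = j
      · subst hij; simp; field_simp; ring
      · simp [hij]
    rw [h1, det_smul, ← eval_charpoly]
    conv_lhs => rw [hsp]
    have key : ∀ m : Multiset ℂ, (-t) ^ Multiset.card m *
        (m.map fun a => -(s / t) - a).prod = (m.map fun l => s + t * l).prod := by
      intro m
      induction m using Multiset.induction with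
      | empty => simp
      | cons a m ih =>
        simp only [Multiset.card_cons, Multiset.map_cons, Multiset.prod_cons, ← ih]
        field_simp
        ring
    have := key A.charpoly.roots
    rw [hcard] at this
    rw [← this, Polynomial.eval_multiset_prod, Multiset.map_map, Fintype.card_fin]
    simp

theorem quadratic_conj {ι : Type*} [Fintype ι] (R D : Matrix ι ι ℂ) (v : ι → ℂ) :
    v ⬝ᵥ (Rᵀ * D * R) *ᵥ v = (R *ᵥ v) ⬝ᵥ D *ᵥ (R *ᵥ v) := by
  rw [← mulVec_mulVec, ← mulVec_mulVec, dotProduct_mulVec, vecMul_transpose]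

theorem integral_gaussExp_diagonal {D : Fin n → ℂ} (hD : ∀ i, 0 < (D i).re) (b : Fin n → ℂ) :
    ∫ v, gaussExp (diagonal D) b v
      = (∏ i, (2 * Real.pi / D i) ^ (1 / 2 : ℂ)) * Complex.exp (1 / 2 * ∑ i, b i ^ 2 / D i) := by
  have h1 : ∀ v, gaussExp (diagonal D) b v
      = ∏ i, Complex.exp (-(D i / 2) * (v i : ℂ) ^ 2 + b i * v i + 0) := fun v => by
    rw [gaussExp, ← Complex.exp_sum]
    congr 1
    simp only [dotProduct, mulVec_diagonal, Finset.mul_sum, ← Finset.sum_add_distrib]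
    refine Finset.sum_congr rfl fun i _ => ?_
    ring
  simp_rw [h1]
  rw [integral_fintype_prod_volume_eq_prod
    (fun i (x : ℝ) => Complex.exp (-(D i / 2) * (x : ℂ) ^ 2 + b i * x + 0)),
    Finset.mul_sum, Complex.exp_sum, ← Finset.prod_mul_distrib]
  refine Finset.prod_congr rfl fun i _ => ?_
  have hi : D i ≠ 0 := by
    intro h
    have := hD i
    rw [h] at this
    simp at this
  rw [integral_cexp_quadratic (by simpa using hD i)]
  congr 2
  · field_simp
  · field_simp; ring

/-- Symmetry extends the positivity from real to complex vectors: `iA` lies in the Siegel upper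
half-plane, so `im_quadratic` excludes a kernel vector. -/
theorem det_ne_zero_of_rePos {A : Matrix (Fin n) (Fin n) ℂ} (hA : A.IsSymm) (h : RePos A) :
    A.det ≠ 0 := by
  intro h0
  obtain ⟨w, hw, hw0⟩ := Matrix.exists_mulVec_eq_zero_iff.2 h0
  have := im_quadratic (I_smul_mem_siegelUpper hA h) hw
  rw [smul_mulVec, hw0] at this
  simp at this

/-- Diagonalization by congruence splits the integral into one-dimensional ones. Only the square of
the constant is recorded; its sign is found in `integral_gaussExp_zero`. -/
theorem exists_integral_gaussExp_eq {A : Matrix (Fin n) (Fin n) ℂ} (hA : A.IsSymm) (h : RePos A) :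
    ∃ c : ℂ, c ^ 2 * A.det = (2 * Real.pi) ^ n ∧
      ∀ b, ∫ v, gaussExp A b v = c * Complex.exp (1 / 2 * (b ⬝ᵥ A⁻¹ *ᵥ b)) := by
  obtain ⟨R, d, hR, hAR⟩ := exists_diagonalization hA h
  set D : Fin n → ℂ := fun i => 1 + Complex.I * (d i : ℂ) with hD
  have hDre : ∀ i, 0 < (D i).re := fun i => by simp [hD]
  have hD0 : ∀ i, D i ≠ 0 := fun i hi => by
    have := hDre i
    rw [hi] at this
    simp at this
  have hRc : IsUnit (cmat R).det := by
    rw [det_cmat, isUnit_iff_ne_zero]; exact_mod_cast hR.ne_zero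
  have hRct : IsUnit ((cmat R)ᵀ).det := by rwa [det_transpose]
  refine ⟨((|R.det|⁻¹ : ℝ) : ℂ) * ∏ i, (2 * Real.pi / D i) ^ (1 / 2 : ℂ), ?_, fun b => ?_⟩
  · have h1 : ∀ i, ((2 * Real.pi / D i) ^ (1 / 2 : ℂ)) ^ 2 = 2 * Real.pi / D i := fun i => by
      rw [← Complex.cpow_nat_mul]; simp
    rw [mul_pow, ← Finset.prod_pow]
    simp_rw [h1]
    rw [hAR, det_mul, det_mul, det_transpose, det_diagonal, det_cmat, Finset.prod_div_distrib,
      Finset.prod_const, Finset.card_univ, Fintype.card_fin]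
    have h2 : ∏ i, D i ≠ 0 := Finset.prod_ne_zero_iff.2 fun i _ => hD0 i
    have h3 : (R.det : ℂ) ≠ 0 := by exact_mod_cast hR.ne_zero
    have h4 : ((|R.det|⁻¹ : ℝ) : ℂ) ^ 2 = ((R.det : ℂ) ^ 2)⁻¹ := by
      rw [← Complex.ofReal_pow, inv_pow, sq_abs]; push_cast; rfl
    rw [h4]
    field_simp
  · have h1 : ∀ v, gaussExp A b v
        = gaussExp (diagonal D) (((cmat R)ᵀ)⁻¹ *ᵥ b) (R *ᵥ v) := fun v => by
      rw [gaussExp, gaussExp, hAR, quadratic_conj, cmat_mulVec]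
      congr 2
      rw [← cmat_mulVec, ← vecMul_transpose, ← dotProduct_mulVec, mulVec_mulVec,
        mul_nonsing_inv _ hRct, one_mulVec]
    simp_rw [h1]
    rw [integral_comp_mulVec hR.ne_zero, integral_gaussExp_diagonal hDre, ← mul_assoc]
    congr 3
    have h2 : A⁻¹ = ((((cmat R)ᵀ)⁻¹)ᵀ) * diagonal (fun i => (D i)⁻¹) * ((cmat R)ᵀ)⁻¹ := by
      have h3 : (diagonal D)⁻¹ = diagonal (fun i => (D i)⁻¹) := by
        refine inv_eq_right_inv ?_
        rw [diagonal_mul_diagonal, ← diagonal_one]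
        congr 1
        funext i
        exact mul_inv_cancel₀ (hD0 i)
      rw [hAR, Matrix.mul_inv_rev, Matrix.mul_inv_rev, h3, transpose_nonsing_inv,
        transpose_transpose, Matrix.mul_assoc]
    rw [h2, quadratic_conj]
    simp only [dotProduct, mulVec_diagonal]
    refine Finset.sum_congr rfl fun i _ => ?_
    rw [div_eq_mul_inv]; ring

/-- For an eigenvector `w` one has `w* A w = l |w|²`, and the left side has positive real part
because `iA` is in the Siegel upper half-plane. -/
theorem re_pos_of_mem_roots {A : Matrix (Fin n) (Fin n) ℂ} (hA : A.IsSymm) (h : RePos A) {l : ℂ}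
    (hl : l ∈ A.charpoly.roots) : 0 < l.re := by
  have h1 : (scalar (Fin n) l - A).det = 0 := by
    rw [← eval_charpoly]; exact (Polynomial.mem_roots'.1 hl).2
  obtain ⟨w, hw, hw0⟩ := Matrix.exists_mulVec_eq_zero_iff.2 h1
  have h2 : A *ᵥ w = l • w := by
    rw [sub_mulVec, sub_eq_zero] at hw0
    rw [← hw0]
    ext i; simp [mulVec_diagonal]
  have h3 := im_quadratic (I_smul_mem_siegelUpper hA h) hw
  rw [smul_mulVec, h2, smul_smul, dotProduct_smul, smul_eq_mul] at h3
  have h4 : star w ⬝ᵥ w = ((∑ i, ‖w i‖ ^ 2 : ℝ) : ℂ) := by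
    push_cast
    refine Finset.sum_congr rfl fun i _ => ?_
    rw [Pi.star_apply]
    exact Complex.conj_mul' (w i)
  rw [h4] at h3
  have h5 : (Complex.I * l * ((∑ i, ‖w i‖ ^ 2 : ℝ) : ℂ)).im = l.re * ∑ i, ‖w i‖ ^ 2 := by
    rw [Complex.im_mul_ofReal]; simp
  rw [h5] at h3
  exact pos_of_mul_pos_left h3 (Finset.sum_nonneg fun i _ => by positivity)

theorem sq_multiset_prod_cpow (m : Multiset ℂ) :
    (m.map fun l => l ^ (-(1 / 2) : ℂ)).prod ^ 2 = m.prod⁻¹ := by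
  induction m using Multiset.induction with
  | empty => simp
  | cons a m ih =>
    simp only [Multiset.map_cons, Multiset.prod_cons, mul_pow, ih, mul_inv]
    rw [← Complex.cpow_nat_mul]
    norm_num [Complex.cpow_neg_one]

theorem detInvSqrt_sq (A : Matrix (Fin n) (Fin n) ℂ) : detInvSqrt A ^ 2 = A.det⁻¹ := by
  rw [detInvSqrt, sq_multiset_prod_cpow, det_eq_prod_roots_charpoly]

theorem RePos.segment {A : Matrix (Fin n) (Fin n) ℂ} (h : RePos A) {t : ℝ}
    (ht : t ∈ Set.Icc (0 : ℝ) 1) :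
    RePos (((1 - t : ℝ) : ℂ) • (1 : Matrix (Fin n) (Fin n) ℂ) + (t : ℂ) • A) := by
  intro v hv
  have h1 : 0 < (cvec v ⬝ᵥ cvec v).re := by
    have : cvec v ⬝ᵥ cvec v = ((v ⬝ᵥ v : ℝ) : ℂ) := by simp [dotProduct]
    rw [this, Complex.ofReal_re]
    exact lt_of_le_of_ne (Finset.sum_nonneg fun i _ => mul_self_nonneg _)
      fun h => hv (dotProduct_self_eq_zero.1 h.symm)
  have h2 := h v hv
  rw [add_mulVec, smul_mulVec, smul_mulVec, dotProduct_add, dotProduct_smul, dotProduct_smul,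
    one_mulVec, smul_eq_mul, smul_eq_mul, Complex.add_re, Complex.re_ofReal_mul,
    Complex.re_ofReal_mul]
  rcases eq_or_lt_of_le ht.1 with h0 | h0
  · rw [← h0]; simpa using h1
  · have := mul_pos h0 h2
    have := mul_nonneg (sub_nonneg.2 ht.2) h1.le
    linarith

theorem continuous_multiset_map_prod {α β : Type*} [TopologicalSpace α] (m : Multiset β)
    (f : α → β → ℂ) (s : Set α) (hf : ∀ b ∈ m, ContinuousOn (fun a => f a b) s) :
    ContinuousOn (fun a => (m.map (f a)).prod) s := by
  induction m using Multiset.induction with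
  | empty => simpa using continuousOn_const
  | cons b m ih =>
    simp only [Multiset.map_cons, Multiset.prod_cons]
    exact (hf b (Multiset.mem_cons_self b m)).mul
      (ih fun c hc => hf c (Multiset.mem_cons_of_mem hc))

/-- Along the segment from `1` to `A` both sides are continuous, have the same nonzero square and
agree at `1`, so they agree throughout. -/
theorem integral_gaussExp_zero {A : Matrix (Fin n) (Fin n) ℂ} (hA : A.IsSymm) (h : RePos A) :
    ∫ v, gaussExp A 0 v = (((2 * Real.pi) ^ ((n : ℝ) / 2) : ℝ) : ℂ) * detInvSqrt A := by
  set κ : ℂ := (((2 * Real.pi) ^ ((n : ℝ) / 2) : ℝ) : ℂ) with hκ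
  have hκ2 : κ ^ 2 = (2 * Real.pi) ^ n := by
    rw [hκ, ← Complex.ofReal_pow, ← Real.rpow_natCast, ← Real.rpow_mul (by positivity)]
    rw [show (n : ℝ) / 2 * ((2 : ℕ) : ℝ) = n by push_cast; ring, Real.rpow_natCast]
    push_cast; rfl
  have hκ0 : κ ≠ 0 := by
    rw [hκ]; exact_mod_cast (by positivity : (2 * Real.pi) ^ ((n : ℝ) / 2) ≠ 0)
  set At : ℝ → Matrix (Fin n) (Fin n) ℂ :=
    fun t => ((1 - t : ℝ) : ℂ) • (1 : Matrix (Fin n) (Fin n) ℂ) + (t : ℂ) • A with hAt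
  have hAts : ∀ t, (At t).IsSymm := fun t => (isSymm_one.smul _).add (hA.smul _)
  -- The right side along the segment, written with the eigenvalues of `A` itself. Continuity in `t`
  -- then needs no continuity of roots, only that the bases stay in the right half-plane.
  set c : ℝ → ℂ := fun t => κ * (A.charpoly.roots.map fun l =>
    (((1 - t : ℝ) : ℂ) + (t : ℂ) * l) ^ (-(1 / 2) : ℂ)).prod with hc
  have hre : ∀ t ∈ Set.Icc (0 : ℝ) 1, ∀ l ∈ A.charpoly.roots,
      0 < (((1 - t : ℝ) : ℂ) + (t : ℂ) * l).re := by
    intro t ht l hl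
    rw [Complex.add_re, Complex.re_ofReal_mul, Complex.ofReal_re]
    have hl' := re_pos_of_mem_roots hA h hl
    rcases eq_or_lt_of_le ht.1 with h0 | h0
    · rw [← h0]; simp
    · have := mul_pos h0 hl'
      linarith [ht.2]
  have hcc : ContinuousOn c (Set.Icc 0 1) := by
    refine continuousOn_const.mul (continuous_multiset_map_prod _ _ _ fun l hl t ht => ?_)
    refine ContinuousAt.continuousWithinAt ?_
    refine ContinuousAt.cpow (by fun_prop) continuousAt_const ?_
    exact Or.inl (hre t ht l hl)
  have hc2 : ∀ t, c t ^ 2 = (2 * Real.pi) ^ n * (At t).det⁻¹ := fun t => by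
    rw [hc]
    simp only
    rw [mul_pow, hκ2, hAt]
    simp only
    rw [det_add_smul_eq_prod, ← sq_multiset_prod_cpow, Multiset.map_map]
    rfl
  have hI2 : ∀ t ∈ Set.Icc (0 : ℝ) 1,
      (∫ v, gaussExp (At t) 0 v) ^ 2 = (2 * Real.pi) ^ n * (At t).det⁻¹ := by
    intro t ht
    obtain ⟨k, hk, hk2⟩ := exists_integral_gaussExp_eq (hAts t) (h.segment ht)
    have h0 := det_ne_zero_of_rePos (hAts t) (h.segment ht)
    rw [hk2]
    simp only [mulVec_zero, dotProduct_zero, mul_zero, Complex.exp_zero, mul_one]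
    rw [← hk, mul_inv_cancel_right₀ h0]
  have hIc : ContinuousOn (fun t => ∫ v, gaussExp (At t) 0 v) (Set.Icc 0 1) := by
    intro t ht
    have h1 := ((subGaussian_const (ι := Fin n) 1).differentiableAt_integral (At t, 0)
      (h.segment ht)).continuousAt
    have h2 : ContinuousAt (fun s : ℝ => ((At s, 0) : (Fin n → Fin n → ℂ) × (Fin n → ℂ))) t := by
      refine Continuous.continuousAt ?_
      refine Continuous.prodMk ?_ continuous_const
      refine continuous_pi fun i => continuous_pi fun j => ?_
      simp only [hAt, Matrix.add_apply, Matrix.smul_apply]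
      fun_prop
    have h3 := ContinuousAt.comp (f := fun s : ℝ =>
      ((At s, 0) : (Fin n → Fin n → ℂ) × (Fin n → ℂ))) h1 h2
    have h4 : ContinuousAt (fun t => ∫ v, gaussExp (At t) 0 v) t := by
      simp only [Function.comp_def, one_mul] at h3
      exact h3
    exact h4.continuousWithinAt
  have h0 : (0 : ℝ) ∈ Set.Icc (0 : ℝ) 1 := by simp
  have h1 : (1 : ℝ) ∈ Set.Icc (0 : ℝ) 1 := by simp
  have hend : ∫ v, gaussExp (At 0) 0 v = c 0 := by
    have e : At 0 = diagonal fun _ => 1 := by simp [hAt]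
    rw [e, integral_gaussExp_diagonal (by simp), hc, hκ]
    simp only [Pi.zero_apply, div_one]
    simp
    rw [← Complex.ofReal_ofNat, ← Complex.ofReal_mul, Real.rpow_div_two_eq_sqrt _ (by positivity),
      Real.sqrt_eq_rpow, Real.rpow_natCast, Complex.ofReal_pow, Complex.ofReal_cpow (by positivity)]
    simp
  have := isPreconnected_Icc.eq_of_sq_eq hIc hcc (fun t ht => by
      simp only [Pi.pow_apply]; rw [hI2 t ht, hc2 t])
    (fun {t} ht h0 => by
      have := hc2 t
      rw [h0] at this
      have hd := det_ne_zero_of_rePos (hAts t) (h.segment ht)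
      have hp : (Real.pi : ℂ) ≠ 0 := by exact_mod_cast Real.pi_ne_zero
      simp [hd, hp] at this) h0 hend h1
  simpa [hAt, hc, detInvSqrt] using this

theorem integral_gaussExp {A : Matrix (Fin n) (Fin n) ℂ} (hA : A.IsSymm) (h : RePos A)
    (b : Fin n → ℂ) :
    ∫ v, gaussExp A b v = (((2 * Real.pi) ^ ((n : ℝ) / 2) : ℝ) : ℂ) * detInvSqrt A
      * Complex.exp (1 / 2 * (b ⬝ᵥ A⁻¹ *ᵥ b)) := by
  obtain ⟨c, -, hc⟩ := exists_integral_gaussExp_eq hA h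
  have h0 := hc 0
  rw [integral_gaussExp_zero hA h] at h0
  rw [hc b, h0]
  simp

/-- It is, up to a positive factor, the integral of a positive function. -/
theorem detInvSqrt_pos {A : Matrix (Fin n) (Fin n) ℝ} (hA : A.PosDef) :
    ∃ t : ℝ, 0 < t ∧ detInvSqrt (cmat A) = t := by
  have hs : (cmat A).IsSymm := by
    have : Aᵀ = A := hA.1
    exact IsSymm.map this _
  have hre : (cmat A).map Complex.re = A := by ext i j; simp
  have hp : RePos (cmat A) := by
    rw [rePos_iff hs, hre]; exact hA
  have h1 := integral_gaussExp_zero hs hp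
  have h2 : ∀ v, gaussExp (cmat A) 0 v = ((Real.exp (-(1 / 2) * (v ⬝ᵥ A *ᵥ v)) : ℝ) : ℂ) := by
    intro v
    rw [gaussExp, cmat_mulVec]
    simp [dotProduct]
  have h3 : Integrable fun v => Real.exp (-(1 / 2) * (v ⬝ᵥ A *ᵥ v)) := by
    have := (integrable_gaussExp hp 0).re
    simp_rw [h2] at this
    exact this
  simp_rw [h2] at h1
  rw [integral_complex_ofReal] at h1
  have h4 : 0 < ∫ v : Fin n → ℝ, Real.exp (-(1 / 2) * (v ⬝ᵥ A *ᵥ v)) := integral_exp_pos h3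
  have h5 : (0 : ℝ) < (2 * Real.pi) ^ ((n : ℝ) / 2) := by positivity
  refine ⟨((2 * Real.pi) ^ ((n : ℝ) / 2))⁻¹ * ∫ v : Fin n → ℝ, Real.exp (-(1 / 2) * (v ⬝ᵥ A *ᵥ v)),
    by positivity, ?_⟩
  rw [Complex.ofReal_mul, h1, ← mul_assoc, ← Complex.ofReal_mul, inv_mul_cancel₀ h5.ne']
  simp

theorem detInvSqrt_ne_zero {A : Matrix (Fin n) (Fin n) ℂ} (hA : A.IsSymm) (h : RePos A) :
    detInvSqrt A ≠ 0 := by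
  intro h0
  have := detInvSqrt_sq A
  rw [h0] at this
  simp only [ne_eq, OfNat.ofNat_ne_zero, not_false_eq_true, zero_pow, zero_eq_inv] at this
  exact det_ne_zero_of_rePos hA h this.symm

/-- Continuity is not visible from the product over eigenvalues, but the Gaussian integral is
continuous in its matrix. -/
theorem continuousOn_detInvSqrt :
    ContinuousOn (detInvSqrt : Matrix (Fin n) (Fin n) ℂ → ℂ) {A | A.IsSymm ∧ RePos A} := by
  set κ : ℂ := (((2 * Real.pi) ^ ((n : ℝ) / 2) : ℝ) : ℂ) with hκ
  have hκ0 : κ ≠ 0 := by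
    rw [hκ]; exact_mod_cast (by positivity : (2 * Real.pi) ^ ((n : ℝ) / 2) ≠ 0)
  have h1 : ContinuousOn (fun A : Matrix (Fin n) (Fin n) ℂ => κ⁻¹ * ∫ v, gaussExp A 0 v)
      {A | A.IsSymm ∧ RePos A} := by
    refine continuousOn_const.mul fun A hA => ContinuousAt.continuousWithinAt ?_
    have h1 := ((subGaussian_const (ι := Fin n) 1).differentiableAt_integral (A, 0)
      hA.2).continuousAt
    have h2 : ContinuousAt (fun B : Matrix (Fin n) (Fin n) ℂ =>
        ((B, 0) : (Fin n → Fin n → ℂ) × (Fin n → ℂ))) A :=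
      (Continuous.prodMk continuous_id continuous_const).continuousAt
    have h3 := ContinuousAt.comp (f := fun B : Matrix (Fin n) (Fin n) ℂ =>
        ((B, 0) : (Fin n → Fin n → ℂ) × (Fin n → ℂ))) h1 h2
    simp only [Function.comp_def, one_mul] at h3
    exact h3
  refine h1.congr fun A hA => ?_
  simp only
  rw [integral_gaussExp_zero hA.1 hA.2, ← mul_assoc, inv_mul_cancel₀ hκ0, one_mul]

end GaussianIntegral

/-! ### The kernel of `𝔍` as a partial Fourier transform of the kernel of `K⁺ ⊗ K⁻` -/

section Kernels

variable {n : ℕ}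

/-- The position part of a phase point, with complex entries. -/
abbrev xpart (v : Phase n) : Fin n → ℂ := fun i => (v (Sum.inl i) : ℂ)

/-- The momentum part of a phase point, with complex entries. -/
abbrev ypart (v : Phase n) : Fin n → ℂ := fun i => (v (Sum.inr i) : ℂ)

theorem _root_.Matrix.IsSymm.dotProduct_mulVec_comm {X : Matrix (Fin n) (Fin n) ℂ} (hX : X.IsSymm)
    (v w : Fin n → ℂ) : v ⬝ᵥ X *ᵥ w = w ⬝ᵥ X *ᵥ v := by
  rw [dotProduct_mulVec, ← mulVec_transpose, hX.eq, dotProduct_comm]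

theorem sub_mem_upper {P Q : Matrix (Fin n) (Fin n) ℂ} (hP : P ∈ siegelUpper n)
    (hQ : Q ∈ siegelLower n) : P - Q ∈ siegelUpper n := by
  refine ⟨hP.1.sub hQ.1, ?_⟩
  have : (P - Q).map Complex.im = P.map Complex.im + -(Q.map Complex.im) := by
    ext i j; simp [sub_eq_add_neg]
  rw [this]
  exact hP.2.add hQ.2

theorem isUnit_det_of_mem_upper {P : Matrix (Fin n) (Fin n) ℂ} (hP : P ∈ siegelUpper n) :
    IsUnit P.det := by
  rw [isUnit_iff_ne_zero]
  intro h
  obtain ⟨w, hw, hw0⟩ := Matrix.exists_mulVec_eq_zero_iff.2 h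
  have := im_quadratic hP hw
  rw [hw0] at this
  simp at this

theorem neg_mem_upper {Q : Matrix (Fin n) (Fin n) ℂ} (hQ : Q ∈ siegelLower n) :
    -Q ∈ siegelUpper n := by
  refine ⟨hQ.1.neg, ?_⟩
  have : (-Q).map Complex.im = -(Q.map Complex.im) := by ext i j; simp
  rw [this]; exact hQ.2

theorem isUnit_det_of_mem_lower {Q : Matrix (Fin n) (Fin n) ℂ} (hQ : Q ∈ siegelLower n) :
    IsUnit Q.det := by
  have := isUnit_det_of_mem_upper (neg_mem_upper hQ)
  rw [← Matrix.isUnit_iff_isUnit_det] at this ⊢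
  simpa using this

theorem symm_inv {R : Matrix (Fin n) (Fin n) ℂ} (hR : R.IsSymm) : (R⁻¹).IsSymm := by
  change (R⁻¹)ᵀ = R⁻¹
  rw [transpose_nonsing_inv, hR.eq]

/-- The form factors because the lower right block is `2 Q (P-Q)⁻¹ P`. All later computations with
the exponent start from this factored form. -/
theorem kernelMatrix_quadratic {P Q : Matrix (Fin n) (Fin n) ℂ} (hP : P ∈ siegelUpper n)
    (hQ : Q ∈ siegelLower n) (x y : Fin n → ℂ) :
    Sum.elim x y ⬝ᵥ kernelMatrix P Q *ᵥ Sum.elim x y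
      = 2 * ((x + Q *ᵥ y) ⬝ᵥ (P - Q)⁻¹ *ᵥ (x + P *ᵥ y)) := by
  have hR := isUnit_det_of_mem_upper (sub_mem_upper hP hQ)
  have hPu := isUnit_det_of_mem_upper hP
  have hQu := isUnit_det_of_mem_lower hQ
  have hRs : ((P - Q)⁻¹).IsSymm := symm_inv (hP.1.sub hQ.1)
  have e1 : (P⁻¹ - Q⁻¹)⁻¹ = -(Q * (P - Q)⁻¹ * P) := by
    refine inv_eq_right_inv ?_
    have e2 : P⁻¹ - Q⁻¹ = -(P⁻¹ * (P - Q) * Q⁻¹) := by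
      rw [Matrix.mul_sub, Matrix.sub_mul, nonsing_inv_mul _ hPu, Matrix.one_mul, Matrix.mul_assoc,
        mul_nonsing_inv _ hQu, Matrix.mul_one, neg_sub]
    rw [e2, neg_mul_neg]
    rw [Matrix.mul_assoc, Matrix.mul_assoc Q, nonsing_inv_mul_cancel_left _ _ hQu,
      Matrix.mul_assoc, mul_nonsing_inv_cancel_left _ _ hR, nonsing_inv_mul _ hPu]
  have e3 : ∀ a, (Q *ᵥ y) ⬝ᵥ a = y ⬝ᵥ Q *ᵥ a := fun a => by
    rw [dotProduct_comm, hQ.1.dotProduct_mulVec_comm]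
  rw [kernelMatrix, e1, fromBlocks_mulVec, sumElim_dotProduct_sumElim]
  simp only [Sum.elim_comp_inl, Sum.elim_comp_inr, smul_mulVec, smul_neg, neg_neg,
    dotProduct_add, add_dotProduct, mulVec_add, ← mulVec_mulVec, add_mulVec, dotProduct_smul,
    smul_eq_mul, mul_add, e3]
  have e4 : x ⬝ᵥ (P - Q)⁻¹ *ᵥ Q *ᵥ y = y ⬝ᵥ Q *ᵥ (P - Q)⁻¹ *ᵥ x := by
    rw [hRs.dotProduct_mulVec_comm, e3]
  have e5 : x ⬝ᵥ (P - Q)⁻¹ *ᵥ P *ᵥ y = y ⬝ᵥ P *ᵥ (P - Q)⁻¹ *ᵥ x := by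
    rw [hRs.dotProduct_mulVec_comm, dotProduct_comm, hP.1.dotProduct_mulVec_comm]
  rw [e4, e5]
  ring

theorem kernelVector_eq (p k : Fin n → ℂ) (v : Phase n) :
    kernelVector p k v = Sum.elim ((1 / 2 : ℂ) • (p + k) - xpart v) (ypart v) := by
  ext i
  rcases i with i | i
  · simp [kernelVector]; ring
  · simp [kernelVector]

/-- The exponent of the kernel. -/
def kernelExponent (P Q : Matrix (Fin n) (Fin n) ℂ) (p k x y : Fin n → ℂ) : ℂ :=
  -Complex.I * (((1 / 2 : ℂ) • (p + k) - x + Q *ᵥ y) ⬝ᵥ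
      (P - Q)⁻¹ *ᵥ ((1 / 2 : ℂ) • (p + k) - x + P *ᵥ y))
    + Complex.I / 2 * (y ⬝ᵥ (p - k))

theorem kernel_eq {P Q : Matrix (Fin n) (Fin n) ℂ} (hP : P ∈ siegelUpper n)
    (hQ : Q ∈ siegelLower n) (p k : Fin n → ℂ) (v : Phase n) :
    kernel ((⟨P, hP⟩, p), (⟨Q, hQ⟩, k)) v
      = ((2 * Real.pi : ℝ) : ℂ)⁻¹ ^ n * detInvSqrt (-(Complex.I • (P - Q))) *
        Complex.exp (kernelExponent P Q p k (xpart v) (ypart v)) := by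
  simp only [kernel]
  rw [kernelVector_eq, kernelMatrix_quadratic hP hQ, kernelExponent]
  congr 2
  simp only [dotProduct, Pi.sub_apply]
  ring

/-- The two affine forms `x - Qy - ϰ` and `x - Py - π` transform simply under the group, and the
correction depends on `(x, y)` no longer. -/
theorem kernelExponent_eq {P Q : Matrix (Fin n) (Fin n) ℂ} (hP : P ∈ siegelUpper n)
    (hQ : Q ∈ siegelLower n) (p k x y : Fin n → ℂ) :
    kernelExponent P Q p k x y
      = -Complex.I * ((x - Q *ᵥ y - k) ⬝ᵥ (P - Q)⁻¹ *ᵥ (x - P *ᵥ y - p))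
        - Complex.I / 4 * ((p - k) ⬝ᵥ (P - Q)⁻¹ *ᵥ (p - k)) := by
  have hR := isUnit_det_of_mem_upper (sub_mem_upper hP hQ)
  have hRs : ((P - Q)⁻¹).IsSymm := symm_inv (hP.1.sub hQ.1)
  set lP := x - P *ᵥ y - p with hlP
  set lQ := x - Q *ᵥ y - k with hlQ
  set δ : Fin n → ℂ := p - k with hδ
  have e1 : (1 / 2 : ℂ) • (p + k) - x + P *ᵥ y = -lP - (1 / 2 : ℂ) • δ := by
    ext i; simp [hlP, hδ]; ring
  have e2 : (1 / 2 : ℂ) • (p + k) - x + Q *ᵥ y = -lQ + (1 / 2 : ℂ) • δ := by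
    ext i; simp [hlQ, hδ]; ring
  have e3 : lQ = lP + ((P - Q) *ᵥ y + δ) := by
    ext i; simp [hlP, hlQ, hδ, sub_mulVec]; ring
  have e4 : (P - Q)⁻¹ *ᵥ (P - Q) *ᵥ y = y := by
    rw [mulVec_mulVec, nonsing_inv_mul _ hR, one_mulVec]
  have e5 : lQ ⬝ᵥ (P - Q)⁻¹ *ᵥ δ = δ ⬝ᵥ (P - Q)⁻¹ *ᵥ lP + δ ⬝ᵥ y
      + δ ⬝ᵥ (P - Q)⁻¹ *ᵥ δ := by
    rw [hRs.dotProduct_mulVec_comm, e3, mulVec_add, mulVec_add, e4, dotProduct_add,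
      dotProduct_add, add_assoc]
  rw [kernelExponent, e1, e2, ← hδ, dotProduct_comm y δ]
  simp only [mulVec_sub, mulVec_neg, mulVec_smul, dotProduct_sub, add_dotProduct, dotProduct_neg,
    neg_dotProduct, dotProduct_smul, smul_dotProduct, smul_eq_mul, e5]
  ring

/-- The kernel of `K⁺ ⊗ K⁻`. -/
def tensorKernel (z : AZpos n × AZneg n) (w : Phase n) : ℂ :=
  kerPos z.1 (w ∘ Sum.inl) * kerNeg z.2 (w ∘ Sum.inr)

theorem rpow_quarter_mul_self :
    (((2 * Real.pi) ^ (-(n : ℝ) / 4) : ℝ) : ℂ) * (((2 * Real.pi) ^ (-(n : ℝ) / 4) : ℝ) : ℂ)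
      = (((2 * Real.pi) ^ (-(n : ℝ) / 2) : ℝ) : ℂ) := by
  rw [← Complex.ofReal_mul, ← Real.rpow_add (by positivity)]
  congr 2
  ring

theorem tensorKernel_apply {P Q : Matrix (Fin n) (Fin n) ℂ} (hP : P ∈ siegelUpper n)
    (hQ : Q ∈ siegelLower n) (p k : Fin n → ℂ) (w : Phase n) :
    tensorKernel ((⟨P, hP⟩, p), (⟨Q, hQ⟩, k)) w
      = (((2 * Real.pi) ^ (-(n : ℝ) / 2) : ℝ) : ℂ) *
        Complex.exp (Complex.I / 2 * (xpart w ⬝ᵥ P *ᵥ xpart w)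
            + Complex.I / (Real.sqrt 2 : ℂ) * (xpart w ⬝ᵥ p)
          - (Complex.I / 2 * (ypart w ⬝ᵥ Q *ᵥ ypart w)
            + Complex.I / (Real.sqrt 2 : ℂ) * (ypart w ⬝ᵥ k))) := by
  rw [← rpow_quarter_mul_self, sub_eq_add_neg, Complex.exp_add, tensorKernel, kerPos, kerNeg]
  simp only
  rw [neg_add, ← sub_eq_add_neg]
  simp only [Function.comp_apply]
  ring

theorem sqrt_two_mul_self : (Real.sqrt 2 : ℂ) * (Real.sqrt 2 : ℂ) = 2 := by
  rw [← Complex.ofReal_mul, Real.mul_self_sqrt (by norm_num)]; norm_num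

theorem sqrt_two_ne_zero : (Real.sqrt 2 : ℂ) ≠ 0 := by
  intro h
  have := sqrt_two_mul_self
  rw [h] at this
  norm_num at this

theorem I_div_sqrt_two : Complex.I / (Real.sqrt 2 : ℂ) = Complex.I * (Real.sqrt 2 : ℂ) / 2 := by
  rw [div_eq_div_iff sqrt_two_ne_zero two_ne_zero, mul_assoc, sqrt_two_mul_self]

/-- The substitution `(β, y) ↦ (y/√2 + β, y/√2 - β)`. -/
def sumDiff (β y : Fin n → ℝ) : Phase n :=
  Sum.elim ((Real.sqrt 2 / 2) • y + β) ((Real.sqrt 2 / 2) • y - β)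

/-- The integrand of the partial Fourier transform is a Gaussian function of `β`. -/
theorem tensorKernel_sumDiff_mul_exp {P Q : Matrix (Fin n) (Fin n) ℂ} (hP : P ∈ siegelUpper n)
    (hQ : Q ∈ siegelLower n) (p k : Fin n → ℂ) (β y : Fin n → ℝ) (x : Fin n → ℂ) :
    tensorKernel ((⟨P, hP⟩, p), (⟨Q, hQ⟩, k)) (sumDiff β y) *
        Complex.exp (-(Complex.I * (Real.sqrt 2 * (cvec β ⬝ᵥ x))))
      = ((((2 * Real.pi) ^ (-(n : ℝ) / 2) : ℝ) : ℂ) *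
          Complex.exp (Complex.I / 4 * (cvec y ⬝ᵥ (P - Q) *ᵥ cvec y)
            + Complex.I / 2 * (cvec y ⬝ᵥ (p - k)))) *
        gaussExp (-(Complex.I • (P - Q))) ((Complex.I * Real.sqrt 2) •
          ((1 / 2 : ℂ) • (p + k) - x + (1 / 2 : ℂ) • ((P + Q) *ᵥ cvec y))) β := by
  have hs := sqrt_two_mul_self
  set s : ℂ := (Real.sqrt 2 : ℂ) with hsd
  have ex : xpart (sumDiff β y) = (s / 2) • cvec y + cvec β := by
    ext i; simp [sumDiff, cvec, hsd, xpart]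
  have ey : ypart (sumDiff β y) = (s / 2) • cvec y - cvec β := by
    ext i; simp [sumDiff, cvec, hsd, ypart]
  rw [tensorKernel_apply, ex, ey, I_div_sqrt_two, gaussExp, mul_assoc, mul_assoc, ← Complex.exp_add,
    ← Complex.exp_add, ← hsd]
  congr 2
  have hPc := hP.1.dotProduct_mulVec_comm (cvec y) (cvec β)
  have hQc := hQ.1.dotProduct_mulVec_comm (cvec y) (cvec β)
  simp only [mulVec_add, mulVec_sub, mulVec_smul, dotProduct_add, dotProduct_sub, add_dotProduct,
    sub_dotProduct, smul_dotProduct, dotProduct_smul, smul_eq_mul, neg_mulVec, smul_mulVec,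
    sub_mulVec, add_mulVec, dotProduct_neg, hPc, hQc]
  linear_combination (Complex.I / 8 * (cvec y ⬝ᵥ P *ᵥ cvec y) - Complex.I / 8 *
    (cvec y ⬝ᵥ Q *ᵥ cvec y) + Complex.I / 4 * (cvec y ⬝ᵥ p) - Complex.I / 4 * (cvec y ⬝ᵥ k)) * hs

theorem inv_neg_I_smul {R : Matrix (Fin n) (Fin n) ℂ} (hR : IsUnit R.det) :
    (-(Complex.I • R))⁻¹ = Complex.I • R⁻¹ := by
  refine inv_eq_right_inv ?_
  rw [Matrix.neg_mul, Matrix.smul_mul, Matrix.mul_smul, smul_smul, mul_nonsing_inv _ hR,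
    Complex.I_mul_I, neg_smul, neg_neg, one_smul]

theorem rpow_half_cancel :
    (((2 * Real.pi) ^ (-(n : ℝ) / 2) : ℝ) : ℂ) * (((2 * Real.pi) ^ ((n : ℝ) / 2) : ℝ) : ℂ) = 1 := by
  rw [← Complex.ofReal_mul, ← Real.rpow_add (by positivity)]
  simp [neg_div]

/-- The kernel is a partial Fourier transform of the kernel of `K⁺ ⊗ K⁻`. -/
theorem kernel_eq_integral (z : AZpos n × AZneg n) (x y : Fin n → ℝ) :
    kernel z (Sum.elim x y) = ((2 * Real.pi : ℝ) : ℂ)⁻¹ ^ n * ∫ β : Fin n → ℝ,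
      tensorKernel z (sumDiff β y) *
        Complex.exp (-(Complex.I * (Real.sqrt 2 * (cvec β ⬝ᵥ cvec x)))) := by
  obtain ⟨⟨⟨P, hP⟩, p⟩, ⟨⟨Q, hQ⟩, k⟩⟩ := z
  have hRm := sub_mem_upper hP hQ
  have hR := isUnit_det_of_mem_upper hRm
  have hRs : ((P - Q)⁻¹).IsSymm := symm_inv (hP.1.sub hQ.1)
  have hAs : (-(Complex.I • (P - Q))).IsSymm := (hRm.1.smul _).neg
  simp_rw [tensorKernel_sumDiff_mul_exp hP hQ]
  rw [integral_const_mul, integral_gaussExp hAs (rePos_neg_I_smul hRm), kernel_eq hP hQ,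
    inv_neg_I_smul hR]
  have ex : xpart (Sum.elim x y) = cvec x := rfl
  have ey : ypart (Sum.elim x y) = cvec y := rfl
  rw [ex, ey]
  set m : Fin n → ℂ := (1 / 2 : ℂ) • (p + k) - cvec x + (1 / 2 : ℂ) • ((P + Q) *ᵥ cvec y) with hm
  have key : kernelExponent P Q p k (cvec x) (cvec y)
      = (Complex.I / 4 * (cvec y ⬝ᵥ (P - Q) *ᵥ cvec y) + Complex.I / 2 * (cvec y ⬝ᵥ (p - k)))
        + 1 / 2 * (((Complex.I * Real.sqrt 2) • m) ⬝ᵥ (Complex.I • (P - Q)⁻¹) *ᵥ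
          ((Complex.I * Real.sqrt 2) • m)) := by
    -- The two factors of the exponent are `m ± ½(P-Q)y`, so their product for `(P-Q)⁻¹` is a
    -- difference of squares. The square in `m` comes from the Gaussian integral over `β`, the
    -- square in `y` from the factor outside it.
    have e1 : (1 / 2 : ℂ) • (p + k) - cvec x + P *ᵥ cvec y
        = m + (1 / 2 : ℂ) • ((P - Q) *ᵥ cvec y) := by
      ext i; simp [hm, sub_mulVec, add_mulVec]; ring
    have e2 : (1 / 2 : ℂ) • (p + k) - cvec x + Q *ᵥ cvec y
        = m - (1 / 2 : ℂ) • ((P - Q) *ᵥ cvec y) := by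
      ext i; simp [hm, sub_mulVec, add_mulVec]; ring
    have e4 : (P - Q)⁻¹ *ᵥ (P - Q) *ᵥ cvec y = cvec y := by
      rw [mulVec_mulVec, nonsing_inv_mul _ hR, one_mulVec]
    have e5 : ((P - Q) *ᵥ cvec y) ⬝ᵥ (P - Q)⁻¹ *ᵥ m = m ⬝ᵥ cvec y := by
      rw [hRs.dotProduct_mulVec_comm, e4]
    have e6 : ((P - Q) *ᵥ cvec y) ⬝ᵥ cvec y = cvec y ⬝ᵥ (P - Q) *ᵥ cvec y := dotProduct_comm _ _
    rw [kernelExponent, e1, e2]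
    simp only [mulVec_add, mulVec_smul, dotProduct_add, sub_dotProduct, smul_dotProduct,
      dotProduct_smul, smul_eq_mul, smul_mulVec, e4, e5, e6]
    have hs := sqrt_two_mul_self
    have hI := Complex.I_mul_I
    linear_combination (-(m ⬝ᵥ (P - Q)⁻¹ *ᵥ m) * Complex.I / 2) *
      (Complex.I * Complex.I * hs + 2 * hI)
  rw [key, Complex.exp_add]
  linear_combination (-(((2 * Real.pi : ℝ) : ℂ)⁻¹ ^ n * detInvSqrt (-(Complex.I • (P - Q))) *
    Complex.exp (Complex.I / 4 * (cvec y ⬝ᵥ (P - Q) *ᵥ cvec y) + Complex.I / 2 *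
      (cvec y ⬝ᵥ (p - k))) * Complex.exp (1 / 2 * (((Complex.I * Real.sqrt 2) • m) ⬝ᵥ
        (Complex.I • (P - Q)⁻¹) *ᵥ ((Complex.I * Real.sqrt 2) • m))))) * rpow_half_cancel (n := n)

end Kernels

/-! ### Square integrability of the two kernels and comparison of their Gram matrices -/

section Gram

variable {n : ℕ}

theorem cvec_eq_elim (w : Phase n) : cvec w = Sum.elim (xpart w) (ypart w) := by
  ext i; rcases i with i | i <;> rfl

/-- The quadratic part of the exponent of the kernel of `K⁺ ⊗ K⁻`. -/
def tensorForm (z : AZpos n × AZneg n) : Matrix (Fin n ⊕ Fin n) (Fin n ⊕ Fin n) ℂ :=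
  fromBlocks (-(Complex.I • z.1.1.1)) 0 0 (Complex.I • z.2.1.1)

/-- The linear part of the exponent of the kernel of `K⁺ ⊗ K⁻`. -/
def tensorLinear (z : AZpos n × AZneg n) : Fin n ⊕ Fin n → ℂ :=
  Sum.elim ((Complex.I / (Real.sqrt 2 : ℂ)) • z.1.2) (-((Complex.I / (Real.sqrt 2 : ℂ)) • z.2.2))

theorem tensorKernel_eq (z : AZpos n × AZneg n) (w : Phase n) :
    tensorKernel z w = (((2 * Real.pi) ^ (-(n : ℝ) / 2) : ℝ) : ℂ) *
      gaussExp (tensorForm z) (tensorLinear z) w := by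
  obtain ⟨⟨⟨P, hP⟩, p⟩, ⟨⟨Q, hQ⟩, k⟩⟩ := z
  rw [tensorKernel_apply hP hQ, gaussExp, cvec_eq_elim, tensorForm, tensorLinear,
    fromBlocks_mulVec, sumElim_dotProduct_sumElim, sumElim_dotProduct_sumElim]
  simp only [Sum.elim_comp_inl, Sum.elim_comp_inr, zero_mulVec, add_zero, zero_add, neg_mulVec,
    smul_mulVec, dotProduct_neg, dotProduct_smul, smul_eq_mul]
  congr 2
  ring

theorem phase_ne_zero {v : Phase n} (hv : v ≠ 0) : v ∘ Sum.inl ≠ 0 ∨ v ∘ Sum.inr ≠ 0 := by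
  by_contra! h
  apply hv
  ext i
  rcases i with i | i
  · exact congrFun h.1 i
  · exact congrFun h.2 i

theorem rePos_tensorForm (z : AZpos n × AZneg n) : RePos (tensorForm z) := by
  obtain ⟨⟨⟨P, hP⟩, p⟩, ⟨⟨Q, hQ⟩, k⟩⟩ := z
  intro v hv
  have h1 := rePos_neg_I_smul hP
  have h2 := rePos_neg_I_smul (neg_mem_upper hQ)
  have h3 : ∀ {A : Matrix (Fin n) (Fin n) ℂ}, RePos A → ∀ u, 0 ≤ (cvec u ⬝ᵥ A *ᵥ cvec u).re := by
    intro A hA u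
    by_cases hu : u = 0
    · subst hu
      have : cvec (0 : Fin n → ℝ) = 0 := by ext i; simp
      rw [this]; simp
    · exact (hA u hu).le
  rw [cvec_eq_elim, tensorForm, fromBlocks_mulVec, sumElim_dotProduct_sumElim]
  simp only [Sum.elim_comp_inl, Sum.elim_comp_inr, zero_mulVec, add_zero, zero_add]
  rw [smul_neg, neg_neg] at h2
  rw [Complex.add_re]
  rcases phase_ne_zero hv with h | h
  · exact add_pos_of_pos_of_nonneg (h1 _ h) (h3 h2 (v ∘ Sum.inr))
  · exact add_pos_of_nonneg_of_pos (h3 h1 (v ∘ Sum.inl)) (h2 _ h)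

/-- With `q = (P-Q)⁻¹(x + Py)` and `p = q - y` one has `Pp - Qq = x`, and the imaginary part of the
form equals `-2 (Im p*Pp + Im q*(-Q)q)`. Both summands are nonnegative, and `p = q = 0` would force
`x = y = 0`. -/
theorem im_kernelMatrix_neg {P Q : Matrix (Fin n) (Fin n) ℂ} (hP : P ∈ siegelUpper n)
    (hQ : Q ∈ siegelLower n) (x y : Fin n → ℝ) (hxy : x ≠ 0 ∨ y ≠ 0) :
    (Sum.elim (cvec x) (cvec y) ⬝ᵥ kernelMatrix P Q *ᵥ Sum.elim (cvec x) (cvec y)).im < 0 := by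
  have hRm := sub_mem_upper hP hQ
  have hR := isUnit_det_of_mem_upper hRm
  rw [kernelMatrix_quadratic hP hQ]
  set q : Fin n → ℂ := (P - Q)⁻¹ *ᵥ (cvec x + P *ᵥ cvec y) with hq
  set p : Fin n → ℂ := q - cvec y with hp
  have hRq : (P - Q) *ᵥ q = cvec x + P *ᵥ cvec y := by
    rw [hq, mulVec_mulVec, mul_nonsing_inv _ hR, one_mulVec]
  have hx : P *ᵥ p = cvec x + Q *ᵥ q := by
    rw [sub_mulVec] at hRq
    rw [hp, mulVec_sub]
    ext i
    have := congrFun hRq i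
    simp only [Pi.sub_apply, Pi.add_apply] at this ⊢
    linear_combination this
  have hx2 : cvec x + Q *ᵥ cvec y = (P - Q) *ᵥ p := by
    rw [hp, mulVec_sub, hRq, sub_mulVec]
    ext i
    simp only [Pi.sub_apply, Pi.add_apply]
    ring
  have e1 : (cvec x + Q *ᵥ cvec y) ⬝ᵥ q = q ⬝ᵥ cvec x + cvec y ⬝ᵥ Q *ᵥ q := by
    rw [hx2, dotProduct_comm, sub_mulVec, dotProduct_sub, hx, dotProduct_add, hp, mulVec_sub,
      dotProduct_sub, hQ.1.dotProduct_mulVec_comm q (cvec y)]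
    ring
  have hsy : star (cvec y) = cvec y := by ext i; simp [cvec]
  have e2 : star p ⬝ᵥ P *ᵥ p - star q ⬝ᵥ Q *ᵥ q
      = star q ⬝ᵥ cvec x - cvec y ⬝ᵥ cvec x - cvec y ⬝ᵥ Q *ᵥ q := by
    rw [hx, hp, star_sub, hsy, sub_dotProduct, dotProduct_add, dotProduct_add]
    ring
  -- The reality of `x` and `y` enters here, to compare the bilinear expression in `e1` with the
  -- Hermitian ones in `e2`.
  have e3 : (star q ⬝ᵥ cvec x).im = -(q ⬝ᵥ cvec x).im := by
    simp [dotProduct]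
  have e4 : (cvec y ⬝ᵥ cvec x).im = 0 := by simp [dotProduct]
  have e5 : ((cvec x + Q *ᵥ cvec y) ⬝ᵥ q).im
      = -((star p ⬝ᵥ P *ᵥ p).im + (star q ⬝ᵥ (-Q) *ᵥ q).im) := by
    have := congrArg Complex.im e2
    rw [Complex.sub_im, Complex.sub_im, Complex.sub_im, e3, e4] at this
    rw [e1, Complex.add_im, neg_mulVec, dotProduct_neg, Complex.neg_im]
    linarith
  have hnn : ∀ {A : Matrix (Fin n) (Fin n) ℂ}, A ∈ siegelUpper n → ∀ u : Fin n → ℂ,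
      0 ≤ (star u ⬝ᵥ A *ᵥ u).im := by
    intro A hA u
    by_cases hu : u = 0
    · subst hu; simp
    · exact (im_quadratic hA hu).le
  have hmul : (2 * ((cvec x + Q *ᵥ cvec y) ⬝ᵥ q)).im = 2 * ((cvec x + Q *ᵥ cvec y) ⬝ᵥ q).im := by
    rw [show (2 : ℂ) = ((2 : ℝ) : ℂ) by norm_num, Complex.im_ofReal_mul]
  rw [hmul, e5]
  have hpq : p ≠ 0 ∨ q ≠ 0 := by
    by_contra! h
    have hy0 : y = 0 := by
      have : cvec y = 0 := by
        have := hp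
        rw [h.1, h.2, zero_sub] at this
        exact neg_eq_zero.1 this.symm
      ext i
      simpa [cvec] using congrFun this i
    have hx0 : x = 0 := by
      have : cvec x = 0 := by
        have := hx
        rw [h.1, h.2, mulVec_zero, mulVec_zero, add_zero] at this
        exact this.symm
      ext i
      simpa [cvec] using congrFun this i
    rcases hxy with h | h
    · exact h hx0
    · exact h hy0
  rcases hpq with h | h
  · have := im_quadratic hP h
    have := hnn (neg_mem_upper hQ) q
    linarith
  · have := im_quadratic (neg_mem_upper hQ) h
    have := hnn hP p
    linarith

/-- The reflection `(x, y) ↦ (-x, y)`. -/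
def reflect (n : ℕ) : Matrix (Fin n ⊕ Fin n) (Fin n ⊕ Fin n) ℂ := fromBlocks (-1) 0 0 1

theorem reflect_mulVec (w : Phase n) :
    reflect n *ᵥ cvec w = Sum.elim (-xpart w) (ypart w) := by
  rw [cvec_eq_elim, reflect, fromBlocks_mulVec]
  simp [neg_mulVec]

/-- The quadratic part of the exponent of the kernel. -/
def kernelForm (z : AZpos n × AZneg n) : Matrix (Fin n ⊕ Fin n) (Fin n ⊕ Fin n) ℂ :=
  Complex.I • ((reflect n)ᵀ * kernelMatrix z.1.1.1 z.2.1.1 * reflect n)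

theorem rePos_kernelForm (z : AZpos n × AZneg n) : RePos (kernelForm z) := by
  intro v hv
  rw [kernelForm, smul_mulVec, dotProduct_smul, quadratic_conj, reflect_mulVec, smul_eq_mul,
    Complex.I_mul_re]
  have h := im_kernelMatrix_neg z.1.1.2 z.2.1.2 (-(v ∘ Sum.inl)) (v ∘ Sum.inr) (by
    simpa using phase_ne_zero hv)
  have e : cvec (-(v ∘ Sum.inl)) = -xpart v := by ext i; simp [cvec]
  rw [e] at h
  exact neg_pos.2 h

theorem exists_kernel_eq (z : AZpos n × AZneg n) :
    ∃ (C : ℂ) (b : Fin n ⊕ Fin n → ℂ), ∀ v, kernel z v = C * gaussExp (kernelForm z) b v := by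
  obtain ⟨⟨⟨P, hP⟩, p⟩, ⟨⟨Q, hQ⟩, k⟩⟩ := z
  set M := kernelMatrix P Q
  set w₀ : Fin n ⊕ Fin n → ℂ := Sum.elim ((1 / 2 : ℂ) • (p + k)) 0 with hw
  refine ⟨((2 * Real.pi : ℝ) : ℂ)⁻¹ ^ n * detInvSqrt (-(Complex.I • (P - Q))) *
    Complex.exp (-(Complex.I / 2) * (w₀ ⬝ᵥ M *ᵥ w₀)),
    -(Complex.I / 2) • ((reflect n)ᵀ *ᵥ (M *ᵥ w₀) + (reflect n)ᵀ *ᵥ (Mᵀ *ᵥ w₀))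
      + Sum.elim (0 : Fin n → ℂ) ((Complex.I / 2) • (p - k)), fun v => ?_⟩
  simp only [kernel]
  rw [mul_assoc _ (Complex.exp _), gaussExp, ← Complex.exp_add]
  congr 2
  have e1 : kernelVector p k v = w₀ + reflect n *ᵥ cvec v := by
    rw [kernelVector_eq, reflect_mulVec, hw]
    ext i
    rcases i with i | i
    · simp [sub_eq_add_neg]
    · simp
  have e2 : ∑ i, (v (Sum.inr i) : ℂ) * (p i - k i) = ypart v ⬝ᵥ (p - k) := rfl
  have e3 : ∀ a, cvec v ⬝ᵥ (reflect n)ᵀ *ᵥ a = (reflect n *ᵥ cvec v) ⬝ᵥ a := fun a => by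
    rw [dotProduct_mulVec, vecMul_transpose]
  -- The two cross terms are kept apart, one through `M` and one through `Mᵀ`, so no symmetry of `M`
  -- has to be proved.
  have e4 : (reflect n *ᵥ cvec v) ⬝ᵥ Mᵀ *ᵥ w₀ = w₀ ⬝ᵥ M *ᵥ reflect n *ᵥ cvec v := by
    rw [dotProduct_mulVec, vecMul_transpose, dotProduct_comm]
  have e5 : cvec v ⬝ᵥ Sum.elim (0 : Fin n → ℂ) ((Complex.I / 2) • (p - k))
      = Complex.I / 2 * (ypart v ⬝ᵥ (p - k)) := by
    rw [cvec_eq_elim, sumElim_dotProduct_sumElim, dotProduct_zero, zero_add, dotProduct_smul,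
      smul_eq_mul]
  rw [e1, e2, kernelForm, smul_mulVec, dotProduct_smul, quadratic_conj]
  simp only [dotProduct_add, add_dotProduct, mulVec_add, dotProduct_smul, e3, e4, e5, smul_eq_mul]
  change _ = _ + (-(1 / 2) * (Complex.I * (reflect n *ᵥ cvec v ⬝ᵥ M *ᵥ reflect n *ᵥ cvec v)) + _)
  ring

theorem continuous_kernel (z : AZpos n × AZneg n) : Continuous (kernel z) := by
  obtain ⟨C, b, h⟩ := exists_kernel_eq z
  rw [funext h]
  exact continuous_const.mul (continuous_gaussExp _ _)

theorem memLp_kernel (z : AZpos n × AZneg n) : MemLp (kernel z) 2 := by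
  obtain ⟨C, b, h⟩ := exists_kernel_eq z
  rw [funext h]
  exact (memLp_gaussExp (rePos_kernelForm z) b).const_mul C

theorem memLp_tensorKernel (z : AZpos n × AZneg n) : MemLp (tensorKernel z) 2 := by
  rw [funext (tensorKernel_eq z)]
  exact (memLp_gaussExp (rePos_tensorForm z) _).const_mul _

/-- This supplies the integrable-transform hypothesis of `plancherel`, since a slice of the kernel
is a rescaled Fourier transform. -/
theorem integrable_kernel_slice (z : AZpos n × AZneg n) (y : Fin n → ℝ) :
    Integrable fun x : Fin n → ℝ => kernel z (Sum.elim x y) := by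
  obtain ⟨C, b, h⟩ := exists_kernel_eq z
  obtain ⟨ε, hε, K, hK⟩ := exists_norm_gaussExp_le (rePos_kernelForm z) b
  have hc : Continuous fun x : Fin n → ℝ => (Sum.elim x y : Phase n) := by
    refine continuous_pi fun i => ?_
    rcases i with i | i
    · exact continuous_apply i
    · exact continuous_const
  refine ((integrable_exp_neg_sq_norm hε).const_mul (‖C‖ * Real.exp K)).mono'
    ((continuous_kernel z).comp hc).aestronglyMeasurable (.of_forall fun x => ?_)
  rw [h, norm_mul, mul_assoc, ← Real.exp_add]
  refine mul_le_mul_of_nonneg_left ((hK _).trans (Real.exp_le_exp.2 ?_)) (norm_nonneg _)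
  have h1 : ‖x‖ ≤ ‖(Sum.elim x y : Phase n)‖ := by
    refine (pi_norm_le_iff_of_nonneg (norm_nonneg _)).2 fun i => ?_
    exact norm_le_pi_norm (Sum.elim x y : Phase n) (Sum.inl i)
  have h2 := pow_le_pow_left₀ (norm_nonneg _) h1 2
  nlinarith

theorem tensorKernel_sumDiff (z : AZpos n × AZneg n) (y : Fin n → ℝ) :
    ∃ (C : ℂ) (b : Fin n → ℂ), ∀ β : Fin n → ℝ, tensorKernel z (sumDiff β y)
      = C * gaussExp (-(Complex.I • (z.1.1.1 - z.2.1.1))) b β := by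
  obtain ⟨⟨⟨P, hP⟩, p⟩, ⟨⟨Q, hQ⟩, k⟩⟩ := z
  exact ⟨_, _, fun β => (by simp : _ = _ * Complex.exp (-(Complex.I *
    (Real.sqrt 2 * (cvec β ⬝ᵥ 0))))).trans (tensorKernel_sumDiff_mul_exp hP hQ p k β y 0)⟩

theorem integral_phase {f : Phase n → ℂ} (hf : Integrable f) :
    ∫ v, f v = ∫ y : Fin n → ℝ, ∫ x : Fin n → ℝ, f (Sum.elim x y) := by
  have mp := (volume_measurePreserving_sumPiEquivProdPi fun _ : Fin n ⊕ Fin n => ℝ).symm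
  rw [← mp.integral_comp', Measure.volume_eq_prod, integral_prod_symm]
  · rfl
  · exact (mp.integrable_comp_emb (MeasurableEquiv.measurableEmbedding _)).2 hf

/-- The matrix of the substitution `sumDiff`. -/
def sumDiffMatrix (n : ℕ) : Matrix (Fin n ⊕ Fin n) (Fin n ⊕ Fin n) ℝ :=
  fromBlocks 1 ((Real.sqrt 2 / 2) • 1) (-1) ((Real.sqrt 2 / 2) • 1)

theorem sumDiffMatrix_mulVec (v : Phase n) :
    sumDiffMatrix n *ᵥ v = sumDiff (v ∘ Sum.inl) (v ∘ Sum.inr) := by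
  rw [sumDiffMatrix, ← Sum.elim_comp_inl_inr v, fromBlocks_mulVec, sumDiff]
  simp only [Sum.elim_comp_inl, Sum.elim_comp_inr, one_mulVec, smul_mulVec, neg_mulVec]
  congr 1
  · rw [add_comm]
  · rw [add_comm, sub_eq_add_neg]

theorem det_sumDiffMatrix : (sumDiffMatrix n).det = Real.sqrt 2 ^ n := by
  rw [sumDiffMatrix, det_fromBlocks_one₁₁, Matrix.neg_mul, Matrix.one_mul, sub_neg_eq_add,
    ← add_smul, add_halves, det_smul, det_one, mul_one, Fintype.card_fin]

/-- For fixed `y` the kernel is `(2π)⁻ⁿ` times a Fourier transform in `β`, taken at `√2 x`.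
Plancherel and the scaling `x ↦ √2 x` give `(2π)⁻²ⁿ (2π)ⁿ 2^(-n/2)`; the substitution `sumDiff`
contributes another `2^(-n/2)`, and the product is `(4π)⁻ⁿ`. -/
theorem integral_gram (z z' : AZpos n × AZneg n) :
    ∫ v, starRingEnd ℂ (kernel z v) * kernel z' v
      = ((((4 * Real.pi) ^ n)⁻¹ : ℝ) : ℂ) *
        ∫ w, starRingEnd ℂ (tensorKernel z w) * tensorKernel z' w := by
  have hk : Integrable fun v => starRingEnd ℂ (kernel z v) * kernel z' v :=
    (memLp_kernel z).star.integrable_mul (memLp_kernel z')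
  have ht : Integrable fun w => starRingEnd ℂ (tensorKernel z w) * tensorKernel z' w :=
    (memLp_tensorKernel z).star.integrable_mul (memLp_tensorKernel z')
  have h2 : (0 : ℝ) < Real.sqrt 2 := by positivity
  have hdet : (sumDiffMatrix n).det ≠ 0 := by rw [det_sumDiffMatrix]; positivity
  set κ : ℂ := ((2 * Real.pi : ℝ) : ℂ)⁻¹ ^ n with hκ
  have hκc : starRingEnd ℂ κ = κ := by
    rw [hκ, map_pow, map_inv₀, Complex.conj_ofReal]
  have slice : ∀ y : Fin n → ℝ,
      ∫ x : Fin n → ℝ, starRingEnd ℂ (kernel z (Sum.elim x y)) * kernel z' (Sum.elim x y)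
        = (κ * (((Real.sqrt 2 ^ n)⁻¹ : ℝ) : ℂ)) * ∫ β : Fin n → ℝ,
          starRingEnd ℂ (tensorKernel z (sumDiff β y)) * tensorKernel z' (sumDiff β y) := by
    intro y
    set F : (Fin n → ℝ) → ℂ := fun β => tensorKernel z (sumDiff β y) with hF
    set G : (Fin n → ℝ) → ℂ := fun β => tensorKernel z' (sumDiff β y) with hG
    have prop : ∀ z : AZpos n × AZneg n,
        Continuous (fun β => tensorKernel z (sumDiff β y)) ∧
        Integrable (fun β => tensorKernel z (sumDiff β y)) := by
      intro z
      obtain ⟨C, b, h⟩ := tensorKernel_sumDiff z y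
      rw [funext h]
      exact ⟨continuous_const.mul (continuous_gaussExp _ _), (integrable_gaussExp
        (rePos_neg_I_smul (sub_mem_upper z.1.1.2 z.2.1.2)) b).const_mul _⟩
    set hat : ((Fin n → ℝ) → ℂ) → (Fin n → ℝ) → ℂ := fun F w =>
      ∫ v, F v * Complex.exp (-(Complex.I * ∑ i, (v i : ℂ) * w i)) with hhat
    have hker : ∀ (z : AZpos n × AZneg n) (x : Fin n → ℝ), kernel z (Sum.elim x y)
        = κ * hat (fun β => tensorKernel z (sumDiff β y)) (Real.sqrt 2 • x) := by
      intro z x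
      rw [kernel_eq_integral]
      congr 1
      refine integral_congr_ae (.of_forall fun β => ?_)
      simp only [dotProduct, Finset.mul_sum, Pi.smul_apply, smul_eq_mul, Complex.ofReal_mul]
      congr! 5
      ring
    have hκ0 : κ ≠ 0 := by
      rw [hκ]
      refine pow_ne_zero _ (inv_ne_zero ?_)
      exact_mod_cast (by positivity : (2 * Real.pi) ≠ 0)
    have hFh : Integrable (hat F) := by
      have h3 := (integrable_kernel_slice z y).const_mul κ⁻¹
      simp_rw [hker z, ← mul_assoc, inv_mul_cancel₀ hκ0, one_mul] at h3
      exact (integrable_comp_smul_iff volume (hat F) h2.ne').1 h3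
    have hpl := plancherel (prop z).1 (prop z).2 (prop z').2 hFh
    simp_rw [hker z, hker z', map_mul, hκc]
    have h4 := Measure.integral_comp_smul volume
      (fun w : Fin n → ℝ => starRingEnd ℂ (hat F w) * hat G w) (Real.sqrt 2)
    have h5 : ∀ x : Fin n → ℝ,
        κ * starRingEnd ℂ (hat F (Real.sqrt 2 • x)) * (κ * hat G (Real.sqrt 2 • x))
          = κ ^ 2 * (starRingEnd ℂ (hat F (Real.sqrt 2 • x)) * hat G (Real.sqrt 2 • x)) :=
      fun x => by ring
    rw [integral_congr_ae (.of_forall h5), integral_const_mul, h4]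
    simp only [hhat]
    rw [hpl, Module.finrank_fintype_fun_eq_card, Fintype.card_fin, abs_of_pos (by positivity),
      Complex.real_smul]
    have hpi : ((2 * Real.pi : ℝ) : ℂ) ≠ 0 := by
      exact_mod_cast (by positivity : (2 : ℝ) * Real.pi ≠ 0)
    have h6 : κ * (((2 * Real.pi) ^ n : ℝ) : ℂ) = 1 := by
      rw [hκ, Complex.ofReal_pow, ← mul_pow, inv_mul_cancel₀ hpi, one_pow]
    linear_combination (κ * (((Real.sqrt 2 ^ n)⁻¹ : ℝ) : ℂ) *
      ∫ v, starRingEnd ℂ (F v) * G v) * h6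
  have hcomp := integral_comp_mulVec hdet
    (fun w => starRingEnd ℂ (tensorKernel z w) * tensorKernel z' w)
  have hint : Integrable fun v : Phase n => starRingEnd ℂ (tensorKernel z (sumDiffMatrix n *ᵥ v)) *
      tensorKernel z' (sumDiffMatrix n *ᵥ v) := by
    have h := Real.map_matrix_volume_pi_eq_smul_volume_pi hdet
    have hm : Measurable (toLin' (sumDiffMatrix n)) :=
      (LinearMap.continuous_of_finiteDimensional _).measurable
    refine Integrable.comp_measurable (f := toLin' (sumDiffMatrix n))
      (g := fun w => starRingEnd ℂ (tensorKernel z w) * tensorKernel z' w) ?_ hm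
    rw [h]
    exact ht.smul_measure ENNReal.ofReal_ne_top
  rw [integral_phase hk]
  simp_rw [slice]
  rw [integral_const_mul]
  rw [integral_phase hint] at hcomp
  simp only [sumDiffMatrix_mulVec, Sum.elim_comp_inl, Sum.elim_comp_inr] at hcomp
  rw [hcomp, det_sumDiffMatrix, abs_of_pos (by positivity), ← mul_assoc]
  congr 1
  rw [hκ]
  push_cast
  rw [← inv_pow, ← inv_pow, ← mul_pow, ← mul_pow]
  congr 1
  have hs := sqrt_two_mul_self
  have hs0 := sqrt_two_ne_zero
  have hpi : (Real.pi : ℂ) ≠ 0 := by exact_mod_cast Real.pi_ne_zero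
  field_simp
  linear_combination -2 * hs

end Gram

/-! ### Totality of the kernels, and the factorization of `𝔍` through `K⁺ ⊗ K⁻` -/

section Unitary

/-- Equal Gram matrices make `∑ c_z a_z ↦ ∑ c_z b_z` isometric. Totality makes its domain and range
dense, so it extends to a unitary operator. -/
theorem exists_unitary_of_gram {H Z : Type*} [NormedAddCommGroup H] [InnerProductSpace ℂ H]
    [CompleteSpace H] (a b : Z → H) (ha : ∀ f, (∀ z, inner ℂ (a z) f = 0) → f = 0)
    (hb : ∀ f, (∀ z, inner ℂ (b z) f = 0) → f = 0)
    (h : ∀ z z', inner ℂ (a z) (a z') = inner ℂ (b z) (b z')) :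
    ∃ U : H ≃ₗᵢ[ℂ] H, ∀ z, U (a z) = b z := by
  have dense : ∀ a : Z → H, (∀ f, (∀ z, inner ℂ (a z) f = 0) → f = 0) →
      DenseRange (Finsupp.linearCombination ℂ a) := by
    intro a ha
    rw [DenseRange, ← LinearMap.coe_range, Finsupp.range_linearCombination,
      Submodule.dense_iff_topologicalClosure_eq_top, Submodule.topologicalClosure_eq_top_iff,
      Submodule.eq_bot_iff]
    intro f hf
    exact ha f fun z => (Submodule.mem_orthogonal _ f).1 hf _ (Submodule.subset_span ⟨z, rfl⟩)
  have hin : ∀ c : Z →₀ ℂ, inner ℂ (Finsupp.linearCombination ℂ b c)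
      (Finsupp.linearCombination ℂ b c)
        = inner ℂ (Finsupp.linearCombination ℂ a c) (Finsupp.linearCombination ℂ a c) := by
    intro c
    simp only [Finsupp.linearCombination_apply, Finsupp.sum_inner, Finsupp.inner_sum, inner_smul_left,
      inner_smul_right, h]
  have hnorm : ∀ c : Z →₀ ℂ, ‖Finsupp.linearCombination ℂ b c‖
      = ‖Finsupp.linearCombination ℂ a c‖ := by
    intro c
    rw [norm_eq_sqrt_re_inner (𝕜 := ℂ), hin, ← norm_eq_sqrt_re_inner]
  refine ⟨(LinearEquiv.refl ℂ (Z →₀ ℂ)).extendOfIsometry (Finsupp.linearCombination ℂ a)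
    (Finsupp.linearCombination ℂ b) (dense a ha) (dense b hb) hnorm, fun z => ?_⟩
  have := LinearEquiv.extendOfIsometry_eq (LinearEquiv.refl ℂ (Z →₀ ℂ))
    (Finsupp.linearCombination ℂ a) (Finsupp.linearCombination ℂ b) (dense a ha) (dense b hb) hnorm
    (Finsupp.single z 1)
  simpa using this

variable {n : ℕ}

theorem rePos_one {ι : Type*} [Fintype ι] [DecidableEq ι] : RePos (1 : Matrix ι ι ℂ) := by
  intro v hv
  have : cvec v ⬝ᵥ cvec v = ((v ⬝ᵥ v : ℝ) : ℂ) := by simp [dotProduct]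
  rw [one_mulVec, this, Complex.ofReal_re]
  exact lt_of_le_of_ne (Finset.sum_nonneg fun i _ => mul_self_nonneg _)
    fun h => hv (dotProduct_self_eq_zero.1 h.symm)

/-- The standard Gaussian function `exp (-½ |v|²)`. -/
def stdGauss {ι : Type*} [Fintype ι] [DecidableEq ι] : (ι → ℝ) → ℂ := gaussExp 1 0

theorem gaussExp_one_I {ι : Type*} [Fintype ι] [DecidableEq ι] (a : ι → ℝ) (v : ι → ℝ) :
    gaussExp 1 (Complex.I • cvec a) v
      = stdGauss v * Complex.exp (Complex.I * ∑ i, (v i : ℂ) * a i) := by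
  rw [stdGauss, gaussExp, gaussExp, ← Complex.exp_add, dotProduct_zero, add_zero, dotProduct_smul]
  rfl

/-- The integrals are the values of the Fourier transform of `f` times the standard Gaussian, which
is integrable, and the Gaussian has no zeros. -/
theorem ae_eq_zero_of_forall_integral_gauss {ι : Type*} [Fintype ι] [DecidableEq ι]
    {f : (ι → ℝ) → ℂ} (hf : SubGaussian f)
    (h : ∀ a : ι → ℝ, ∫ v, f v * gaussExp 1 (Complex.I • cvec a) v = 0) : f =ᵐ[volume] 0 := by
  have h1 : Integrable fun v => f v * stdGauss v := hf.integrable_mul_gaussExp rePos_one 0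
  have h2 := ae_eq_zero_of_forall_integral_exp h1 fun a => by
    rw [← h a]
    simp_rw [gaussExp_one_I, mul_assoc]
  filter_upwards [h2] with v hv
  exact (mul_eq_zero.1 hv).resolve_right (Complex.exp_ne_zero _)

theorem I_mem_upper : Complex.I • (1 : Matrix (Fin n) (Fin n) ℂ) ∈ siegelUpper n :=
  I_smul_mem_siegelUpper isSymm_one rePos_one

theorem neg_I_mem_lower : -(Complex.I • (1 : Matrix (Fin n) (Fin n) ℂ)) ∈ siegelLower n := by
  refine ⟨(isSymm_one.smul _).neg, ?_⟩
  have : -((-(Complex.I • (1 : Matrix (Fin n) (Fin n) ℂ))).map Complex.im)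
      = (Complex.I • (1 : Matrix (Fin n) (Fin n) ℂ)).map Complex.im := by ext i j; simp
  rw [this]
  exact I_mem_upper.2

theorem exists_tensorKernel_eq_gaussExp (a : Phase n) :
    ∃ z : AZpos n × AZneg n, ∃ c : ℂ, c ≠ 0 ∧
      ∀ w, tensorKernel z w = c * gaussExp 1 (Complex.I • cvec a) w := by
  refine ⟨((⟨_, I_mem_upper⟩, (Real.sqrt 2 : ℂ) • xpart a),
    (⟨_, neg_I_mem_lower⟩, -((Real.sqrt 2 : ℂ) • ypart a))),
    (((2 * Real.pi) ^ (-(n : ℝ) / 2) : ℝ) : ℂ), ?_, fun w => ?_⟩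
  · exact_mod_cast (by positivity : (2 * Real.pi) ^ (-(n : ℝ) / 2) ≠ 0)
  · rw [tensorKernel_eq]
    congr 2
    · simp [tensorForm, smul_smul]
    · rw [tensorLinear, cvec_eq_elim]
      have hs := sqrt_two_ne_zero
      ext i
      rcases i with i | i
      · simp; field_simp
      · simp; field_simp

theorem exists_kernel_eq_gaussExp (a : Phase n) :
    ∃ z : AZpos n × AZneg n, ∃ c : ℂ, c ≠ 0 ∧
      ∀ v, kernel z v = c * gaussExp 1 (Complex.I • cvec a) v := by
  have hRm := sub_mem_upper (n := n) I_mem_upper neg_I_mem_lower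
  -- At `P = i`, `Q = -i` the quadratic part is the standard one. The linear term of the exponent
  -- depends on `π + ϰ` and `π - ϰ`, which must be `2i a_x` and `2 a_y` to give the character with
  -- frequency `a`.
  refine ⟨((⟨_, I_mem_upper⟩, Complex.I • xpart a + ypart a),
    (⟨_, neg_I_mem_lower⟩, Complex.I • xpart a - ypart a)),
    ((2 * Real.pi : ℝ) : ℂ)⁻¹ ^ n * detInvSqrt (-(Complex.I •
      (Complex.I • (1 : Matrix (Fin n) (Fin n) ℂ) - -(Complex.I • 1)))) *
        Complex.exp (1 / 2 * (xpart a ⬝ᵥ xpart a)), ?_, fun v => ?_⟩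
  · refine mul_ne_zero (mul_ne_zero (pow_ne_zero _ (inv_ne_zero ?_)) ?_) (Complex.exp_ne_zero _)
    · exact_mod_cast (by positivity : (2 : ℝ) * Real.pi ≠ 0)
    · exact detInvSqrt_ne_zero (hRm.1.smul _).neg (rePos_neg_I_smul hRm)
  · rw [kernel_eq I_mem_upper neg_I_mem_lower, mul_assoc _ (Complex.exp (1 / 2 * _)), gaussExp,
      ← Complex.exp_add]
    congr 2
    have hinv : (Complex.I • (1 : Matrix (Fin n) (Fin n) ℂ) - -(Complex.I • 1))⁻¹
        = (-(Complex.I / 2)) • 1 := by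
      refine inv_eq_right_inv ?_
      rw [sub_neg_eq_add, ← add_smul, Matrix.smul_mul, Matrix.one_mul, smul_smul]
      have : (Complex.I + Complex.I) * (-(Complex.I / 2)) = 1 := by
        linear_combination -Complex.I_mul_I
      rw [this, one_smul]
    have hm : (1 / 2 : ℂ) • (Complex.I • xpart a + ypart a + (Complex.I • xpart a - ypart a))
        = Complex.I • xpart a := by
      ext i; simp; ring
    have hd : Complex.I • xpart a + ypart a - (Complex.I • xpart a - ypart a)
        = (2 : ℂ) • ypart a := by
      ext i; simp; ring
    rw [kernelExponent, hinv, hm, hd, cvec_eq_elim, cvec_eq_elim, one_mulVec,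
      sumElim_dotProduct_sumElim, dotProduct_smul Complex.I (Sum.elim (xpart v) (ypart v)), sumElim_dotProduct_sumElim]
    simp only [smul_mulVec, one_mulVec, neg_mulVec, dotProduct_add, dotProduct_sub, add_dotProduct,
      sub_dotProduct, dotProduct_smul, smul_dotProduct, smul_eq_mul, neg_dotProduct,
      dotProduct_comm (xpart a) (xpart v), dotProduct_comm (ypart v) (xpart v),
      dotProduct_comm (ypart v) (xpart a)]
    linear_combination (1 / 2 * (Complex.I ^ 2 - 1) * (xpart a ⬝ᵥ xpart a)
      + 1 / 2 * (xpart v ⬝ᵥ xpart v) - 1 / 2 * (Complex.I ^ 2 - 1) * (ypart v ⬝ᵥ ypart v)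
      - Complex.I * (xpart v ⬝ᵥ xpart a)) * Complex.I_mul_I

/-- The complex conjugate of the kernel, as an element of `L²`. -/
def kernelVec (z : AZpos n × AZneg n) : L2 n := (memLp_kernel z).star.toLp _

/-- The complex conjugate of the kernel of `K⁺ ⊗ K⁻`, as an element of `L²`. -/
def tensorVec (z : AZpos n × AZneg n) : L2 n := (memLp_tensorKernel z).star.toLp _

theorem inner_kernelVec (z : AZpos n × AZneg n) (f : L2 n) :
    inner ℂ (kernelVec z) f = ∫ v, f v * kernel z v := by
  rw [L2.inner_def]
  refine integral_congr_ae ?_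
  filter_upwards [(memLp_kernel z).star.coeFn_toLp] with v hv
  rw [kernelVec, hv, RCLike.inner_apply]
  simp

theorem inner_tensorVec (z : AZpos n × AZneg n) (f : L2 n) :
    inner ℂ (tensorVec z) f = tensorTransform f z := by
  rw [L2.inner_def]
  refine integral_congr_ae ?_
  filter_upwards [(memLp_tensorKernel z).star.coeFn_toLp] with v hv
  rw [tensorVec, hv, RCLike.inner_apply]
  simp [tensorKernel]

theorem eq_zero_of_inner_tensorVec {f : L2 n} (h : ∀ z, inner ℂ (tensorVec z) f = 0) : f = 0 := by
  rw [Lp.eq_zero_iff_ae_eq_zero]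
  refine ae_eq_zero_of_forall_integral_gauss (subGaussian_of_memLp (Lp.memLp f)) fun a => ?_
  obtain ⟨z, c, hc, hz⟩ := exists_tensorKernel_eq_gaussExp a
  have h1 := h z
  rw [inner_tensorVec, tensorTransform] at h1
  change ∫ w, f w * tensorKernel z w = 0 at h1
  simp_rw [hz, mul_left_comm _ c] at h1
  rw [integral_const_mul] at h1
  exact (mul_eq_zero.1 h1).resolve_left hc

theorem eq_zero_of_inner_kernelVec {f : L2 n} (h : ∀ z, inner ℂ (kernelVec z) f = 0) : f = 0 := by
  rw [Lp.eq_zero_iff_ae_eq_zero]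
  refine ae_eq_zero_of_forall_integral_gauss (subGaussian_of_memLp (Lp.memLp f)) fun a => ?_
  obtain ⟨z, c, hc, hz⟩ := exists_kernel_eq_gaussExp a
  have h1 := h z
  rw [inner_kernelVec] at h1
  simp_rw [hz, mul_left_comm _ c] at h1
  rw [integral_const_mul] at h1
  exact (mul_eq_zero.1 h1).resolve_left hc

theorem inner_kernelVec_kernelVec (z z' : AZpos n × AZneg n) :
    inner ℂ (kernelVec z) (kernelVec z')
      = ((((4 * Real.pi) ^ n)⁻¹ : ℝ) : ℂ) * inner ℂ (tensorVec z) (tensorVec z') := by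
  -- The vectors are conjugated kernels, so the inner product exchanges the roles of `z` and `z'`.
  have h := integral_gram z' z
  rw [inner_kernelVec, inner_tensorVec, tensorTransform]
  convert h using 1
  · refine integral_congr_ae ?_
    filter_upwards [(memLp_kernel z').star.coeFn_toLp] with v hv
    rw [kernelVec, hv]
    simp
  · congr 1
    refine integral_congr_ae ?_
    filter_upwards [(memLp_tensorKernel z').star.coeFn_toLp] with v hv
    rw [tensorVec, hv]
    simp [tensorKernel]

/-- The constant `(4π)^(-n/2)`. -/
def normConst (n : ℕ) : ℝ := (4 * Real.pi) ^ (-(n : ℝ) / 2)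

theorem normConst_pos : 0 < normConst n := by unfold normConst; positivity

theorem normConst_mul_self : normConst n * normConst n = ((4 * Real.pi) ^ n)⁻¹ := by
  rw [normConst, ← Real.rpow_add (by positivity), ← Real.rpow_natCast,
    ← Real.rpow_neg (by positivity)]
  congr 1
  ring

variable (n) in
theorem exists_unitary : ∃ U : L2 n ≃ₗᵢ[ℂ] L2 n,
    ∀ z, U (kernelVec z) = (normConst n : ℂ) • tensorVec z := by
  have hc : (normConst n : ℂ) ≠ 0 := by exact_mod_cast normConst_pos.ne'
  refine exists_unitary_of_gram _ _ (fun f => eq_zero_of_inner_kernelVec) (fun f hf => ?_)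
    fun z z' => ?_
  · refine eq_zero_of_inner_tensorVec fun z => ?_
    have := hf z
    rw [inner_smul_left, Complex.conj_ofReal] at this
    exact (mul_eq_zero.1 this).resolve_left hc
  · rw [inner_smul_left, inner_smul_right, Complex.conj_ofReal, inner_kernelVec_kernelVec,
      ← normConst_mul_self, Complex.ofReal_mul, mul_assoc]

variable (n) in
/-- The unitary operator of `L²` by which the integral transform factors through `K⁺ ⊗ K⁻`. -/
def unitary : L2 n ≃ₗᵢ[ℂ] L2 n := (exists_unitary n).choose

variable (n) in
/-- The integral transform with kernel `kernel`. -/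
def transform : L2 n →ₗ[ℂ] (AZpos n × AZneg n → ℂ) :=
  LinearMap.pi fun z => (innerSL ℂ (kernelVec z)).toLinearMap

theorem transform_eq_inner (f : L2 n) (z : AZpos n × AZneg n) :
    transform n f z = inner ℂ (kernelVec z) f := rfl

theorem transform_apply (f : L2 n) (z : AZpos n × AZneg n) :
    transform n f z = ∫ v, f v * kernel z v := inner_kernelVec z f

theorem integrable_mul_kernel (f : L2 n) (z : AZpos n × AZneg n) :
    Integrable fun v => f v * kernel z v :=
  (Lp.memLp f).integrable_mul (memLp_kernel z)

/-- Both transforms are inner products with their kernel vectors, and `unitary n` carries one family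
of vectors to the other up to the real constant `normConst n`. -/
theorem transform_eq_tensorTransform (f : L2 n) :
    transform n f = tensorTransform ((normConst n : ℂ) • unitary n f) := by
  funext z
  rw [transform_eq_inner, ← inner_tensorVec, inner_smul_right,
    ← LinearIsometryEquiv.inner_map_map (unitary n), unitary, (exists_unitary n).choose_spec,
    inner_smul_left, Complex.conj_ofReal]

theorem tensorTransform_injective {φ ψ : L2 n} (h : tensorTransform φ = tensorTransform ψ) :
    φ = ψ := by
  rw [← sub_eq_zero]
  refine eq_zero_of_inner_tensorVec fun z => ?_
  rw [inner_sub_right, inner_tensorVec, inner_tensorVec, h, sub_self]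

/-- As `K⁺ ⊗ K⁻` is injective, the infimum that defines `hNorm` runs over a single number. -/
theorem hNorm_tensorTransform (φ : L2 n) : hNorm (tensorTransform φ) = ‖φ‖ := by
  have : {t : ℝ | ∃ ψ : L2 n, tensorTransform ψ = tensorTransform φ ∧ t = ‖ψ‖} = {‖φ‖} := by
    ext t
    constructor
    · rintro ⟨ψ, hψ, rfl⟩
      rw [tensorTransform_injective hψ]
      rfl
    · rintro rfl
      exact ⟨φ, rfl, rfl⟩
  rw [hNorm, this, csInf_singleton]

theorem transform_injective : Function.Injective (transform n) := by
  intro f g h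
  rw [← sub_eq_zero]
  refine eq_zero_of_inner_kernelVec fun z => ?_
  rw [inner_sub_right, ← transform_eq_inner, ← transform_eq_inner, h, sub_self]

theorem hNorm_transform (f : L2 n) : hNorm (transform n f) = normConst n * ‖f‖ := by
  rw [transform_eq_tensorTransform, hNorm_tensorTransform, norm_smul, LinearIsometryEquiv.norm_map,
    Complex.norm_real, Real.norm_of_nonneg normConst_pos.le]

theorem range_transform : Set.range (transform n) = HTensor n := by
  have hc : (normConst n : ℂ) ≠ 0 := by exact_mod_cast normConst_pos.ne'
  ext F
  constructor
  · rintro ⟨f, rfl⟩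
    exact ⟨_, (transform_eq_tensorTransform f).symm⟩
  · rintro ⟨φ, rfl⟩
    refine ⟨(unitary n).symm ((normConst n : ℂ)⁻¹ • φ), ?_⟩
    rw [transform_eq_tensorTransform, LinearIsometryEquiv.apply_symm_apply, smul_smul,
      mul_inv_cancel₀ hc, one_smul]

/-- The extension is the same integral with arbitrary matrices in the exponent. Differentiability of
Gaussian integrals needs only positivity of the real part at the point, not symmetry, so it holds in
all matrix directions. -/
theorem isHolomorphic_tensorTransform (φ : L2 n) : IsHolomorphic (tensorTransform φ) := by
  set c : ℂ := (((2 * Real.pi) ^ (-(n : ℝ) / 2) : ℝ) : ℂ)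
  set κ : ℂ := Complex.I / (Real.sqrt 2 : ℂ)
  refine ⟨fun q => c * ∫ w, φ w * gaussExp
    (fromBlocks (-(Complex.I • q.1.1)) 0 0 (Complex.I • q.2.1))
    (Sum.elim (κ • q.1.2) (-(κ • q.2.2))) w, ?_, fun z => ?_⟩
  · intro q hq
    have h1 := (subGaussian_of_memLp (Lp.memLp φ)).differentiableAt_integral
      (fromBlocks (-(Complex.I • q.1.1)) 0 0 (Complex.I • q.2.1),
        Sum.elim (κ • q.1.2) (-(κ • q.2.2)))
      (rePos_tensorForm ((⟨q.1.1, hq.1⟩, q.1.2), (⟨q.2.1, hq.2⟩, q.2.2)))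
    let A := (((Fin n → Fin n → ℂ) × (Fin n → ℂ)) × ((Fin n → Fin n → ℂ) × (Fin n → ℂ)))
    have h2 : DifferentiableAt ℂ (fun q : A =>
        ((fromBlocks (-(Complex.I • Matrix.of q.1.1)) 0 0 (Complex.I • Matrix.of q.2.1),
          Sum.elim (κ • q.1.2) (-(κ • q.2.2))) :
          (Fin n ⊕ Fin n → Fin n ⊕ Fin n → ℂ) × (Fin n ⊕ Fin n → ℂ))) q := by
      refine DifferentiableAt.prodMk ?_ ?_
      · refine differentiableAt_pi.2 fun i => differentiableAt_pi.2 fun j => ?_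
        rcases i with i | i <;> rcases j with j | j <;>
          simp only [fromBlocks_apply₁₁, fromBlocks_apply₁₂, fromBlocks_apply₂₁,
            fromBlocks_apply₂₂, Matrix.neg_apply, Matrix.smul_apply, Matrix.of_apply,
            Matrix.zero_apply] <;> fun_prop
      · refine differentiableAt_pi.2 fun i => ?_
        rcases i with i | i <;> simp only [Sum.elim_inl, Sum.elim_inr] <;> fun_prop
    have h3 : DifferentiableAt ℂ (fun q : A => c * ∫ w, φ w * gaussExp
        (fromBlocks (-(Complex.I • Matrix.of q.1.1)) 0 0 (Complex.I • Matrix.of q.2.1))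
        (Sum.elim (κ • q.1.2) (-(κ • q.2.2))) w) q :=
      (DifferentiableAt.comp (𝕜 := ℂ) (E := A) q h1 h2).const_mul c
    exact h3.differentiableWithinAt
  · simp only
    rw [← integral_const_mul]
    refine integral_congr_ae (.of_forall fun w => ?_)
    change c * (φ w * _) = φ w * tensorKernel z w
    rw [tensorKernel_eq, mul_left_comm]
    rfl

end Unitary

/-! ### Covariance of the kernel under `ASp(2n, ℝ)` -/

section Intertwining

variable {n : ℕ}

namespace ASp

theorem xpart_smul (g : ASp n) (v : Phase n) :
    xpart (g • v) = g.a *ᵥ xpart v + g.b *ᵥ ypart v + g.r := by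
  ext i
  simp [smul_def, xpart, ypart, a, b, r, mulVec, dotProduct, Fintype.sum_sum_type,
    toBlocks₁₁, toBlocks₁₂]

theorem ypart_smul (g : ASp n) (v : Phase n) :
    ypart (g • v) = g.c *ᵥ xpart v + g.d *ᵥ ypart v + g.s := by
  ext i
  simp [smul_def, xpart, ypart, c, d, s, mulVec, dotProduct, Fintype.sum_sum_type,
    toBlocks₂₁, toBlocks₂₂]

theorem den_map_conj (g : ASp n) (Q : Matrix (Fin n) (Fin n) ℂ) :
    g.den (Q.map (starRingEnd ℂ)) = (g.den Q).map (starRingEnd ℂ) := by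
  have hr : ∀ X : Matrix (Fin n) (Fin n) ℝ,
      (X.map Complex.ofReal).map (starRingEnd ℂ) = X.map Complex.ofReal := by
    intro X; ext i j; simp
  have hc : g.c.map (starRingEnd ℂ) = g.c := hr _
  have hd : g.d.map (starRingEnd ℂ) = g.d := hr _
  rw [den, den, Matrix.map_add _ (map_add (starRingEnd ℂ)), Matrix.map_mul, hc, hd]

theorem det_den_map_conj (g : ASp n) (Q : Matrix (Fin n) (Fin n) ℂ) :
    (g.den (Q.map (starRingEnd ℂ))).det = starRingEnd ℂ (g.den Q).det := by
  rw [den_map_conj]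
  exact ((starRingEnd ℂ).map_det _).symm

theorem isUnit_det_den_lower (g : ASp n) {Q : Matrix (Fin n) (Fin n) ℂ}
    (hQ : Q ∈ siegelLower n) : IsUnit (g.den Q).det := by
  have h := g.isUnit_det_den (map_conj_mem_upper hQ)
  rw [det_den_map_conj, isUnit_iff_ne_zero, map_ne_zero] at h
  exact isUnit_iff_ne_zero.2 h

theorem moebius_mul_den (g : ASp n) {P : Matrix (Fin n) (Fin n) ℂ} (h : IsUnit (g.den P).det) :
    g.moebius P * g.den P = g.a * P + g.b := by
  rw [moebius, nonsing_inv_mul_cancel_right _ _ h]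

theorem block_relations' (g : ASp n) :
    g.aᵀ * g.c = g.cᵀ * g.a ∧ g.bᵀ * g.d = g.dᵀ * g.b ∧ g.cᵀ * g.b = g.aᵀ * g.d - 1 ∧
      g.bᵀ * g.c = g.dᵀ * g.a - 1 := by
  obtain ⟨h1, h2, h3⟩ := g.block_relations
  have h4 := congrArg Matrix.transpose h3
  simp only [transpose_sub, transpose_mul, transpose_transpose, transpose_one] at h4
  exact ⟨h1, h2, by rw [← h3]; abel, by rw [← h4]; abel⟩

/-- Since `Q'` is symmetric, `(cQ+d)ᵗQ' = (aQ+b)ᵗ`; in the expansion the symplectic relations leave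
only `P - Q`. Both the exponent and the determinant factor rest on this identity. -/
theorem den_transpose_mul_sub_mul_den (g : ASp n) {P Q : Matrix (Fin n) (Fin n) ℂ}
    (hQ : Q.IsSymm) (hPu : IsUnit (g.den P).det) (hQu : IsUnit (g.den Q).det)
    (hQ' : (g.moebius Q).IsSymm) :
    (g.den Q)ᵀ * (g.moebius P - g.moebius Q) * g.den P = P - Q := by
  obtain ⟨h1, h2, h3, h4⟩ := g.block_relations'
  have e1 : (g.den Q)ᵀ * g.moebius Q = (g.a * Q + g.b)ᵀ := by
    rw [← g.moebius_mul_den hQu, transpose_mul, hQ'.eq]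
  rw [Matrix.mul_sub, Matrix.sub_mul, e1, Matrix.mul_assoc, g.moebius_mul_den hPu]
  have e2 : (g.den Q)ᵀ * (g.a * P + g.b) - (g.a * Q + g.b)ᵀ * g.den P
      = Q * (g.cᵀ * g.a - g.aᵀ * g.c) * P + Q * (g.cᵀ * g.b - g.aᵀ * g.d)
        + (g.dᵀ * g.a - g.bᵀ * g.c) * P + (g.dᵀ * g.b - g.bᵀ * g.d) := by
    simp only [den, transpose_add, transpose_mul, hQ.eq]
    noncomm_ring
  rw [e2, h1, h2, h3, h4]
  noncomm_ring

/-- The matrix `a - P' c`, the inverse transpose of `c P + d`. -/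
def cofactor (g : ASp n) (P : Matrix (Fin n) (Fin n) ℂ) : Matrix (Fin n) (Fin n) ℂ :=
  g.a - g.moebius P * g.c

theorem den_transpose_mul_cofactor (g : ASp n) {P : Matrix (Fin n) (Fin n) ℂ}
    (hP : P.IsSymm) (hu : IsUnit (g.den P).det) (hP' : (g.moebius P).IsSymm) :
    (g.den P)ᵀ * g.cofactor P = 1 := by
  obtain ⟨h1, h2, h3, h4⟩ := g.block_relations'
  have e1 : (g.den P)ᵀ * g.moebius P = (g.a * P + g.b)ᵀ := by
    rw [← g.moebius_mul_den hu, transpose_mul, hP'.eq]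
  rw [cofactor, Matrix.mul_sub, ← Matrix.mul_assoc, e1]
  have e2 : (g.den P)ᵀ * g.a - (g.a * P + g.b)ᵀ * g.c
      = P * (g.cᵀ * g.a - g.aᵀ * g.c) + (g.dᵀ * g.a - g.bᵀ * g.c) := by
    simp only [den, transpose_add, transpose_mul, hP.eq]
    noncomm_ring
  rw [e2, h1, h4]
  noncomm_ring

theorem cofactor_mul (g : ASp n) {P : Matrix (Fin n) (Fin n) ℂ}
    (hu : IsUnit (g.den P).det) :
    g.cofactor P * P = -(g.b - g.moebius P * g.d) := by
  have h := g.moebius_mul_den hu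
  rw [den, Matrix.mul_add] at h
  rw [cofactor, Matrix.sub_mul, Matrix.mul_assoc]
  rw [← sub_eq_zero] at h ⊢
  rw [← neg_eq_zero, ← h]
  abel

theorem moebiusVec_eq (g : ASp n) (P : Matrix (Fin n) (Fin n) ℂ) (p : Fin n → ℂ) :
    g.moebiusVec P p = g.cofactor P *ᵥ p + g.r - g.moebius P *ᵥ g.s := by
  rw [moebiusVec, cofactor, mulVec_add, sub_mulVec, mulVec_mulVec]
  abel

/-- The action on pairs `(P, π)` is the action on the complex affine subspaces `x = Py + π`; hence
`g` can only multiply their defining equations by a matrix, which is `a - P'c`. -/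
theorem linear_form_smul (g : ASp n) {P : Matrix (Fin n) (Fin n) ℂ}
    (hu : IsUnit (g.den P).det) (p : Fin n → ℂ) (v : Phase n) :
    xpart (g • v) - g.moebius P *ᵥ ypart (g • v) - g.moebiusVec P p
      = g.cofactor P *ᵥ (xpart v - P *ᵥ ypart v - p) := by
  rw [xpart_smul, ypart_smul, moebiusVec_eq, mulVec_sub, mulVec_sub, mulVec_mulVec,
    g.cofactor_mul hu, neg_mulVec, sub_mulVec, mulVec_add, mulVec_add, mulVec_mulVec,
    mulVec_mulVec]
  nth_rewrite 2 [cofactor]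
  rw [sub_mulVec]
  abel

theorem phase_eq (g : ASp n) {P : Matrix (Fin n) (Fin n) ℂ} (hP : P.IsSymm)
    (hu : IsUnit (g.den P).det) (hP' : (g.moebius P).IsSymm) (p : Fin n → ℂ) :
    phase g P p = -(1 / 4) * ((g.cofactor P *ᵥ p) ⬝ᵥ g.c *ᵥ p)
      + 1 / 4 * (g.s ⬝ᵥ g.moebius P *ᵥ g.s) - 1 / 2 * (g.s ⬝ᵥ g.cofactor P *ᵥ p) := by
  have h1 := g.den_transpose_mul_cofactor hP hu hP'
  have h2 : (g.den P)⁻¹ = (g.cofactor P)ᵀ := by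
    refine inv_eq_left_inv ?_
    have := congrArg Matrix.transpose h1
    simpa using this
  have h3 : g.a *ᵥ p - g.moebius P *ᵥ g.c *ᵥ p = g.cofactor P *ᵥ p := by
    rw [cofactor, sub_mulVec, mulVec_mulVec]
  rw [phase, h2, h3, ← mulVec_mulVec, dotProduct_mulVec, vecMul_transpose]

/-- In the form of `kernelExponent_eq`, the bilinear term is invariant, because `cofactor` is
inverse to the transposed `den`. The phases come from the term in `π - ϰ`: its parts in `π` alone
and `ϰ` alone change by the terms with `c`, and the translation part adds the terms with `s`. -/
theorem kernelExponent_smul (g : ASp n) {P Q : Matrix (Fin n) (Fin n) ℂ}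
    (hP : P ∈ siegelUpper n) (hQ : Q ∈ siegelLower n) (p k : Fin n → ℂ) (v : Phase n) :
    kernelExponent P Q p k (xpart v) (ypart v)
      = Complex.I * phase g P p + -Complex.I * phase g Q k
        + kernelExponent (g.moebius P) (g.moebius Q) (g.moebiusVec P p) (g.moebiusVec Q k)
          (xpart (g • v)) (ypart (g • v)) := by
  have hPu := g.isUnit_det_den hP
  have hQu := g.isUnit_det_den_lower hQ
  have hP' := g.moebius_mem_upper hP
  have hQ' := g.moebius_mem_lower hQ
  have hR := isUnit_det_of_mem_upper (sub_mem_upper hP hQ)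
  have hR' := isUnit_det_of_mem_upper (sub_mem_upper hP' hQ')
  have hRs : ((P - Q)⁻¹).IsSymm := symm_inv (hP.1.sub hQ.1)
  have hRs' := (hP'.1.sub hQ'.1)
  have hRsi' := symm_inv hRs'
  have cP := g.den_transpose_mul_cofactor hP.1 hPu hP'.1
  have cQ := g.den_transpose_mul_cofactor hQ.1 hQu hQ'.1
  have hrel := g.den_transpose_mul_sub_mul_den hQ.1 hPu hQu hQ'.1
  set W := g.cofactor P with hW
  set V := g.cofactor Q with hV
  set R' := g.moebius P - g.moebius Q with hR'd
  have hQtu : IsUnit ((g.den Q)ᵀ).det := by rwa [det_transpose]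
  have hinv : R'⁻¹ = g.den P * (P - Q)⁻¹ * (g.den Q)ᵀ := by
    rw [← hrel, Matrix.mul_inv_rev, Matrix.mul_inv_rev, mul_nonsing_inv_cancel_left _ _ hPu,
      Matrix.mul_assoc, nonsing_inv_mul _ hQtu, Matrix.mul_one]
  have hinv2 : R'⁻¹ = g.den Q * (P - Q)⁻¹ * (g.den P)ᵀ := by
    have := congrArg Matrix.transpose hinv
    rw [hRsi'.eq] at this
    rw [this, transpose_mul, transpose_mul, hRs.eq, transpose_transpose, Matrix.mul_assoc]
  have den_dot : ∀ (T : ASp n) (X : Matrix (Fin n) (Fin n) ℂ) (u w : Fin n → ℂ),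
      u ⬝ᵥ T.den X *ᵥ w = ((T.den X)ᵀ *ᵥ u) ⬝ᵥ w := fun T X u w => by
    rw [dotProduct_mulVec, ← mulVec_transpose]
  have cT : ∀ u w : Fin n → ℂ, u ⬝ᵥ g.cᵀ *ᵥ w = (g.c *ᵥ u) ⬝ᵥ w := fun u w => by
    rw [dotProduct_mulVec, vecMul_transpose]
  have mixed : ∀ u w : Fin n → ℂ, (V *ᵥ u) ⬝ᵥ R'⁻¹ *ᵥ (W *ᵥ w) = u ⬝ᵥ (P - Q)⁻¹ *ᵥ w := by
    intro u w
    rw [hinv2, mulVec_mulVec, Matrix.mul_assoc, cP, Matrix.mul_one, ← mulVec_mulVec, den_dot,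
      mulVec_mulVec, cQ, one_mulVec]
  -- In the diagonal terms the contragredient meets the wrong denominator. Exchanging `cQ + d` for
  -- `cP + d` costs `(P-Q)cᵗ`, and this is the source of the quadratic part of the phase.
  have denQ : (g.den Q)ᵀ = (g.den P)ᵀ - (P - Q) * g.cᵀ := by
    simp only [den, transpose_add, transpose_mul, hP.1.eq, hQ.1.eq]
    noncomm_ring
  have diagP : (W *ᵥ p) ⬝ᵥ R'⁻¹ *ᵥ (W *ᵥ p)
      = p ⬝ᵥ (P - Q)⁻¹ *ᵥ p - (W *ᵥ p) ⬝ᵥ g.c *ᵥ p := by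
    have e : (P - Q)⁻¹ * (g.den Q)ᵀ * W = (P - Q)⁻¹ - g.cᵀ * W := by
      rw [denQ, Matrix.mul_sub, Matrix.sub_mul, Matrix.mul_assoc, cP, Matrix.mul_one,
        nonsing_inv_mul_cancel_left _ _ hR]
    rw [hinv, mulVec_mulVec, Matrix.mul_assoc (g.den P), Matrix.mul_assoc (g.den P), e,
      ← mulVec_mulVec, den_dot, mulVec_mulVec, cP, one_mulVec, sub_mulVec, dotProduct_sub,
      ← mulVec_mulVec, cT p, dotProduct_comm (g.c *ᵥ p)]
  have diagQ : (V *ᵥ k) ⬝ᵥ R'⁻¹ *ᵥ (V *ᵥ k)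
      = k ⬝ᵥ (P - Q)⁻¹ *ᵥ k + (V *ᵥ k) ⬝ᵥ g.c *ᵥ k := by
    have denP : (g.den P)ᵀ = (g.den Q)ᵀ + (P - Q) * g.cᵀ := by rw [denQ]; abel
    have e : (P - Q)⁻¹ * (g.den P)ᵀ * V = (P - Q)⁻¹ + g.cᵀ * V := by
      rw [denP, Matrix.mul_add, Matrix.add_mul, Matrix.mul_assoc, cQ, Matrix.mul_one,
        nonsing_inv_mul_cancel_left _ _ hR]
    rw [hinv2, mulVec_mulVec, Matrix.mul_assoc (g.den Q), Matrix.mul_assoc (g.den Q), e,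
      ← mulVec_mulVec, den_dot, mulVec_mulVec, cQ, one_mulVec, add_mulVec, dotProduct_add,
      ← mulVec_mulVec, cT k, dotProduct_comm (g.c *ᵥ k)]
  have hδ : g.moebiusVec P p - g.moebiusVec Q k = W *ᵥ p - V *ᵥ k - R' *ᵥ g.s := by
    rw [moebiusVec_eq, moebiusVec_eq, hR'd, sub_mulVec]
    abel
  have hRR : ∀ u, R'⁻¹ *ᵥ R' *ᵥ u = u := fun u => by
    rw [mulVec_mulVec, nonsing_inv_mul _ hR', one_mulVec]
  have hRd : ∀ u w, (R' *ᵥ u) ⬝ᵥ R'⁻¹ *ᵥ w = u ⬝ᵥ w := fun u w => by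
    rw [hRsi'.dotProduct_mulVec_comm, hRR, dotProduct_comm]
  have hcross : p ⬝ᵥ (P - Q)⁻¹ *ᵥ k = k ⬝ᵥ (P - Q)⁻¹ *ᵥ p := hRs.dotProduct_mulVec_comm _ _
  have hcross' : (W *ᵥ p) ⬝ᵥ R'⁻¹ *ᵥ (V *ᵥ k) = k ⬝ᵥ (P - Q)⁻¹ *ᵥ p := by
    rw [hRsi'.dotProduct_mulVec_comm, mixed]
  have hs1 : (R' *ᵥ g.s) ⬝ᵥ g.s = g.s ⬝ᵥ g.moebius P *ᵥ g.s - g.s ⬝ᵥ g.moebius Q *ᵥ g.s := by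
    rw [dotProduct_comm, hR'd, sub_mulVec, dotProduct_sub]
  rw [kernelExponent_eq hP hQ, kernelExponent_eq hP' hQ', g.linear_form_smul hPu,
    g.linear_form_smul hQu, mixed, hδ, g.phase_eq hP.1 hPu hP'.1, g.phase_eq hQ.1 hQu hQ'.1,
    ← hW, ← hV, ← hR'd]
  simp only [mulVec_sub (R'⁻¹), mulVec_sub ((P - Q)⁻¹) p k, dotProduct_sub, sub_dotProduct, hRR,
    hRd, diagP, diagQ, hcross, hcross', mixed, hs1, dotProduct_comm (W *ᵥ p) g.s,
    dotProduct_comm (V *ᵥ k) g.s]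
  ring

end ASp

/-! ### The determinant factor -/

theorem neg_I_smul_mem {R : Matrix (Fin n) (Fin n) ℂ} (hR : R ∈ siegelUpper n) :
    -(Complex.I • R) ∈ {A : Matrix (Fin n) (Fin n) ℂ | A.IsSymm ∧ RePos A} :=
  ⟨(hR.1.smul _).neg, rePos_neg_I_smul hR⟩

theorem det_neg_I_smul_eq (g : ASp n) {P Q : Matrix (Fin n) (Fin n) ℂ}
    (hP : P ∈ siegelUpper n) (hQ : Q ∈ siegelLower n) :
    (-(Complex.I • (P - Q))).det = (g.den Q).det *
      (-(Complex.I • (g.moebius P - g.moebius Q))).det * (g.den P).det := by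
  have h := g.den_transpose_mul_sub_mul_den hQ.1 (g.isUnit_det_den hP)
    (g.isUnit_det_den_lower hQ) (g.moebius_mem_lower hQ).1
  rw [← det_transpose (g.den Q), ← det_mul, ← det_mul, Matrix.mul_neg, Matrix.neg_mul,
    Matrix.mul_smul, Matrix.smul_mul, h]

theorem ASp.continuous_den (g : ASp n) : Continuous g.den := by
  unfold ASp.den
  fun_prop

theorem ASp.continuousOn_moebius (g : ASp n) :
    ContinuousOn g.moebius {P | IsUnit (g.den P).det} := by
  have h1 : ∀ P, g.moebius P
      = (g.a * P + g.b) * ((g.den P).det⁻¹ • (g.den P).adjugate) := fun P => by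
    rw [ASp.moebius, Matrix.inv_def, Ring.inverse_eq_inv']
  rw [funext h1]
  have hd := g.continuous_den
  refine ContinuousOn.mul (by fun_prop) (ContinuousOn.smul (f := fun P => (g.den P).det⁻¹)
    (g := fun P => (g.den P).adjugate) ?_ ?_)
  · exact ContinuousOn.inv₀ hd.matrix_det.continuousOn fun P hP => IsUnit.ne_zero hP
  · exact hd.matrix_adjugate.continuousOn

/-- With `Q = -i` fixed, `det_neg_I_smul_eq` expresses `det(cP+d)` through determinants of matrices
with positive real part, for which `detInvSqrt` is a continuous square root. -/
theorem exists_isDetBranch (g : ASp n) : ∃ h : siegelUpper n → ℂ, IsDetBranch g h := by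
  set Q : Matrix (Fin n) (Fin n) ℂ := -(Complex.I • 1) with hQd
  have hQ : Q ∈ siegelLower n := neg_I_mem_lower
  have hQu := g.isUnit_det_den_lower hQ
  have hQ' := g.moebius_mem_lower hQ
  obtain ⟨κ, hκ⟩ : ∃ κ : ℂ, κ ^ 2 = (g.den Q).det := ⟨(g.den Q).det ^ (1 / 2 : ℂ), by
    rw [← Complex.cpow_nat_mul]; norm_num⟩
  have hm : Continuous fun P : siegelUpper n => g.moebius P.1 :=
    g.continuousOn_moebius.comp_continuous continuous_subtype_val fun P => g.isUnit_det_den P.2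
  have mem1 : ∀ P : siegelUpper n, _ := fun P => neg_I_smul_mem (sub_mem_upper P.2 hQ)
  have mem2 : ∀ P : siegelUpper n, _ := fun P =>
    neg_I_smul_mem (sub_mem_upper (g.moebius_mem_upper P.2) hQ')
  refine ⟨fun P => κ * detInvSqrt (-(Complex.I • (P.1 - Q)))
    / detInvSqrt (-(Complex.I • (g.moebius P.1 - g.moebius Q))), ?_, fun P => ?_⟩
  · refine Continuous.div (continuous_const.mul ?_) ?_ fun P =>
      detInvSqrt_ne_zero (mem2 P).1 (mem2 P).2
    · exact continuousOn_detInvSqrt.comp_continuous (by fun_prop) mem1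
    · exact continuousOn_detInvSqrt.comp_continuous (by fun_prop) mem2
  · have h1 := det_neg_I_smul_eq g P.2 hQ
    have d1 := det_ne_zero_of_rePos (mem1 P).1 (mem1 P).2
    have d2 := det_ne_zero_of_rePos (mem2 P).1 (mem2 P).2
    have d3 := (g.isUnit_det_den P.2).ne_zero
    have d4 := hQu.ne_zero
    rw [div_pow, mul_pow, hκ, detInvSqrt_sq, detInvSqrt_sq, h1]
    field_simp

theorem convex_siegelLower : Convex ℝ (siegelLower n) := by
  intro P hP Q hQ s t hs ht hst
  refine ⟨(hP.1.smul s).add (hQ.1.smul t), ?_⟩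
  have : -((s • P + t • Q).map Complex.im)
      = s • (-(P.map Complex.im)) + t • (-(Q.map Complex.im)) := by
    ext i j; simp; ring
  rw [this]
  rcases eq_or_lt_of_le hs with h0 | h0
  · rw [← h0, zero_smul, zero_add]
    exact hQ.2.smul (by linarith)
  · exact (hP.2.smul h0).add_posSemidef (hQ.2.posSemidef.smul ht)

instance : PreconnectedSpace (siegelLower n) :=
  Subtype.preconnectedSpace convex_siegelLower.isPreconnected

/-- The matrix is `2 Im P`, which is real and positive definite. -/
theorem detInvSqrt_sub_conj_pos {P : Matrix (Fin n) (Fin n) ℂ} (hP : P ∈ siegelUpper n) :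
    ∃ t : ℝ, 0 < t ∧ detInvSqrt (-(Complex.I • (P - P.map (starRingEnd ℂ)))) = t := by
  have e : -(Complex.I • (P - P.map (starRingEnd ℂ)))
      = cmat (P.map Complex.im + P.map Complex.im) := by
    ext i j
    simp only [Matrix.neg_apply, Matrix.smul_apply, Matrix.sub_apply, Matrix.map_apply,
      smul_eq_mul, Complex.sub_conj, Matrix.add_apply]
    push_cast
    linear_combination (-2 * ((P i j).im : ℂ)) * Complex.I_mul_I
  rw [e]
  exact detInvSqrt_pos (hP.2.add hP.2)

/-- The squares agree by `det_neg_I_smul_eq`, and both sides are continuous and nonzero in `Q` on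
the connected set `Z⁻(n)`. So it suffices to compare signs at one point. -/
theorem detInvSqrt_eq (g : ASp n) {h : siegelUpper n → ℂ} (hh : IsDetBranch g h)
    (P : siegelUpper n) (Q : siegelLower n) :
    detInvSqrt (-(Complex.I • (P.1 - Q.1))) = h P * starRingEnd ℂ (h (conjLower Q)) *
      detInvSqrt (-(Complex.I • (g.moebius P.1 - g.moebius Q.1))) := by
  have hP' := g.moebius_mem_upper P.2
  have mem1 : ∀ Q : siegelLower n, _ := fun Q => neg_I_smul_mem (sub_mem_upper P.2 Q.2)
  have mem2 : ∀ Q : siegelLower n, _ := fun Q =>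
    neg_I_smul_mem (sub_mem_upper hP' (g.moebius_mem_lower Q.2))
  have hm : Continuous fun Q : siegelLower n => g.moebius Q.1 :=
    g.continuousOn_moebius.comp_continuous continuous_subtype_val
      fun Q => g.isUnit_det_den_lower Q.2
  have hconj : Continuous (conjLower : siegelLower n → siegelUpper n) := by
    refine Continuous.subtype_mk ?_ _
    exact Continuous.matrix_map continuous_subtype_val Complex.continuous_conj
  have c1 : Continuous fun Q : siegelLower n => detInvSqrt (-(Complex.I • (P.1 - Q.1))) :=
    continuousOn_detInvSqrt.comp_continuous (by fun_prop) mem1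
  have c2 : Continuous fun Q : siegelLower n => h P * starRingEnd ℂ (h (conjLower Q)) *
      detInvSqrt (-(Complex.I • (g.moebius P.1 - g.moebius Q.1))) :=
    (continuous_const.mul (Complex.continuous_conj.comp (hh.1.comp hconj))).mul
      (continuousOn_detInvSqrt.comp_continuous (by fun_prop) mem2)
  have hsq : ∀ Q : siegelLower n, detInvSqrt (-(Complex.I • (P.1 - Q.1))) ^ 2
      = (h P * starRingEnd ℂ (h (conjLower Q)) *
        detInvSqrt (-(Complex.I • (g.moebius P.1 - g.moebius Q.1)))) ^ 2 := by
    intro Q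
    have d2 := det_ne_zero_of_rePos (mem2 Q).1 (mem2 Q).2
    have d3 := (g.isUnit_det_den P.2).ne_zero
    have d4 := (g.isUnit_det_den_lower Q.2).ne_zero
    have hP2 := hh.2 P
    have hQ2 := congrArg (starRingEnd ℂ) (hh.2 (conjLower Q))
    have e : ((conjLower Q).1).map (starRingEnd ℂ) = Q.1 := by ext i j; simp [conjLower]
    rw [map_mul, map_pow, ← ASp.det_den_map_conj, e, map_one] at hQ2
    rw [mul_pow, mul_pow, detInvSqrt_sq, detInvSqrt_sq, det_neg_I_smul_eq g P.2 Q.2,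
      eq_div_of_mul_eq d3 hP2, eq_div_of_mul_eq d4 hQ2]
    field_simp
  -- At `Q = P̄` the factor `h(P) conj(h(Q̄))` is `|h(P)|²`, and both values of `detInvSqrt` are
  -- positive reals.
  set Q₀ : siegelLower n := ⟨P.1.map (starRingEnd ℂ), map_conj_mem_lower P.2⟩ with hQ₀
  have hbase : detInvSqrt (-(Complex.I • (P.1 - Q₀.1))) = h P * starRingEnd ℂ (h (conjLower Q₀)) *
      detInvSqrt (-(Complex.I • (g.moebius P.1 - g.moebius Q₀.1))) := by
    have hc : conjLower Q₀ = P := by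
      apply Subtype.ext
      ext i j
      simp [conjLower, hQ₀]
    obtain ⟨s, hs, hs'⟩ := detInvSqrt_sub_conj_pos P.2
    obtain ⟨t, ht, ht'⟩ := detInvSqrt_sub_conj_pos hP'
    have h0 := hsq Q₀
    rw [hc, Complex.mul_conj] at h0 ⊢
    simp only [hQ₀, g.moebius_map_conj] at h0 ⊢
    rw [hs', ht'] at h0 ⊢
    rw [← Complex.ofReal_mul, ← Complex.ofReal_pow, ← Complex.ofReal_pow, Complex.ofReal_inj] at h0
    rw [← Complex.ofReal_mul, Complex.ofReal_inj]
    exact (sq_eq_sq₀ hs.le (mul_nonneg (Complex.normSq_nonneg _) ht.le)).1 h0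
  refine isPreconnected_univ.eq_of_sq_eq c1.continuousOn c2.continuousOn (fun Q _ => hsq Q)
    (fun {Q} _ h0 => ?_) (Set.mem_univ Q₀) hbase (Set.mem_univ Q)
  have := hsq Q
  rw [h0, zero_pow two_ne_zero] at this
  exact detInvSqrt_ne_zero (mem1 Q).1 (mem1 Q).2 (pow_eq_zero_iff two_ne_zero |>.1 this)

theorem kernel_smul (g : ASp n) {h : siegelUpper n → ℂ} (hh : IsDetBranch g h)
    (z : AZpos n × AZneg n) (v : Phase n) :
    kernel z v = (h z.1.1 * Complex.exp (Complex.I * phase g z.1.1 z.1.2)) *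
      (starRingEnd ℂ (h (conjLower z.2.1)) * Complex.exp (-Complex.I * phase g z.2.1 z.2.2)) *
      kernel (g.actPos z.1, g.actNeg z.2) (g • v) := by
  obtain ⟨⟨P, p⟩, ⟨Q, k⟩⟩ := z
  have h1 := kernel_eq P.2 Q.2 p k v
  have h2 := kernel_eq (g.moebius_mem_upper P.2) (g.moebius_mem_lower Q.2) (g.moebiusVec P.1 p)
    (g.moebiusVec Q.1 k) (g • v)
  change kernel ((P, p), (Q, k)) v = _ at h1
  change kernel (g.actPos (P, p), g.actNeg (Q, k)) (g • v) = _ at h2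
  rw [h1, h2, g.kernelExponent_smul P.2 Q.2, detInvSqrt_eq g hh, Complex.exp_add, Complex.exp_add]
  ring

theorem coeFn_repL2 (g : ASp n) (f : L2 n) : g.repL2 f =ᵐ[volume] fun v => f (g • v) :=
  Lp.coeFn_compMeasurePreserving f g.measurePreserving_smul

theorem intertwines_transform : Intertwines (transform n) := by
  intro g h hh f
  funext z
  rw [transform_apply, repTensor, transform_apply]
  set C := (h z.1.1 * Complex.exp (Complex.I * phase g z.1.1 z.1.2)) *
      (starRingEnd ℂ (h (conjLower z.2.1)) * Complex.exp (-Complex.I * phase g z.2.1 z.2.2))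
  set z' := (g.actPos z.1, g.actNeg z.2)
  have h1 : ∫ v, g.repL2 f v * kernel z v = ∫ v, C * (f (g • v) * kernel z' (g • v)) := by
    refine integral_congr_ae ?_
    filter_upwards [coeFn_repL2 g f] with v hv
    rw [hv, kernel_smul g hh z v]
    ring
  have mp := g.measurePreserving_smul
  have h2 : ∫ v, f (g • v) * kernel z' (g • v) = ∫ v, f v * kernel z' v := by
    have h3 := integral_map (μ := volume) (φ := fun v : Phase n => g • v)
      (f := fun v => f v * kernel z' v) mp.measurable.aemeasurable (by
        rw [mp.map_eq]; exact (integrable_mul_kernel f z').1)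
    rw [mp.map_eq] at h3
    exact h3.symm
  rw [h1, integral_const_mul, h2]

end Intertwining

/-! ### Operators that commute with all characters -/

section Characters

variable {n : ℕ}

/-- The unitary character `v ↦ exp (i v·a)`. -/
def character (a v : Phase n) : ℂ := Complex.exp (Complex.I * ∑ i, (v i : ℂ) * a i)

theorem character_eq (a v : Phase n) :
    character a v = Complex.exp (((∑ i, v i * a i : ℝ) : ℂ) * Complex.I) := by
  rw [character, mul_comm]
  push_cast
  rfl

theorem norm_character (a v : Phase n) : ‖character a v‖ = 1 := by
  rw [character_eq, Complex.norm_exp_ofReal_mul_I]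

theorem character_neg (a v : Phase n) : character (-a) v = starRingEnd ℂ (character a v) := by
  rw [character_eq, character_eq, ← Complex.exp_conj, map_mul, Complex.conj_I, Complex.conj_ofReal]
  congr 1
  rw [mul_neg, ← neg_mul, ← Complex.ofReal_neg, ← Finset.sum_neg_distrib]
  simp only [Pi.neg_apply, mul_neg]

theorem continuous_character (a : Phase n) : Continuous (character a) := by
  unfold character
  fun_prop

theorem memLp_mul_character (f : L2 n) (a : Phase n) :
    MemLp (fun v => f v * character a v) 2 :=
  (Lp.memLp f).of_le ((Lp.aestronglyMeasurable f).mul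
    (continuous_character a).aestronglyMeasurable) (.of_forall fun v => by
      rw [norm_mul, norm_character, mul_one])

/-- Multiplication by a character. -/
def modulate (a : Phase n) (f : L2 n) : L2 n := (memLp_mul_character f a).toLp _

theorem coeFn_modulate (a : Phase n) (f : L2 n) :
    modulate a f =ᵐ[volume] fun v => f v * character a v :=
  MemLp.coeFn_toLp _

theorem inner_modulate (a : Phase n) (f g : L2 n) :
    inner ℂ f (modulate a g) = inner ℂ (modulate (-a) f) g := by
  rw [L2.inner_def, L2.inner_def]
  refine integral_congr_ae ?_
  filter_upwards [coeFn_modulate a g, coeFn_modulate (-a) f] with v h1 h2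
  rw [h1, h2, RCLike.inner_apply, RCLike.inner_apply, character_neg, map_mul, Complex.conj_conj]
  ring

variable (n) in
/-- The standard Gaussian function as an element of `L²`. -/
def gaussVec : L2 n := (memLp_gaussExp rePos_one 0).toLp stdGauss

theorem coeFn_gaussVec : gaussVec n =ᵐ[volume] stdGauss := MemLp.coeFn_toLp _

theorem stdGauss_eq (v : Phase n) : stdGauss v = (Real.exp (-(1 / 2) * (v ⬝ᵥ v)) : ℂ) := by
  rw [stdGauss, gaussExp, one_mulVec, dotProduct_zero, add_zero]
  push_cast
  simp [dotProduct]

theorem stdGauss_ne_zero (v : Phase n) : stdGauss v ≠ 0 := Complex.exp_ne_zero _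

theorem conj_stdGauss (v : Phase n) : starRingEnd ℂ (stdGauss v) = stdGauss v := by
  rw [stdGauss_eq, Complex.conj_ofReal]

theorem eq_zero_of_inner_modulate_gaussVec {f : L2 n}
    (h : ∀ a, inner ℂ (modulate a (gaussVec n)) f = 0) : f = 0 := by
  rw [Lp.eq_zero_iff_ae_eq_zero]
  refine ae_eq_zero_of_forall_integral_gauss (subGaussian_of_memLp (Lp.memLp f)) fun a => ?_
  rw [← h (-a), L2.inner_def]
  refine integral_congr_ae ?_
  filter_upwards [coeFn_modulate (-a) (gaussVec n), coeFn_gaussVec] with v h1 h2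
  rw [h1, h2, RCLike.inner_apply, map_mul, conj_stdGauss, ← character_neg, neg_neg, gaussExp_one_I,
    character]

/-- An operator that commutes with all characters is a multiplication operator. -/
theorem gauss_mul_eq_of_commute_modulate (A : L2 n →L[ℂ] L2 n)
    (hA : ∀ a f, A (modulate a f) = modulate a (A f)) (f : L2 n) :
    (fun v => stdGauss v * A f v) =ᵐ[volume] fun v => f v * A (gaussVec n) v := by
  have hg : MemLp (stdGauss : Phase n → ℂ) 2 := memLp_gaussExp rePos_one 0
  have i1 : Integrable fun v => stdGauss v * A f v := hg.integrable_mul (Lp.memLp _)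
  have i2 : Integrable fun v => f v * A (gaussVec n) v := (Lp.memLp _).integrable_mul (Lp.memLp _)
  suffices hz : (fun v => stdGauss v * A f v - f v * A (gaussVec n) v) =ᵐ[volume] 0 by
    filter_upwards [hz] with v hv
    exact sub_eq_zero.1 hv
  -- Both products are integrable, so it is enough to compare their Fourier transforms. At each
  -- frequency these are bounded linear functionals of `f`.
  refine ae_eq_zero_of_forall_integral_exp (i1.sub i2) fun a => ?_
  set w : L2 n := (memLp_mul_character (A (gaussVec n)) a).star.toLp _ with hw
  have pair : ∀ f : L2 n, inner ℂ w f = ∫ v, f v * A (gaussVec n) v * character a v := by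
    intro f
    rw [L2.inner_def]
    refine integral_congr_ae ?_
    filter_upwards [(memLp_mul_character (A (gaussVec n)) a).star.coeFn_toLp] with v hv
    rw [hw, hv, RCLike.inner_apply]
    simp
    ring
  have pair' : ∀ f : L2 n, inner ℂ (modulate (-a) (gaussVec n)) (A f)
      = ∫ v, stdGauss v * A f v * character a v := by
    intro f
    rw [← inner_modulate, L2.inner_def]
    refine integral_congr_ae ?_
    filter_upwards [coeFn_modulate a (A f), coeFn_gaussVec] with v h1 h2
    rw [h1, h2, RCLike.inner_apply, conj_stdGauss]
    ring
  -- The vectors that represent the two functionals coincide: on modulated Gaussians the functionals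
  -- agree by the commutation hypothesis, and these functions are total.
  have hu : ContinuousLinearMap.adjoint A (modulate (-a) (gaussVec n)) - w = 0 := by
    refine eq_zero_of_inner_modulate_gaussVec fun b => ?_
    rw [inner_eq_zero_symm, inner_sub_left, ContinuousLinearMap.adjoint_inner_left, pair, pair',
      sub_eq_zero]
    refine integral_congr_ae ?_
    rw [hA]
    filter_upwards [coeFn_modulate b (A (gaussVec n)), coeFn_modulate b (gaussVec n),
      coeFn_gaussVec] with v h1 h2 h3
    rw [h1, h2, h3]
    ring
  have h0 : inner ℂ (ContinuousLinearMap.adjoint A (modulate (-a) (gaussVec n)) - w) f = 0 := by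
    rw [hu, inner_zero_left]
  rw [inner_sub_left, ContinuousLinearMap.adjoint_inner_left, pair, pair', sub_eq_zero] at h0
  have bdd : ∀ {F : Phase n → ℂ}, Integrable F → Integrable fun v => F v * character a v :=
    fun hF => hF.mul_bdd (c := 1) (continuous_character a).aestronglyMeasurable
      (.of_forall fun v => (norm_character a v).le)
  calc ∫ v, (stdGauss v * A f v - f v * A (gaussVec n) v) * character a v
      = ∫ v, (stdGauss v * A f v * character a v - f v * A (gaussVec n) v * character a v) := by
        simp only [sub_mul]
    _ = 0 := by rw [integral_sub (bdd i1) (bdd i2), h0, sub_self]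

end Characters

/-! ### Functions invariant under shears in both directions -/

section Shears

variable {n : ℕ}

theorem ae_phase_iff {p : Phase n → Prop} :
    (∀ᵐ v, p v) ↔ ∀ᵐ z : (Fin n → ℝ) × (Fin n → ℝ), p (Sum.elim z.1 z.2) := by
  have mp := (volume_measurePreserving_sumPiEquivProdPi fun _ : Fin n ⊕ Fin n => ℝ).symm
  rw [← mp.map_eq, (MeasurableEquiv.measurableEmbedding _).ae_map_iff]
  rfl

theorem quasiMeasurePreserving_sub_div (y : Fin n → ℝ) {x : Fin n → ℝ} (hx : ∀ i, x i ≠ 0) :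
    Measure.QuasiMeasurePreserving (fun y' : Fin n → ℝ => (y' - y) / x) := by
  have h1 : Measure.QuasiMeasurePreserving (toLin' (diagonal x⁻¹)) := by
    refine Measure.LinearMap.quasiMeasurePreserving _ _ ?_
    rw [LinearMap.det_toLin', det_diagonal]
    exact Finset.prod_ne_zero_iff.2 fun i _ => inv_ne_zero (hx i)
  have h2 := h1.comp (measurePreserving_sub_right volume y).quasiMeasurePreserving
  convert h2 using 1
  funext y'
  ext i
  simp [mulVec_diagonal, div_eq_inv_mul]

theorem ae_forall_ne_zero : ∀ᵐ x : Fin n → ℝ, ∀ i, x i ≠ 0 := by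
  rw [ae_all_iff]
  intro i
  exact (Measure.quasiMeasurePreserving_eval (fun _ : Fin n => (volume : Measure ℝ)) i).ae
    (Measure.ae_ne volume 0)

/-- A function invariant under the shears `y ↦ y + t x`, for all `t`, does not depend on `y`. -/
theorem ae_eq_of_shear {m : (Fin n → ℝ) × (Fin n → ℝ) → ℂ} (hm : Measurable m)
    (h : ∀ t, ∀ᵐ z, m (z.1, z.2 + t * z.1) = m z) :
    ∀ᵐ z, ∀ᵐ y, m (z.1, y) = m z := by
  have hms : MeasurableSet {q : (Fin n → ℝ) × ((Fin n → ℝ) × (Fin n → ℝ)) |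
      m (q.2.1, q.2.2 + q.1 * q.2.1) = m q.2} :=
    measurableSet_eq_fun (hm.comp (by fun_prop)) (hm.comp (by fun_prop))
  have hx : ∀ᵐ z : (Fin n → ℝ) × (Fin n → ℝ), ∀ i, z.1 i ≠ 0 :=
    (Measure.quasiMeasurePreserving_fst (μ := (volume : Measure (Fin n → ℝ)))
      (ν := (volume : Measure (Fin n → ℝ)))).ae ae_forall_ne_zero
  -- Fubini moves the exceptional set from each `t` separately to almost every `t` at a fixed point.
  -- When no coordinate of `x` vanishes, `t ↦ y + tx` is an affine bijection and carries null sets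
  -- to null sets.
  have ht : ∀ᵐ z : (Fin n → ℝ) × (Fin n → ℝ), ∀ᵐ t : Fin n → ℝ, m (z.1, z.2 + t * z.1) = m z :=
    (Measure.ae_ae_comm hms).1 (.of_forall h)
  filter_upwards [ht, hx] with z h1 h2
  filter_upwards [(quasiMeasurePreserving_sub_div z.2 h2).ae h1] with y hy
  have e : z.2 + (y - z.2) / z.1 * z.1 = y := by
    ext i
    simp [h2 i]
  rwa [e] at hy

/-- For almost every `x` the function is almost constant on the slice over `x`, and almost every
horizontal line carries almost everywhere the value it has on that slice. One `x` good for both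
conditions provides the constant. -/
theorem exists_ae_eq_const_of_shear {m : (Fin n → ℝ) × (Fin n → ℝ) → ℂ} (hm : Measurable m)
    (h1 : ∀ t, ∀ᵐ z, m (z.1, z.2 + t * z.1) = m z)
    (h2 : ∀ t, ∀ᵐ z, m (z.1 + t * z.2, z.2) = m z) :
    ∃ c, ∀ᵐ z, m z = c := by
  have hs : Measure.QuasiMeasurePreserving
      (Prod.swap : (Fin n → ℝ) × (Fin n → ℝ) → (Fin n → ℝ) × (Fin n → ℝ)) :=
    (Measure.measurePreserving_swap (μ := (volume : Measure (Fin n → ℝ)))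
      (ν := (volume : Measure (Fin n → ℝ)))).quasiMeasurePreserving
  have k1 := Measure.ae_ae_of_ae_prod (ae_eq_of_shear hm h1)
  have k2 := ae_eq_of_shear (m := m ∘ Prod.swap) (hm.comp measurable_swap) fun t => hs.ae (h2 t)
  have k3 := Measure.ae_ae_of_ae_prod (hs.ae k2)
  obtain ⟨x, hx1, hx2⟩ := (k1.and k3).exists
  obtain ⟨y, hy⟩ := hx1.exists
  refine ⟨m (x, y), ?_⟩
  refine hs.ae (p := fun z => m z.swap = m (x, y)) ?_
  refine (Measure.ae_prod_iff_ae_ae ?_).2 ?_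
  · exact measurableSet_eq_fun (hm.comp measurable_swap) measurable_const
  · filter_upwards [hy, hx2] with b hb1 hb2
    filter_upwards [hb2] with a ha
    exact ha.trans hb1

end Shears

/-! ### Schur's lemma and the symplectic Fourier transform -/

section Schur

variable {n : ℕ}

variable (n) in
/-- The shear `(x, y) ↦ (x, y + t x)`, with `t` acting diagonally. -/
def lowerShear (t : Fin n → ℝ) : ASp n where
  lin := ⟨fromBlocks 1 0 (diagonal t) 1, by
    rw [SymplecticGroup.fromBlocks_mem_iff]; simp⟩
  trans := 0

variable (n) in
/-- The shear `(x, y) ↦ (x + t y, y)`, with `t` acting diagonally. -/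
def upperShear (t : Fin n → ℝ) : ASp n where
  lin := ⟨fromBlocks 1 (diagonal t) 0 1, by
    rw [SymplecticGroup.fromBlocks_mem_iff]; simp⟩
  trans := 0

theorem lowerShear_smul (t x y : Fin n → ℝ) :
    lowerShear n t • (Sum.elim x y : Phase n) = Sum.elim x (y + t * x) := by
  rw [ASp.smul_def, lowerShear, fromBlocks_mulVec]
  ext (i | i) <;> simp [mulVec_diagonal, add_comm]

theorem upperShear_smul (t x y : Fin n → ℝ) :
    upperShear n t • (Sum.elim x y : Phase n) = Sum.elim (x + t * y) y := by
  rw [ASp.smul_def, upperShear, fromBlocks_mulVec]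
  ext (i | i) <;> simp [mulVec_diagonal]

/-- An operator that commutes with all characters and with all linear symplectic changes of
variables is a scalar. -/
theorem exists_eq_smul_of_commute (A : L2 n →L[ℂ] L2 n)
    (hA : ∀ a f, A (modulate a f) = modulate a (A f))
    (hT : ∀ g : ASp n, g.trans = 0 → ∀ f, A (g.repL2 f) = g.repL2 (A f)) :
    ∃ α : ℂ, ∀ f, A f = α • f := by
  set ψ := A (gaussVec n) with hψ
  have hcont : Continuous (stdGauss : Phase n → ℂ) := continuous_gaussExp _ _
  set m : (Fin n → ℝ) × (Fin n → ℝ) → ℂ :=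
    fun z => ψ (Sum.elim z.1 z.2) / stdGauss (Sum.elim z.1 z.2) with hm
  have hmeas : Measurable m := by
    have h1 : Measurable fun z : (Fin n → ℝ) × (Fin n → ℝ) => (Sum.elim z.1 z.2 : Phase n) :=
      (MeasurableEquiv.sumPiEquivProdPi fun _ : Fin n ⊕ Fin n => ℝ).symm.measurable
    exact ((Lp.stronglyMeasurable ψ).measurable.comp h1).div (hcont.measurable.comp h1)
  have inv : ∀ g : ASp n, g.trans = 0 →
      ∀ᵐ v : Phase n, ψ (g • v) / stdGauss (g • v) = ψ v / stdGauss v := by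
    intro g hg
    -- Applied to the transformed Gaussian, the multiplication formula reads `γ(v) ψ(gv) = γ(gv)
    -- ψ(v)` with `γ` the Gaussian, so the multiplier `ψ/γ` is invariant under `g`.
    have h1 := gauss_mul_eq_of_commute_modulate A hA (g.repL2 (gaussVec n))
    rw [hT g hg] at h1
    filter_upwards [h1, coeFn_repL2 g (gaussVec n), coeFn_repL2 g ψ,
      g.measurePreserving_smul.quasiMeasurePreserving.ae coeFn_gaussVec] with v h1 h2 h3 h4
    rw [h3, h2, h4] at h1
    rw [div_eq_div_iff (stdGauss_ne_zero _) (stdGauss_ne_zero _), mul_comm, h1, mul_comm]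
  obtain ⟨α, hα⟩ := exists_ae_eq_const_of_shear hmeas
    (fun t => by
      filter_upwards [ae_phase_iff.1 (inv (lowerShear n t) rfl)] with z hz
      rwa [lowerShear_smul] at hz)
    (fun t => by
      filter_upwards [ae_phase_iff.1 (inv (upperShear n t) rfl)] with z hz
      rwa [upperShear_smul] at hz)
  have hα' : ∀ᵐ v : Phase n, ψ v / stdGauss v = α := ae_phase_iff.2 hα
  refine ⟨α, fun f => ?_⟩
  apply Lp.ext
  filter_upwards [gauss_mul_eq_of_commute_modulate A hA f, hα', Lp.coeFn_smul α f] with v h1 h2 h3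
  rw [h3, Pi.smul_apply, smul_eq_mul]
  refine mul_left_cancel₀ (stdGauss_ne_zero v) ?_
  rw [h1, ← hψ, ← h2]
  field_simp [stdGauss_ne_zero v]

/-! ### The symplectic Fourier transform -/

/-- The reflection `(u, v) ↦ (u, -v)`. -/
def reflectSecond (w : Phase n) : Phase n := Sum.elim (w ∘ Sum.inl) (-(w ∘ Sum.inr))

theorem measurePreserving_reflectSecond : MeasurePreserving (reflectSecond (n := n)) volume volume := by
  have h := volume_preserving_pi (ι := Fin n ⊕ Fin n) (α' := fun _ => ℝ) (β' := fun _ => ℝ)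
    (f := fun i t => Sum.elim (fun _ => t) (fun _ => -t) i) (by
      rintro (i | i)
      · exact MeasurePreserving.id _
      · exact Measure.measurePreserving_neg _)
  have e : reflectSecond (n := n)
      = fun w i => Sum.elim (fun _ : Fin n => w i) (fun _ : Fin n => -w i) i := by
    funext w i
    rcases i with i | i <;> rfl
  rw [e]
  exact h

variable (n) in
/-- The substitution `(u, v) ↦ (u, -v)` in `L²`. -/
def reflection : L2 n →ₗᵢ[ℂ] L2 n :=
  Lp.compMeasurePreservingₗᵢ ℂ reflectSecond measurePreserving_reflectSecond

theorem coeFn_reflection (f : L2 n) : reflection n f =ᵐ[volume] fun v => f (reflectSecond v) :=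
  Lp.coeFn_compMeasurePreserving f measurePreserving_reflectSecond

theorem reflection_reflection (f : L2 n) : reflection n (reflection n f) = f := by
  apply Lp.ext
  filter_upwards [coeFn_reflection (reflection n f),
    measurePreserving_reflectSecond.quasiMeasurePreserving.ae (coeFn_reflection f)] with v h1 h2
  rw [h1, h2]
  congr 1
  ext (i | i) <;> simp [reflectSecond]

/-- The map `(P, π; Q, ϰ) ↦ (P, π; Q, -ϰ)`. -/
def flip (z : AZpos n × AZneg n) : AZpos n × AZneg n := (z.1, (z.2.1, -z.2.2))

theorem flip_flip (z : AZpos n × AZneg n) : flip (flip z) = z := by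
  simp [flip]

theorem kerNeg_neg (z : AZneg n) (v : Fin n → ℝ) : kerNeg z (-v) = kerNeg (z.1, -z.2) v := by
  simp only [kerNeg]
  have : (fun i => (((-v) i : ℝ) : ℂ)) = -fun i => (v i : ℂ) := by ext i; simp
  rw [this, mulVec_neg, neg_dotProduct, dotProduct_neg, neg_neg, neg_dotProduct, dotProduct_neg]

/-- The quadratic part of the exponent of `kerNeg` is even in `v`, so `v ↦ -v` amounts to changing
the sign of `ϰ`. -/
theorem tensorTransform_reflection (φ : L2 n) (z : AZpos n × AZneg n) :
    tensorTransform (reflection n φ) z = tensorTransform φ (flip z) := by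
  have mp := measurePreserving_reflectSecond (n := n)
  have h1 : tensorTransform (reflection n φ) z
      = ∫ w, (fun w => φ w * tensorKernel (flip z) w) (reflectSecond w) := by
    refine integral_congr_ae ?_
    filter_upwards [coeFn_reflection φ] with w hw
    rw [hw]
    change _ = φ (reflectSecond w) * (kerPos z.1 (w ∘ Sum.inl)
      * kerNeg (z.2.1, -z.2.2) (-(w ∘ Sum.inr)))
    rw [kerNeg_neg, neg_neg]
  have h3 := integral_map (μ := volume) (φ := reflectSecond (n := n))
    (f := fun w => φ w * tensorKernel (flip z) w) mp.measurable.aemeasurable (by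
      rw [mp.map_eq]
      exact ((Lp.memLp φ).integrable_mul (memLp_tensorKernel (flip z))).1)
  rw [mp.map_eq] at h3
  rw [h1, ← h3]
  rfl

variable (n) in
/-- The involution of `L²` that corresponds to `(u, v) ↦ (u, -v)` in the tensor product; it is
the symplectic Fourier transform. -/
def symplecticFourier : L2 n →L[ℂ] L2 n :=
  (unitary n).symm.toContinuousLinearEquiv.toContinuousLinearMap.comp
    ((reflection n).toContinuousLinearMap.comp
      (unitary n).toContinuousLinearEquiv.toContinuousLinearMap)

theorem symplecticFourier_apply (f : L2 n) :
    symplecticFourier n f = (unitary n).symm (reflection n (unitary n f)) := rfl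

theorem symplecticFourier_symplecticFourier (f : L2 n) :
    symplecticFourier n (symplecticFourier n f) = f := by
  rw [symplecticFourier_apply, symplecticFourier_apply, LinearIsometryEquiv.apply_symm_apply,
    reflection_reflection, LinearIsometryEquiv.symm_apply_apply]

theorem transform_symplecticFourier (f : L2 n) (z : AZpos n × AZneg n) :
    transform n (symplecticFourier n f) z = transform n f (flip z) := by
  rw [transform_eq_tensorTransform, symplecticFourier_apply, LinearIsometryEquiv.apply_symm_apply,
    ← map_smul, tensorTransform_reflection, transform_eq_tensorTransform]

/-- Without translation part, `ϰ ↦ ϰ'` is linear and the phase is even in `ϰ`, so the action and the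
cocycle are compatible with `flip`. -/
theorem symplecticFourier_repL2 {g : ASp n} (hg : g.trans = 0) (f : L2 n) :
    symplecticFourier n (g.repL2 f) = g.repL2 (symplecticFourier n f) := by
  obtain ⟨h, hh⟩ := exists_isDetBranch g
  have hr : g.r = 0 := by ext i; simp [ASp.r, hg]
  have hs : g.s = 0 := by ext i; simp [ASp.s, hg]
  apply transform_injective
  funext z
  have e1 : phase g z.2.1 (-z.2.2) = phase g z.2.1 z.2.2 := by
    simp [phase, hs, mulVec_neg]
  have e2 : (g.actPos z.1, g.actNeg (z.2.1, -z.2.2)) = flip (g.actPos z.1, g.actNeg z.2) := by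
    rw [flip, ASp.actNeg, ASp.actNeg]
    simp only [ASp.moebiusVec, hr, hs, mulVec_neg, add_zero]
    congr 2
    abel
  rw [transform_symplecticFourier, intertwines_transform g h hh, intertwines_transform g h hh,
    repTensor, repTensor, transform_symplecticFourier]
  simp only [flip] at e2 ⊢
  rw [e1, e2]

/-- The translation of `ℝ²ⁿ` that corresponds to the character with frequency `a`. -/
def translation (a : Phase n) : ASp n where
  lin := 1
  trans := Sum.elim (a ∘ Sum.inr) (-(a ∘ Sum.inl))

theorem translation_blocks (a : Phase n) : (translation a).a = 1 ∧ (translation a).b = 0 ∧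
    (translation a).c = 0 ∧ (translation a).d = 1 := by
  have e : (translation a).lin.1 = fromBlocks 1 0 0 1 := fromBlocks_one.symm
  simp only [ASp.a, ASp.b, ASp.c, ASp.d, e, toBlocks_fromBlocks₁₁, toBlocks_fromBlocks₁₂,
    toBlocks_fromBlocks₂₁, toBlocks_fromBlocks₂₂]
  simp [Matrix.map_one, Matrix.map_zero]

theorem den_translation (a : Phase n) (P : Matrix (Fin n) (Fin n) ℂ) :
    (translation a).den P = 1 := by
  obtain ⟨h1, h2, h3, h4⟩ := translation_blocks a
  rw [ASp.den, h3, h4, Matrix.zero_mul, zero_add]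

theorem moebius_translation (a : Phase n) (P : Matrix (Fin n) (Fin n) ℂ) :
    (translation a).moebius P = P := by
  obtain ⟨h1, h2, h3, h4⟩ := translation_blocks a
  rw [ASp.moebius, den_translation, h1, h2, inv_one, Matrix.one_mul, add_zero, Matrix.mul_one]

theorem moebiusVec_translation (a : Phase n) (P : Matrix (Fin n) (Fin n) ℂ) (p : Fin n → ℂ) :
    (translation a).moebiusVec P p = p + ypart a + P *ᵥ xpart a := by
  obtain ⟨h1, h2, h3, h4⟩ := translation_blocks a
  have hr : (translation a).r = ypart a := by ext i; simp [ASp.r, translation, ypart]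
  have hs : (translation a).s = -xpart a := by ext i; simp [ASp.s, translation, xpart]
  rw [ASp.moebiusVec, moebius_translation, h1, h3, hr, hs, one_mulVec, zero_mulVec, zero_add,
    mulVec_neg, sub_neg_eq_add]

theorem phase_translation (a : Phase n) (P : Matrix (Fin n) (Fin n) ℂ) (p : Fin n → ℂ) :
    phase (translation a) P p
      = 1 / 4 * (xpart a ⬝ᵥ P *ᵥ xpart a) + 1 / 2 * (xpart a ⬝ᵥ p) := by
  obtain ⟨h1, h2, h3, h4⟩ := translation_blocks a
  have hs : (translation a).s = -xpart a := by ext i; simp [ASp.s, translation, xpart]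
  rw [phase, moebius_translation, h1, h3, hs]
  simp [mulVec_neg]

theorem isDetBranch_translation (a : Phase n) : IsDetBranch (translation a) fun _ => 1 :=
  ⟨continuous_const, fun P => by rw [den_translation]; simp⟩

/-- A translation moves `π` by `r + Ps` and `ϰ` by `r + Qs`. When the second shift is taken with the
opposite sign, the kernel acquires, besides the phases, a factor that is a character of `(x, y)`
instead of being translated. -/
theorem kernelExponent_translation {P Q : Matrix (Fin n) (Fin n) ℂ} (hP : P ∈ siegelUpper n)
    (hQ : Q ∈ siegelLower n) (p k s r x y : Fin n → ℂ) :
    kernelExponent P Q p k x y + Complex.I * (x ⬝ᵥ s + y ⬝ᵥ r)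
      = Complex.I * (1 / 4 * (s ⬝ᵥ P *ᵥ s) + 1 / 2 * (s ⬝ᵥ p))
        + -Complex.I * (1 / 4 * (s ⬝ᵥ Q *ᵥ s) + 1 / 2 * (s ⬝ᵥ -k))
        + kernelExponent P Q (p + r + P *ᵥ s) (-(-k + r + Q *ᵥ s)) x y := by
  have hR := isUnit_det_of_mem_upper (sub_mem_upper hP hQ)
  have hRs : ((P - Q)⁻¹).IsSymm := symm_inv (hP.1.sub hQ.1)
  rw [kernelExponent_eq hP hQ, kernelExponent_eq hP hQ]
  -- All forms are expressed through `lQ`, `δ`, `β` and multiples of `P - Q`, on which `(P-Q)⁻¹`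
  -- cancels.
  set β := r + Q *ᵥ s with hβ
  set lQ := x - Q *ᵥ y - k with hlQ
  set δ := p - k with hδ
  have hRR : ∀ u, (P - Q)⁻¹ *ᵥ (P - Q) *ᵥ u = u := fun u => by
    rw [mulVec_mulVec, nonsing_inv_mul _ hR, one_mulVec]
  have hRd : ∀ u w, ((P - Q) *ᵥ u) ⬝ᵥ (P - Q)⁻¹ *ᵥ w = u ⬝ᵥ w := fun u w => by
    rw [hRs.dotProduct_mulVec_comm, hRR, dotProduct_comm]
  have hP0 : x - P *ᵥ y - p = lQ - (P - Q) *ᵥ y - δ := by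
    rw [hlQ, hδ, sub_mulVec]; abel
  have hP1 : x - P *ᵥ y - (p + r + P *ᵥ s) = lQ - (P - Q) *ᵥ y - δ - β - (P - Q) *ᵥ s := by
    rw [hlQ, hδ, hβ, sub_mulVec, sub_mulVec]; abel
  have hQ1 : x - Q *ᵥ y - -(-k + r + Q *ᵥ s) = lQ + β := by
    rw [hlQ, hβ]; abel
  have hd1 : p + r + P *ᵥ s - -(-k + r + Q *ᵥ s) = δ + (2 : ℂ) • β + (P - Q) *ᵥ s := by
    rw [hδ, hβ, sub_mulVec, two_smul]; abel
  rw [hP0, hP1, hQ1, hd1]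
  have c1 : β ⬝ᵥ (P - Q)⁻¹ *ᵥ lQ = lQ ⬝ᵥ (P - Q)⁻¹ *ᵥ β := hRs.dotProduct_mulVec_comm _ _
  have c2 : β ⬝ᵥ (P - Q)⁻¹ *ᵥ δ = δ ⬝ᵥ (P - Q)⁻¹ *ᵥ β := hRs.dotProduct_mulVec_comm _ _
  simp only [mulVec_add ((P - Q)⁻¹), mulVec_sub ((P - Q)⁻¹) _ _, mulVec_smul, dotProduct_sub,
    dotProduct_add, add_dotProduct, smul_dotProduct, dotProduct_smul, hRR, hRd,
    smul_eq_mul, c1, c2]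
  rw [sub_mulVec P Q s]
  have e1 : lQ ⬝ᵥ s = x ⬝ᵥ s - y ⬝ᵥ Q *ᵥ s - k ⬝ᵥ s := by
    rw [hlQ, sub_dotProduct, sub_dotProduct, dotProduct_comm (Q *ᵥ y),
      hQ.1.dotProduct_mulVec_comm s y]
  have e2 : β ⬝ᵥ y = y ⬝ᵥ r + y ⬝ᵥ Q *ᵥ s := by
    rw [dotProduct_comm, hβ, dotProduct_add]
  have e3 : δ ⬝ᵥ s = s ⬝ᵥ p - s ⬝ᵥ k := by rw [dotProduct_comm, hδ, dotProduct_sub]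
  have e4 : (P *ᵥ s - Q *ᵥ s) ⬝ᵥ s = s ⬝ᵥ P *ᵥ s - s ⬝ᵥ Q *ᵥ s := by
    rw [dotProduct_comm, dotProduct_sub]
  rw [e1, e2, e3, e4]
  simp only [dotProduct_comm _ β, dotProduct_comm k s, dotProduct_neg, dotProduct_comm s δ, e3]
  ring

theorem sum_mul_eq_dotProduct (a v : Phase n) :
    ∑ i, (v i : ℂ) * a i = xpart v ⬝ᵥ xpart a + ypart v ⬝ᵥ ypart a :=
  Fintype.sum_sum_type _

theorem kernel_mul_character (a v : Phase n) (z : AZpos n × AZneg n) :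
    kernel z v * character a v
      = Complex.exp (Complex.I * phase (translation a) z.1.1 z.1.2) *
        Complex.exp (-Complex.I * phase (translation a) z.2.1 (-z.2.2)) *
        kernel (flip ((translation a).actPos z.1, (translation a).actNeg (flip z).2)) v := by
  obtain ⟨⟨P, p⟩, ⟨Q, k⟩⟩ := z
  have e : flip ((translation a).actPos (P, p), (translation a).actNeg (flip ((P, p), (Q, k))).2)
      = ((P, p + ypart a + P.1 *ᵥ xpart a), (Q, -(-k + ypart a + Q.1 *ᵥ xpart a))) := by
    simp only [flip, ASp.actPos, ASp.actNeg, moebius_translation, moebiusVec_translation]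
  rw [e, kernel_eq P.2 Q.2, kernel_eq P.2 Q.2, phase_translation, phase_translation, character,
    sum_mul_eq_dotProduct, mul_assoc, ← Complex.exp_add, kernelExponent_translation P.2 Q.2,
    Complex.exp_add, Complex.exp_add]
  ring

/-- After `transform` both sides are integrals against the kernel: the left one is the action of the
translation conjugated by `flip`, which `kernel_mul_character` identifies with multiplying the
kernel by the character. -/
theorem symplecticFourier_repL2_translation (a : Phase n) (f : L2 n) :
    symplecticFourier n ((translation a).repL2 f) = modulate a (symplecticFourier n f) := by
  apply transform_injective
  funext z
  rw [transform_symplecticFourier, intertwines_transform _ _ (isDetBranch_translation a),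
    repTensor, ← flip_flip ((translation a).actPos (flip z).1, (translation a).actNeg (flip z).2),
    ← transform_symplecticFourier, transform_apply, transform_apply, ← integral_const_mul]
  refine integral_congr_ae ?_
  filter_upwards [coeFn_modulate a (symplecticFourier n f)] with v hv
  have hk := kernel_mul_character a v z
  simp only [flip, map_one] at hk ⊢
  rw [hv, mul_assoc (symplecticFourier n f v), mul_comm (character a v), hk]
  ring

/-- The range of `transform` is all of `HTensor n`, so `L` factors through it. The commutation is
read off after applying the injective `transform`, and boundedness holds as `transform` scales norms
by `normConst n`. -/
theorem exists_commuting_operator {L : L2 n →ₗ[ℂ] (AZpos n × AZneg n → ℂ)}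
    (hL : ∀ f, L f ∈ HTensor n) {C : ℝ} (hC : ∀ f, hNorm (L f) ≤ C * ‖f‖) (hT : Intertwines L) :
    ∃ B : L2 n →L[ℂ] L2 n, (∀ f, transform n (B f) = L f) ∧
      ∀ (g : ASp n) f, B (g.repL2 f) = g.repL2 (B f) := by
  have hr : ∀ f, L f ∈ LinearMap.range (transform n) := fun f => by
    have h := hL f
    rwa [← range_transform, ← LinearMap.coe_range] at h
  set B : L2 n →ₗ[ℂ] L2 n :=
    (LinearEquiv.ofInjective (transform n) transform_injective).symm.toLinearMap.comp
      (L.codRestrict _ hr) with hB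
  have hBL : ∀ f, transform n (B f) = L f := fun f =>
    congrArg Subtype.val ((LinearEquiv.ofInjective (transform n)
      transform_injective).apply_symm_apply (L.codRestrict _ hr f))
  refine ⟨B.mkContinuous (C / normConst n) fun f => ?_, hBL, fun g f => ?_⟩
  · have h := hC f
    rw [← hBL, hNorm_transform] at h
    rw [div_mul_eq_mul_div, le_div_iff₀ normConst_pos]
    linarith
  · obtain ⟨h, hh⟩ := exists_isDetBranch g
    apply transform_injective
    rw [intertwines_transform g h hh]
    change transform n (B _) = repTensor g h (transform n (B f))
    rw [hBL, hBL, hT g h hh]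

/-- Conjugated by the symplectic Fourier transform, the operator of `exists_commuting_operator`
commutes with characters, which come from translations, and still with linear symplectic maps. Hence
it is a scalar. -/
theorem exists_eq_smul_transform {L : L2 n →ₗ[ℂ] (AZpos n × AZneg n → ℂ)}
    (hL : ∀ f, L f ∈ HTensor n) {C : ℝ} (hC : ∀ f, hNorm (L f) ≤ C * ‖f‖) (hT : Intertwines L) :
    ∃ α : ℂ, L = α • transform n := by
  obtain ⟨B, hBL, hBT⟩ := exists_commuting_operator hL hC hT
  have hF := symplecticFourier_symplecticFourier (n := n)
  have hmod : ∀ a (f : L2 n), modulate a f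
      = symplecticFourier n ((translation a).repL2 (symplecticFourier n f)) := fun a f => by
    rw [symplecticFourier_repL2_translation, hF]
  obtain ⟨α, hα⟩ := exists_eq_smul_of_commute
    ((symplecticFourier n).comp (B.comp (symplecticFourier n)))
    (fun a f => by
      simp only [ContinuousLinearMap.comp_apply, hmod, hF, hBT])
    (fun g hg f => by
      simp only [ContinuousLinearMap.comp_apply, symplecticFourier_repL2 hg, hBT])
  refine ⟨α, LinearMap.ext fun f => ?_⟩
  have h := congrArg (symplecticFourier n) (hα (symplecticFourier n f))
  simp only [ContinuousLinearMap.comp_apply, hF, map_smul] at h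
  rw [← hBL, h, map_smul, LinearMap.smul_apply]

end Schur

end SiegelWeil

end

theorem mainTheorem4 (n : ℕ) :
    (∀ g : ASp n, ∃ h : siegelUpper n → ℂ, IsDetBranch g h) ∧
    ∃ J : L2 n →ₗ[ℂ] (AZpos n × AZneg n → ℂ),
      (∀ (f : L2 n) (z : AZpos n × AZneg n),
        Integrable (fun v : Phase n => f v * kernel z v) ∧
        J f z = ∫ v : Phase n, f v * kernel z v) ∧
      Function.Injective J ∧
      Set.range J = HTensor n ∧
      (∀ f : L2 n, hNorm (J f) = (4 * Real.pi) ^ (-(n : ℝ) / 2) * ‖f‖) ∧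
      (∀ f : L2 n, IsHolomorphic (J f)) ∧
      Intertwines J ∧
      (∀ L : L2 n →ₗ[ℂ] (AZpos n × AZneg n → ℂ),
        (∀ f, L f ∈ HTensor n) → (∃ C : ℝ, ∀ f, hNorm (L f) ≤ C * ‖f‖) → Intertwines L →
        ∃ α : ℂ, L = α • J) := by
  refine ⟨exists_isDetBranch, transform n, fun f z => ⟨integrable_mul_kernel f z,
    transform_apply f z⟩, transform_injective, range_transform, hNorm_transform, fun f => ?_,
    intertwines_transform, fun L hL ⟨C, hC⟩ hT => exists_eq_smul_transform hL hC hT⟩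
  rw [transform_eq_tensorTransform]
  exact isHolomorphic_tensorTransform _
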